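/- **Setting.** Let $x:\mathbb R\to\mathbb R$ relate the outgoing coordinate $y$ to the incoming coordinate $x(y)$; for the relativistic black hole $x(y)=-e^{-y}$ and for the CGHS black hole $x(y)=-\log(1+e^{-y})$. Write $\tilde h(k)=\frac1{\sqrt{2\pi}}\int e^{-ikt}h(t)\,dt$. On the bosonic Fock space over $L^2(\frac{dk}{2k},\mathbb R_+)$ with vacuum $\Omega_o$ and $[a(k),a^\dagger(k')]=2k\,\delta(k-k')$, let $\phi(x)=\frac1{\sqrt{2\pi}}\int_0^\infty\frac{dk}{2k}\,[a(k)e^{-ikx}+a^\dagger(k)e^{ikx}]$ be the real massless (right-moving) field, $\phi[h]=\int h(x)\phi(x)\,dx$ and $\hat\phi[f]=\int f(y)\,\phi(x(y))\,dy$. Let $g:\mathbb R\to\mathbb C$ be integrable with $\tilde g(k)=0$ for $k<0$ and $\int_0^\infty\frac{dk}{2k}|\tilde g(k)|^2=1$, and put $\Omega_g=\phi[g]^\dagger\Omega_o$, $\bar N_g[f]=\|\hat\phi[f]\Omega_g\|^2\in[0,\infty]$, $\bar N_o[f]=\|\hat\phi[f]\Omega_o\|^2\in[0,\infty]$, $\hat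 g(y)=x'(y)\,g(x(y))$ and $G(x)=\int_{-\infty}^x g$. For $p\ge 0$ the outgoing mode $f_p$ is the improper wave function $\tilde f_p(q)=2q\,\delta(q-p)$, $q\geq 0$. The values $\bar N_g[f_p]$, $\bar N_o[f_p]$ and $(\bar N_g-\bar N_o)[f_p]$ are the limits of $\bar N_g[f]$, $\bar N_o[f]$ and $\bar N_g[f]-\bar N_o[f]$ along wave packets $\tilde f(q)=2q\,\eta(q)$, where $\eta$ is a smooth probability density with compact support in $(0,\infty)$ whose support shrinks to $p$. (When a limit is not asserted to exist, the upper limit is meant.) Put $\bar N^{tot}=\int_0^\infty\frac{dp}{2p}\,\bar N[f_p]\in[0,\infty]$, and let the difference of the total numbers be $(\bar N_g-\bar N_o)^{tot}=\int_0^\infty\frac{dp}{2p}\,(\bar N_g-\bar N_o)[f_p]$, which has a meaning even if both total numbers are infinite. Finally put $\|\tilde{\hat g}\|^2=\int_{-\infty}^{\infty}\frac{dp}{2|p|}\,|\tilde{\hat g}(p)|^2\in[0,\infty]$. **Theorem.** For both black holes: 1. For every $p\ge 0$ the three limits exist (the first two in $[0,\infty]$, the third in $[0,\infty)$), and $$\bar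 N_g[f_p]\le\bar N_o[f_p]+\frac1\pi\|g\|^2_{L^1(\mathbb R_-)},\qquad 0\le(\bar N_g-\bar N_o)[f_p]\le\frac1\pi\|g\|^2_{L^1(\mathbb R_-)}.$$ 2. $\bar N_g^{tot}=\bar N_o^{tot}+\|\tilde{\hat g}\|^2$ and $(\bar N_g-\bar N_o)^{tot}=\|\tilde{\hat g}\|^2$. 3. $\bar N_g^{tot}=\infty$. 4. If moreover $\tilde g$ is a Schwartz function, then $(\bar N_g-\bar N_o)^{tot}$ is finite if and only if $G(0)=0$. Moreover, the equation $\bar N_g^{tot}=\bar N_o^{tot}+\|\tilde{\hat g}\|^2$ holds for every smooth $x:\mathbb R\to\mathbb R$ with $x'>0$. -/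

import Mathlib

open Real Set Filter Topology MeasureTheory
open scoped ENNReal ContDiff SchwartzMap

noncomputable section

namespace StimulatedEmission

/-! ### The two black holes -/

/-- The two black-hole models. -/
inductive BlackHole
  | relativistic
  | cghs

/-- The incoming coordinate `x` as a function of the outgoing coordinate `y`
(units in which the parameters of the models are `M = λ = 1`, `Δ = x₀⁺ = 0`). -/
def BlackHole.coord : BlackHole → ℝ → ℝ
  | .relativistic, y => -Real.exp (-y)
  | .cghs, y => -Real.log (1 + Real.exp (-y))

/-! ### Bosonic Fock space over `L²(dk/2k, ℝ₊)`

A vector is represented by its family of `n`-particle wave functions. The squared norm takes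
values in `[0, ∞]`, so it is meaningful also for vectors of infinite norm. -/

/-- The measure `dk / (2k)` on `(0, ∞)`. -/
def momentumMeasure : Measure ℝ :=
  (volume.restrict (Ioi (0 : ℝ))).withDensity (fun k => ENNReal.ofReal (1 / (2 * k)))

/-- Families of `n`-particle wave functions in momentum space. -/
abbrev FockVector : Type := (n : ℕ) → (Fin n → ℝ) → ℂ

/-- The squared norm `∑ₙ ∫ |ψₙ(k₁, …, kₙ)|² ∏ dkᵢ/2kᵢ`. -/
def fockNormSq (ψ : FockVector) : ℝ≥0∞ :=
  ∑' n : ℕ, ∫⁻ κ : Fin n → ℝ, ‖ψ n κ‖ₑ ^ 2 ∂(Measure.pi fun _ => momentumMeasure)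

/-- The vacuum. -/
def vacuum : FockVector
  | 0, _ => 1
  | _ + 1, _ => 0

/-- `∫ dk/2k β(k) a†(k)`. -/
def creation (β : ℝ → ℂ) (ψ : FockVector) : FockVector
  | 0, _ => 0
  | n + 1, κ => (1 / (Real.sqrt (n + 1) : ℂ)) * ∑ i : Fin (n + 1), β (κ i) * ψ n (i.removeNth κ)

/-- `∫ dk/2k α(k) a(k)`, normalised by `[a(k), a†(k')] = 2k δ(k - k')`. -/
def annihilation (α : ℝ → ℂ) (ψ : FockVector) : FockVector :=
  fun n κ => (Real.sqrt (n + 1) : ℂ) * ∫ k, α k * ψ (n + 1) (Fin.cons k κ) ∂momentumMeasure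

/-! ### The (right moving, real, massless) scalar field

The field is `φ(x) = (2π)^(-1/2) ∫ dk/2k [a(k) e^{-ikx} + a†(k) e^{ikx}]`. -/

/-- The function `k ↦ (2π)^(-1/2) ∫ e^{-ik x(y)} f(y) dy`. For `x = id` it is the Fourier
transform of `f`. In general it is the Fourier transform of the incoming test function
`f(y(x)) y'(x)` to which the outgoing test function `f` corresponds. -/
def incomingMomentum (x : ℝ → ℝ) (f : ℝ → ℂ) (k : ℝ) : ℂ :=
  (1 / (Real.sqrt (2 * π) : ℂ)) * ∫ y, Complex.exp (-(Complex.I * k * x y)) * f y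

/-- The Fourier transform `(2π)^(-1/2) ∫ e^{-ikx} f(x) dx`. -/
def momentum (f : ℝ → ℂ) : ℝ → ℂ := incomingMomentum id f

/-- The outgoing field `∫ f(y) φ(x(y)) dy`, smeared with `f`, where `x = x(y)`. -/
def outField (x : ℝ → ℝ) (f : ℝ → ℂ) (ψ : FockVector) : FockVector :=
  annihilation (incomingMomentum x f) ψ + creation (fun k => incomingMomentum x f (-k)) ψ

/-- The incoming field `φ[h] = ∫ h(x) φ(x) dx`. -/
def inField (h : ℝ → ℂ) (ψ : FockVector) : FockVector := outField id h ψ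

/-- The incoming one-particle state `φ[g]† Ω₀ = φ[g*] Ω₀`. -/
def oneParticle (g : ℝ → ℂ) : FockVector := inField (fun t => starRingEnd ℂ (g t)) vacuum

/-- The mean number `(ψ, φ̂[f]† φ̂[f] ψ) = ‖φ̂[f] ψ‖²` of outgoing particles with wave
function `f` in the state `ψ`. -/
def meanNumber (x : ℝ → ℝ) (ψ : FockVector) (f : ℝ → ℂ) : ℝ≥0∞ := fockNormSq (outField x f ψ)

/-- Incoming normalized test functions: integrable functions whose Fourier transform vanishes for
negative momentum and has norm one in `L²(dk/2k, ℝ₊)`. -/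
structure IsIncomingWave (g : ℝ → ℂ) : Prop where
  integrable : Integrable g
  momentum_neg : ∀ k < 0, momentum g k = 0
  normalized : ∫⁻ k, ‖momentum g k‖ₑ ^ 2 ∂momentumMeasure = 1

/-! ### Outgoing modes

The mode `f_p` is the improper wave function with Fourier transform `2q δ(q - p)`, `q ≥ 0`.
It is approached by proper wave functions with Fourier transform `2q η(q)`, where the
smooth densities `η` on `(0, ∞)` concentrate at `p`. -/

/-- The outgoing wave function with Fourier transform `q ↦ 2q η(q)`. -/
def wavePacket (η : ℝ → ℝ) (y : ℝ) : ℂ :=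
  (1 / (Real.sqrt (2 * π) : ℂ)) * ∫ q : ℝ, Complex.exp (Complex.I * q * y) * (2 * q * η q : ℝ)

/-- `η` is a smooth probability density with compact support in `(0, ∞)` and within distance `ε`
of `p`. -/
structure IsDensityNear (p ε : ℝ) (η : ℝ → ℝ) : Prop where
  smooth : ContDiff ℝ ∞ η
  compact : HasCompactSupport η
  support : tsupport η ⊆ Ioi 0 ∩ Metric.ball p ε
  nonneg : ∀ q, 0 ≤ η q
  integral_one : ∫ q, η q = 1

/-- The filter "`η → δ(· - p)`". -/
def modeFilter (p : ℝ) : Filter (ℝ → ℝ) :=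
  ⨅ ε : {ε : ℝ // 0 < ε}, 𝓟 {η | IsDensityNear p ε η}

/-- The mean number of particles in the outgoing mode `f_p`: the limit of the mean numbers for
wave packets that approach `f_p`. -/
def modeNumber (x : ℝ → ℝ) (ψ : FockVector) (p : ℝ) : ℝ≥0∞ :=
  limsup (fun η => meanNumber x ψ (wavePacket η)) (modeFilter p)

/-- The total mean number `∫ dp/2p N[f_p]`. -/
def totalNumber (x : ℝ → ℝ) (ψ : FockVector) : ℝ≥0∞ :=
  ∫⁻ p, modeNumber x ψ p ∂momentumMeasure

/-- The difference of the mean numbers in the states `ψ` and vacuum. In `EReal`, `∞ - ∞ = -∞`,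
so that a nonnegative value means that the vacuum term is finite. -/
def extraNumber (x : ℝ → ℝ) (ψ : FockVector) (f : ℝ → ℂ) : EReal :=
  (meanNumber x ψ f : EReal) - (meanNumber x vacuum f : EReal)

/-- The mean number of extra particles in the mode `f_p` (as a limit over wave packets). -/
def modeExtra (x : ℝ → ℝ) (ψ : FockVector) (p : ℝ) : EReal :=
  limsup (fun η => extraNumber x ψ (wavePacket η)) (modeFilter p)

/-- The total mean number of extra particles `∫ dp/2p (N_ψ[f_p] - N_o[f_p])`, that is the
difference of the two total mean numbers, also when both are infinite. -/
def totalExtra (x : ℝ → ℝ) (ψ : FockVector) : ℝ≥0∞ :=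
  ∫⁻ p, (modeExtra x ψ p).toENNReal ∂momentumMeasure

/-! ### Quantities in the bounds -/

/-- The outgoing function `x'(y) g(x(y))`. -/
def outgoing (x : ℝ → ℝ) (g : ℝ → ℂ) (y : ℝ) : ℂ := ((deriv x y : ℝ) : ℂ) * g (x y)

/-- The squared norm `∫ |h(p)|² dp / (2|p|)` over the whole line. -/
def momentumNormSq (h : ℝ → ℂ) : ℝ≥0∞ := ∫⁻ p : ℝ, ‖h p‖ₑ ^ 2 / ENNReal.ofReal (2 * |p|)

/-- The bound `(1/π) ‖g‖²` with the norm of `L¹(ℝ₋)`. -/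
def modeBound (g : ℝ → ℂ) : ℝ≥0∞ :=
  ENNReal.ofReal (1 / π) * (∫⁻ t in Iio (0 : ℝ), ‖g t‖ₑ) ^ 2

/-- The primitive `G(x) = ∫_{-∞}^x g`. -/
def primitive (g : ℝ → ℂ) (t : ℝ) : ℂ := ∫ s in Iic t, g s

end StimulatedEmission

end

open StimulatedEmission

noncomputable section

namespace StimulatedEmission

/-! ### Square-integrable functions -/

section SquareIntegrable

variable {α : Type*} [MeasurableSpace α] {μ : Measure α}

/-! Write `F` for `incomingMomentum x f`, `G` for `primitive g` and `h` for `outgoing x g`. The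
field maps a one-particle state into the sectors with zero and two particles. The first contributes
an overlap of `F(k)` with the wave function. The second is a symmetrised product, whose squared norm
is the vacuum number plus the square of an overlap of `F(-k)` (`meanNumber_oneParticle_eq`). So the
number in the state of `g` is the vacuum number plus two squared overlaps.

Both overlaps have simple forms in position space. Since the transform of `g` vanishes on negative
momenta, an integral of `1/k` over the half line is an integral over the whole line, where the
Fourier transform of `1/k` is a sign function; integrating the sign against `g` gives `G`. Up to
phases the overlaps are half the integrals of `f` against `G ∘ x` and its conjugate
(`integral_incomingMomentum_mul_conj`). The absolute convergence needed here follows from a finite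
vacuum number, because positive frequencies are controlled by negative ones
(`lintegral_oscIntegral_lt_top`). If the vacuum number is infinite, both sides are infinite.

A wave packet is the derivative of a Schwartz function, and integration by parts turns `G ∘ x` into
`h` (`integral_wavePacket_mul`). The extra number becomes the sum of the squares of the transform of
`h` averaged near `p` and near `-p`, and tends to `modeLimit`. Integration over `dp/2p` yields the
norm on the whole line for any smooth increasing `x`. For black holes the range of `x` is the
negative half line, so the sup bound on the transform gives the bound for each mode.

The difference of numbers makes sense because each proper packet has a finite vacuum number: in `s =
log k` the amplitude is `O(1/(1+|s|))` (`meanNumber_vacuum_lt_top`). The sharp modes have infinite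
vacuum number: their amplitudes are explicit in terms of Gamma functions and stay away from zero as
`k → ∞`, so `dk/2k` diverges logarithmically (`tendsto_meanNumber_vacuum`).

Finiteness of the extra total is decided at `p = 0`, where the transform of `h` is a multiple of
`G(0)`. If it is nonzero, `dp/2p` diverges there; if it vanishes and `g` is Schwartz up to a null
set, the transform is `O(|p|)` at zero and `O(1/|p|)` at infinity
(`lintegral_modeLimit_lt_top_iff`). -/

lemma memLp_two_iff_lintegral {f : α → ℂ} (hf : AEStronglyMeasurable f μ) :
    MemLp f 2 μ ↔ ∫⁻ a, ‖f a‖ₑ ^ 2 ∂μ < ⊤ := by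
  have h := eLpNorm_lt_top_iff_lintegral_rpow_enorm_lt_top (f := f) (μ := μ) (p := 2)
    (by norm_num) (by norm_num)
  simp only [ENNReal.toReal_ofNat, ENNReal.rpow_two] at h
  exact ⟨fun hm => h.1 hm.2, fun hl => ⟨hf, h.2 hl⟩⟩

lemma lintegral_enorm_sq {f : α → ℂ} (hf : MemLp f 2 μ) :
    ∫⁻ a, ‖f a‖ₑ ^ 2 ∂μ = ENNReal.ofReal (∫ a, ‖f a‖ ^ 2 ∂μ) := by
  rw [ofReal_integral_eq_lintegral_ofReal ((memLp_two_iff_integrable_sq_norm hf.1).1 hf)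
    (Eventually.of_forall fun a => by positivity)]
  refine lintegral_congr fun a => ?_
  rw [ENNReal.ofReal_pow (norm_nonneg _), ofReal_norm]

lemma MemLp.integrable_mul_conj {f h : α → ℂ} (hf : MemLp f 2 μ) (hh : MemLp h 2 μ) :
    Integrable (fun a => f a * starRingEnd ℂ (h a)) μ :=
  hf.integrable_mul hh.star

/-- The norm of a symmetrised product. -/
lemma lintegral_symmetrized [SigmaFinite μ] {β ψ : α → ℂ} (hβ : Measurable β) (hψ : Measurable ψ)
    (h1 : ∫⁻ a, ‖ψ a‖ₑ ^ 2 ∂μ = 1) :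
    ∫⁻ z : α × α, ‖β z.1 * ψ z.2 + β z.2 * ψ z.1‖ₑ ^ 2 ∂(μ.prod μ) =
      2 * (∫⁻ a, ‖β a‖ₑ ^ 2 ∂μ + ‖∫ a, β a * starRingEnd ℂ (ψ a) ∂μ‖ₑ ^ 2) := by
  have hψ2 : MemLp ψ 2 μ := (memLp_two_iff_lintegral hψ.aestronglyMeasurable).2 (by simp [h1])
  have hmeas : Measurable fun z : α × α => β z.1 * ψ z.2 + β z.2 * ψ z.1 := by fun_prop
  by_cases hb : ∫⁻ a, ‖β a‖ₑ ^ 2 ∂μ < ⊤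
  · have hβ2 : MemLp β 2 μ := (memLp_two_iff_lintegral hβ.aestronglyMeasurable).2 hb
    have iβ := (memLp_two_iff_integrable_sq_norm hβ2.1).1 hβ2
    have iψ := (memLp_two_iff_integrable_sq_norm hψ2.1).1 hψ2
    have nψ : ∫ a, ‖ψ a‖ ^ 2 ∂μ = 1 := by
      rw [lintegral_enorm_sq hψ2, ENNReal.ofReal_eq_one] at h1
      exact h1
    set I : ℂ := ∫ a, β a * starRingEnd ℂ (ψ a) ∂μ with hI
    have i1 : Integrable (fun z : α × α => ‖β z.1‖ ^ 2 * ‖ψ z.2‖ ^ 2) (μ.prod μ) :=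
      iβ.mul_prod iψ
    have i2 : Integrable (fun z : α × α => ‖ψ z.1‖ ^ 2 * ‖β z.2‖ ^ 2) (μ.prod μ) :=
      iψ.mul_prod iβ
    -- The cross term of the square separates into a function of each variable; the two factors
    -- integrate to the overlap and its conjugate.
    have i3 : Integrable (fun z : α × α => (β z.1 * starRingEnd ℂ (ψ z.1)) *
        (ψ z.2 * starRingEnd ℂ (β z.2))) (μ.prod μ) :=
      (MemLp.integrable_mul_conj hβ2 hψ2).mul_prod (MemLp.integrable_mul_conj hψ2 hβ2)
    have e3 : ∫ z : α × α, (β z.1 * starRingEnd ℂ (ψ z.1)) *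
        (ψ z.2 * starRingEnd ℂ (β z.2)) ∂(μ.prod μ) = ((‖I‖ ^ 2 : ℝ) : ℂ) := by
      rw [integral_prod_mul (fun a => β a * starRingEnd ℂ (ψ a))
        (fun a => ψ a * starRingEnd ℂ (β a))]
      have : ∫ a, ψ a * starRingEnd ℂ (β a) ∂μ = starRingEnd ℂ I := by
        rw [hI, ← integral_conj]
        exact integral_congr_ae (Eventually.of_forall fun a => by simp [mul_comm])
      rw [this, Complex.mul_conj, Complex.normSq_eq_norm_sq]
    have key : ∀ z : α × α, ‖β z.1 * ψ z.2 + β z.2 * ψ z.1‖ ^ 2 =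
        ‖β z.1‖ ^ 2 * ‖ψ z.2‖ ^ 2 + ‖ψ z.1‖ ^ 2 * ‖β z.2‖ ^ 2 +
        2 * ((β z.1 * starRingEnd ℂ (ψ z.1)) * (ψ z.2 * starRingEnd ℂ (β z.2))).re := by
      intro z
      rw [← Complex.normSq_eq_norm_sq, Complex.normSq_add, Complex.normSq_eq_norm_sq,
        Complex.normSq_eq_norm_sq, norm_mul, norm_mul, mul_pow, mul_pow, map_mul,
        mul_comm (‖β z.2‖ ^ 2)]
      congr 3
      ring
    have i3' : Integrable (fun z : α × α => 2 * ((β z.1 * starRingEnd ℂ (ψ z.1)) *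
        (ψ z.2 * starRingEnd ℂ (β z.2))).re) (μ.prod μ) := i3.re.const_mul 2
    have i12 : Integrable (fun z : α × α => ‖β z.1‖ ^ 2 * ‖ψ z.2‖ ^ 2 +
        ‖ψ z.1‖ ^ 2 * ‖β z.2‖ ^ 2) (μ.prod μ) := i1.add i2
    have hint : Integrable (fun z : α × α => ‖β z.1 * ψ z.2 + β z.2 * ψ z.1‖ ^ 2) (μ.prod μ) := by
      simp_rw [key]
      exact i12.add i3'
    rw [lintegral_enorm_sq ((memLp_two_iff_integrable_sq_norm
      hmeas.aestronglyMeasurable).2 hint), lintegral_enorm_sq hβ2]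
    have e : ∫ z : α × α, ‖β z.1 * ψ z.2 + β z.2 * ψ z.1‖ ^ 2 ∂(μ.prod μ) =
        2 * (∫ a, ‖β a‖ ^ 2 ∂μ + ‖I‖ ^ 2) := by
      simp_rw [key]
      rw [integral_add i12 i3', integral_add i1 i2,
        integral_prod_mul (fun a => ‖β a‖ ^ 2) (fun a => ‖ψ a‖ ^ 2),
        integral_prod_mul (fun a => ‖ψ a‖ ^ 2) (fun a => ‖β a‖ ^ 2), nψ, integral_const_mul]
      have := congrArg Complex.re e3
      rw [← RCLike.re_eq_complex_re, ← integral_re i3] at this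
      simp only [RCLike.re_eq_complex_re, Complex.ofReal_re] at this
      rw [this]
      ring
    rw [e, ENNReal.ofReal_mul (by norm_num), ENNReal.ofReal_add
      (integral_nonneg fun a => by positivity) (by positivity),
      ENNReal.ofReal_pow (norm_nonneg _), ofReal_norm]
    norm_num
  · have hb' : ∫⁻ a, ‖β a‖ₑ ^ 2 ∂μ = ⊤ := not_lt_top_iff.1 hb
    rw [hb', top_add, ENNReal.mul_top (by norm_num)]
    by_contra hne
    rw [lintegral_prod_symm _ (by fun_prop)] at hne
    have hfin := ae_lt_top (Measurable.lintegral_prod_left' (f := fun z : α × α =>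
      ‖β z.1 * ψ z.2 + β z.2 * ψ z.1‖ₑ ^ 2) (by fun_prop)) hne
    -- If the double integral were finite, almost every slice would be. A slice at a point with `ψ b
    -- ≠ 0` expresses `β` through square-integrable functions.
    have hex : ∃ b, ψ b ≠ 0 ∧ ∫⁻ a, ‖β a * ψ b + β b * ψ a‖ₑ ^ 2 ∂μ < ⊤ := by
      by_contra hcon
      push Not at hcon
      have : ∀ᵐ b ∂μ, ‖ψ b‖ₑ ^ 2 = 0 := by
        filter_upwards [hfin] with b hbf
        by_contra h0
        exact absurd (hcon b fun h => h0 (by simp [h])) (not_le.2 hbf)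
      rw [lintegral_congr_ae this] at h1
      simp at h1
    obtain ⟨b, hb0, hbf⟩ := hex
    have m1 : MemLp (fun a => β a * ψ b + β b * ψ a) 2 μ :=
      (memLp_two_iff_lintegral (by fun_prop)).2 hbf
    have m2 : MemLp β 2 μ := by
      have h := (m1.sub (hψ2.const_mul (β b))).const_mul (ψ b)⁻¹
      refine h.congr_norm hβ.aestronglyMeasurable (Eventually.of_forall fun a => ?_)
      simp only [Pi.sub_apply, add_sub_cancel_right]
      congr 1
      field_simp
    exact hb ((memLp_two_iff_lintegral hβ.aestronglyMeasurable).1 m2)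

end SquareIntegrable

/-! ### The momentum measure -/

instance : SigmaFinite momentumMeasure := by
  unfold momentumMeasure
  infer_instance

lemma lintegral_momentumMeasure (h : ℝ → ℝ≥0∞) :
    ∫⁻ k, h k ∂momentumMeasure = ∫⁻ k in Ioi 0, ENNReal.ofReal (1 / (2 * k)) * h k := by
  rw [momentumMeasure, lintegral_withDensity_eq_lintegral_mul_non_measurable _ (by fun_prop)]
  · rfl
  · exact Eventually.of_forall fun _ => ENNReal.ofReal_lt_top

lemma integral_momentumMeasure (h : ℝ → ℂ) :
    ∫ k, h k ∂momentumMeasure = ∫ k in Ioi (0 : ℝ), (1 / (2 * k) : ℝ) * h k := by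
  rw [momentumMeasure, integral_withDensity_eq_integral_toReal_smul (by fun_prop)
    (Eventually.of_forall fun _ => ENNReal.ofReal_lt_top)]
  refine setIntegral_congr_fun measurableSet_Ioi fun k hk => ?_
  have : (0 : ℝ) < k := hk
  rw [ENNReal.toReal_ofReal (by positivity), Complex.real_smul]

lemma integrable_momentumMeasure {h : ℝ → ℂ} :
    Integrable h momentumMeasure ↔
      IntegrableOn (fun k : ℝ => ((1 / (2 * k) : ℝ) : ℂ) * h k) (Ioi 0) := by
  rw [momentumMeasure, integrable_withDensity_iff_integrable_smul' (by fun_prop)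
    (Eventually.of_forall fun _ => ENNReal.ofReal_lt_top), IntegrableOn]
  refine integrable_congr ?_
  filter_upwards [ae_restrict_mem measurableSet_Ioi] with k hk
  have : (0 : ℝ) < k := hk
  rw [ENNReal.toReal_ofReal (by positivity), Complex.real_smul]

lemma ae_momentumMeasure_pos : ∀ᵐ k ∂momentumMeasure, (0 : ℝ) < k :=
  (withDensity_absolutelyContinuous _ _).ae_le (ae_restrict_mem measurableSet_Ioi)

/-- The momentum measure is half the Lebesgue measure in logarithmic coordinates. -/
lemma lintegral_momentumMeasure_exp (h : ℝ → ℝ≥0∞) :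
    ∫⁻ k, h k ∂momentumMeasure = ∫⁻ s : ℝ, ENNReal.ofReal (1 / 2) * h (rexp s) := by
  have himg : Ioi (0 : ℝ) = rexp '' univ := by rw [image_univ, Real.range_exp]
  rw [lintegral_momentumMeasure, himg, lintegral_image_eq_lintegral_abs_deriv_mul
    MeasurableSet.univ (fun s _ => (Real.hasDerivAt_exp s).hasDerivWithinAt)
    Real.exp_injective.injOn, setLIntegral_univ]
  refine lintegral_congr fun s => ?_
  rw [← mul_assoc, ← ENNReal.ofReal_mul (abs_nonneg _), abs_of_pos (Real.exp_pos s)]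
  congr 2
  field_simp

/-! ### Mean numbers in terms of one-particle wave functions -/

lemma creation_vacuum (β : ℝ → ℂ) (κ : Fin 1 → ℝ) : creation β vacuum 1 κ = β (κ 0) := by
  simp [creation, vacuum]

lemma creation_vacuum_of_ne (β : ℝ → ℂ) {n : ℕ} (hn : n ≠ 1) : creation β vacuum n = 0 := by
  funext κ
  match n, hn with
  | 0, _ => rfl
  | n + 2, _ => simp [creation, vacuum]

lemma annihilation_vacuum (α : ℝ → ℂ) : annihilation α vacuum = 0 := by
  funext n κ
  simp [annihilation, vacuum]

lemma outField_vacuum (x : ℝ → ℝ) (f : ℝ → ℂ) :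
    outField x f vacuum = creation (fun k => incomingMomentum x f (-k)) vacuum := by
  rw [outField, annihilation_vacuum, zero_add]

lemma meanNumber_vacuum (x : ℝ → ℝ) (f : ℝ → ℂ) :
    meanNumber x vacuum f = ∫⁻ k, ‖incomingMomentum x f (-k)‖ₑ ^ 2 ∂momentumMeasure := by
  rw [meanNumber, fockNormSq, outField_vacuum, tsum_eq_single 1]
  · simp_rw [creation_vacuum]
    exact (measurePreserving_funUnique momentumMeasure (Fin 1)).lintegral_comp_emb
      (MeasurableEquiv.measurableEmbedding _) (fun k => ‖incomingMomentum x f (-k)‖ₑ ^ 2)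
  · intro n hn
    simp [creation_vacuum_of_ne _ hn]

lemma incomingMomentum_conj (x : ℝ → ℝ) (f : ℝ → ℂ) (k : ℝ) :
    incomingMomentum x (fun t => starRingEnd ℂ (f t)) k =
      starRingEnd ℂ (incomingMomentum x f (-k)) := by
  simp only [incomingMomentum, map_mul, ← integral_conj, ← Complex.exp_conj]
  simp

lemma oneParticle_one (g : ℝ → ℂ) (κ : Fin 1 → ℝ) :
    oneParticle g 1 κ = starRingEnd ℂ (momentum g (κ 0)) := by
  rw [oneParticle, inField, outField_vacuum, creation_vacuum, incomingMomentum_conj, neg_neg]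
  rfl

lemma oneParticle_of_ne (g : ℝ → ℂ) {n : ℕ} (hn : n ≠ 1) : oneParticle g n = 0 := by
  rw [oneParticle, inField, outField_vacuum, creation_vacuum_of_ne _ hn]

lemma outField_oneParticle_zero (x : ℝ → ℝ) (f g : ℝ → ℂ) (κ : Fin 0 → ℝ) :
    outField x f (oneParticle g) 0 κ =
      ∫ k, incomingMomentum x f k * starRingEnd ℂ (momentum g k) ∂momentumMeasure := by
  simp [outField, annihilation, creation, oneParticle_one]

lemma outField_oneParticle_two (x : ℝ → ℝ) (f g : ℝ → ℂ) (κ : Fin 2 → ℝ) :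
    outField x f (oneParticle g) 2 κ = (1 / (Real.sqrt 2 : ℂ)) *
      (incomingMomentum x f (-κ 0) * starRingEnd ℂ (momentum g (κ 1)) +
        incomingMomentum x f (-κ 1) * starRingEnd ℂ (momentum g (κ 0))) := by
  simp only [outField, Pi.add_apply, annihilation, creation]
  simp only [oneParticle_of_ne g (show 2 + 1 ≠ 1 by norm_num), Pi.zero_apply, mul_zero,
    integral_zero, zero_add, oneParticle_one, Fin.removeNth_apply]
  norm_num [Fin.succAbove, Fin.sum_univ_succ]

lemma outField_oneParticle_of_ne (x : ℝ → ℝ) (f g : ℝ → ℂ) {n : ℕ} (h0 : n ≠ 0) (h2 : n ≠ 2) :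
    outField x f (oneParticle g) n = 0 := by
  obtain ⟨m, rfl⟩ := Nat.exists_eq_succ_of_ne_zero h0
  funext κ
  simp [outField, annihilation, creation, oneParticle_of_ne g (show m + 1 + 1 ≠ 1 by omega),
    oneParticle_of_ne g (show m ≠ 1 by omega)]

/-- Only the sectors with zero and two particles are reached. In the latter the factor `1/√2` of the
creation operator cancels the 2 of `lintegral_symmetrized`, so no finiteness of the vacuum number is
needed. -/
lemma meanNumber_oneParticle_eq (x : ℝ → ℝ) (f g : ℝ → ℂ)
    (hF : Measurable (incomingMomentum x f)) (hgm : Measurable (momentum g))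
    (hg : ∫⁻ k, ‖momentum g k‖ₑ ^ 2 ∂momentumMeasure = 1) :
    meanNumber x (oneParticle g) f = meanNumber x vacuum f +
      (‖∫ k, incomingMomentum x f k * starRingEnd ℂ (momentum g k) ∂momentumMeasure‖ₑ ^ 2 +
        ‖∫ k, incomingMomentum x f (-k) * momentum g k ∂momentumMeasure‖ₑ ^ 2) := by
  have hsqrt : ‖(1 / (Real.sqrt 2 : ℂ))‖ₑ ^ 2 = 2⁻¹ := by
    rw [← ofReal_norm, ← ENNReal.ofReal_pow (norm_nonneg _)]
    rw [norm_div, norm_one, Complex.norm_real, Real.norm_of_nonneg (Real.sqrt_nonneg _), div_pow,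
      Real.sq_sqrt (by norm_num), one_pow, one_div, ENNReal.ofReal_inv_of_pos (by norm_num)]
    norm_num
  have hcomm : (2 : ℝ≥0∞)⁻¹ * 2 = 1 := ENNReal.inv_mul_cancel (by norm_num) (by norm_num)
  rw [meanNumber, fockNormSq, tsum_eq_sum (s := {0, 2}), Finset.sum_pair (by norm_num),
    meanNumber_vacuum]
  · have e0 : ∫⁻ κ : Fin 0 → ℝ, ‖outField x f (oneParticle g) 0 κ‖ₑ ^ 2
        ∂(Measure.pi fun _ => momentumMeasure) =
        ‖∫ k, incomingMomentum x f k * starRingEnd ℂ (momentum g k) ∂momentumMeasure‖ₑ ^ 2 := by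
      simp only [outField_oneParticle_zero]
      rw [lintegral_const, Measure.pi_of_empty]
      simp
    have e2 : ∫⁻ κ : Fin 2 → ℝ, ‖outField x f (oneParticle g) 2 κ‖ₑ ^ 2
        ∂(Measure.pi fun _ => momentumMeasure) =
        ∫⁻ k, ‖incomingMomentum x f (-k)‖ₑ ^ 2 ∂momentumMeasure +
          ‖∫ k, incomingMomentum x f (-k) * momentum g k ∂momentumMeasure‖ₑ ^ 2 := by
      simp only [outField_oneParticle_two, enorm_mul, mul_pow, hsqrt]
      have hp := (measurePreserving_finTwoArrow momentumMeasure).lintegral_comp_emb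
        (MeasurableEquiv.measurableEmbedding _) (fun z : ℝ × ℝ => 2⁻¹ *
          ‖incomingMomentum x f (-z.1) * starRingEnd ℂ (momentum g z.2) +
            incomingMomentum x f (-z.2) * starRingEnd ℂ (momentum g z.1)‖ₑ ^ 2)
      refine Eq.trans hp ?_
      have hc : Measurable fun k => starRingEnd ℂ (momentum g k) :=
        Complex.continuous_conj.measurable.comp hgm
      have hFn : Measurable fun k => incomingMomentum x f (-k) := hF.comp measurable_neg
      rw [lintegral_const_mul' _ _ (by norm_num)]
      rw [lintegral_symmetrized hFn hc (by simpa using hg), ← mul_assoc, hcomm, one_mul]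
      simp
    rw [e0, e2]
    ring
  · intro n hn
    simp only [Finset.mem_insert, Finset.mem_singleton, not_or] at hn
    simp [outField_oneParticle_of_ne x f g hn.1 hn.2]

/-! ### Oscillatory integrals -/

/-- The integral `∫ e^{-ikX} f`. -/
def oscIntegral {α : Type*} [MeasurableSpace α] (ν : Measure α) (X : α → ℝ) (f : α → ℂ)
    (k : ℝ) : ℂ := ∫ a, Complex.exp (-(Complex.I * k * X a)) * f a ∂ν

lemma incomingMomentum_eq (x : ℝ → ℝ) (f : ℝ → ℂ) (k : ℝ) :
    incomingMomentum x f k = (1 / (Real.sqrt (2 * π) : ℂ)) * oscIntegral volume x f k := rfl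

lemma norm_exp_neg_I_mul (k t : ℝ) : ‖Complex.exp (-(Complex.I * k * t))‖ = 1 := by
  rw [Complex.norm_exp]
  simp

section Osc

variable {α : Type*} [MeasurableSpace α] {ν : Measure α} {X : α → ℝ} {f : α → ℂ}

lemma integrable_osc (hX : Measurable X) (hf : Integrable f ν) (k : ℝ) :
    Integrable (fun a => Complex.exp (-(Complex.I * k * X a)) * f a) ν := by
  refine hf.bdd_mul (c := 1) (by fun_prop) (Eventually.of_forall fun a => ?_)
  exact (norm_exp_neg_I_mul _ _).le

lemma norm_oscIntegral_le (k : ℝ) : ‖oscIntegral ν X f k‖ ≤ ∫ a, ‖f a‖ ∂ν := by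
  refine (norm_integral_le_integral_norm _).trans_eq ?_
  simp [norm_exp_neg_I_mul]

lemma continuous_oscIntegral (hX : Measurable X) (hf : Integrable f ν) :
    Continuous (oscIntegral ν X f) := by
  refine continuous_of_dominated (bound := fun a => ‖f a‖)
    (fun k => (integrable_osc hX hf k).aestronglyMeasurable)
    (fun k => Eventually.of_forall fun a => ?_) hf.norm (Eventually.of_forall fun a => ?_)
  · simp [norm_exp_neg_I_mul]
  · fun_prop

/-- Fubini, with conjugation reversing a phase. It makes `|F|²` and products of two transforms
accessible to `integral_cutoff_mul_osc_sub`, which treats a single oscillatory integral. -/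
lemma oscIntegral_prod {γ : Type*} [MeasurableSpace γ] {ξ : Measure γ} [SFinite ν] [SFinite ξ]
    (Y : γ → ℝ) (h : γ → ℂ) (k : ℝ) :
    oscIntegral (ν.prod ξ) (fun z => X z.1 - Y z.2) (fun z => f z.1 * starRingEnd ℂ (h z.2)) k =
      oscIntegral ν X f k * starRingEnd ℂ (oscIntegral ξ Y h k) := by
  rw [oscIntegral, oscIntegral, oscIntegral, ← integral_conj, ← integral_prod_mul]
  congr 1
  funext z
  rw [map_mul, ← Complex.exp_conj]
  have : Complex.exp (-(Complex.I * k * ((X z.1 - Y z.2 : ℝ) : ℂ))) =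
      Complex.exp (-(Complex.I * k * X z.1)) *
        Complex.exp (starRingEnd ℂ (-(Complex.I * k * Y z.2))) := by
    rw [← Complex.exp_add]
    congr 1
    simp
    ring
  rw [this]
  ring

end Osc

lemma continuous_incomingMomentum {x : ℝ → ℝ} {f : ℝ → ℂ} (hx : Measurable x)
    (hf : Integrable f) : Continuous (incomingMomentum x f) :=
  continuous_const.mul (continuous_oscIntegral hx hf)

lemma norm_incomingMomentum_le (x : ℝ → ℝ) (f : ℝ → ℂ) (k : ℝ) :
    ‖incomingMomentum x f k‖ ≤ 1 / Real.sqrt (2 * π) * ∫ a, ‖f a‖ := by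
  rw [incomingMomentum_eq, norm_mul, norm_div, norm_one, Complex.norm_real,
    Real.norm_of_nonneg (Real.sqrt_nonneg _)]
  gcongr
  exact norm_oscIntegral_le k

/-! ### Regularised inverse of the momentum -/

/-- A regularisation of `1/k`, which is integrable on `(0, ∞)`. -/
def cutoff (ε k : ℝ) : ℝ := ∫ a in ε..ε⁻¹, rexp (-(a * k))

lemma cutoff_eq (ε : ℝ) {k : ℝ} (hk : k ≠ 0) :
    cutoff ε k = (rexp (-(ε * k)) - rexp (-(ε⁻¹ * k))) / k := by
  have h : ∀ a ∈ uIcc ε ε⁻¹, HasDerivAt (fun a => -(rexp (-(a * k)) / k)) (rexp (-(a * k))) a := by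
    intro a _
    have := (((hasDerivAt_id a).mul_const k).neg.exp.div_const k).neg
    refine this.congr_deriv ?_
    simp only [id, Pi.neg_apply]
    field_simp
  rw [cutoff, intervalIntegral.integral_eq_sub_of_hasDerivAt h
    (by apply Continuous.intervalIntegrable; fun_prop)]
  ring

lemma cutoff_nonneg {ε : ℝ} (h0 : 0 < ε) (h1 : ε ≤ 1) (k : ℝ) : 0 ≤ cutoff ε k :=
  intervalIntegral.integral_nonneg (h1.trans ((one_le_inv₀ h0).2 h1)) fun _ _ => (Real.exp_pos _).le

lemma cutoff_le_inv {ε : ℝ} (h0 : 0 < ε) {k : ℝ} (hk : 0 < k) : cutoff ε k ≤ 1 / k := by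
  rw [cutoff_eq ε hk.ne']
  gcongr
  have h1 : rexp (-(ε * k)) ≤ 1 := Real.exp_le_one_iff.2 (by nlinarith)
  have h2 := Real.exp_pos (-(ε⁻¹ * k))
  linarith

lemma cutoff_le_exp {ε : ℝ} (h0 : 0 < ε) (h1 : ε ≤ 1) {k : ℝ} (hk : 0 < k) :
    cutoff ε k ≤ ε⁻¹ * rexp (-ε * k) := by
  have hle : ε ≤ ε⁻¹ := h1.trans ((one_le_inv₀ h0).2 h1)
  have : cutoff ε k ≤ ∫ _ in ε..ε⁻¹, rexp (-ε * k) := by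
    refine intervalIntegral.integral_mono_on hle
      (by apply Continuous.intervalIntegrable; fun_prop) (by simp) fun a ha => ?_
    gcongr
    nlinarith [ha.1]
  rw [intervalIntegral.integral_const, smul_eq_mul] at this
  refine this.trans ?_
  gcongr
  linarith

lemma tendsto_cutoff {k : ℝ} (hk : 0 < k) :
    Tendsto (fun ε => cutoff ε k) (𝓝[>] 0) (𝓝 (1 / k)) := by
  have h1 : Tendsto (fun ε : ℝ => rexp (-(ε * k))) (𝓝[>] 0) (𝓝 1) := by
    have : Continuous fun ε : ℝ => rexp (-(ε * k)) := by fun_prop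
    simpa using (this.tendsto 0).mono_left nhdsWithin_le_nhds
  have h2 : Tendsto (fun ε : ℝ => rexp (-(ε⁻¹ * k))) (𝓝[>] 0) (𝓝 0) :=
    Real.tendsto_exp_neg_atTop_nhds_zero.comp (tendsto_inv_nhdsGT_zero.atTop_mul_const hk)
  have := (h1.sub h2).div_const k
  rw [sub_zero] at this
  exact this.congr fun ε => (cutoff_eq ε hk.ne').symm

lemma measurable_cutoff (ε : ℝ) : Measurable (cutoff ε) := by
  have : Continuous (cutoff ε) := by
    unfold cutoff
    apply intervalIntegral.continuous_parametric_intervalIntegral_of_continuous'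
    fun_prop
  exact this.measurable

lemma integrableOn_cutoff {ε : ℝ} (h0 : 0 < ε) (h1 : ε ≤ 1) : IntegrableOn (cutoff ε) (Ioi 0) := by
  refine Integrable.mono' (g := fun k => ε⁻¹ * rexp (-ε * k))
    ((integrableOn_exp_mul_Ioi (neg_lt_zero.2 h0) 0).const_mul _)
    (measurable_cutoff ε).aestronglyMeasurable ?_
  filter_upwards [ae_restrict_mem measurableSet_Ioi] with k hk
  rw [Real.norm_of_nonneg (cutoff_nonneg h0 h1 k)]
  exact cutoff_le_exp h0 h1 hk

lemma integral_exp_mul_sin {a : ℝ} (ha : 0 < a) (s : ℝ) :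
    ∫ k in Ioi (0 : ℝ), rexp (-(a * k)) * Real.sin (k * s) = s / (a ^ 2 + s ^ 2) := by
  have hre : (-(a : ℂ) + s * Complex.I).re < 0 := by simp [ha]
  have h := integral_exp_mul_complex_Ioi hre 0
  have hint := integrableOn_exp_mul_complex_Ioi hre 0
  have him := congrArg Complex.im h
  rw [← RCLike.im_eq_complex_im, ← integral_im hint] at him
  have e : ∀ k : ℝ, RCLike.im (Complex.exp ((-(a : ℂ) + s * Complex.I) * k)) =
      rexp (-(a * k)) * Real.sin (k * s) := by
    intro k
    rw [RCLike.im_eq_complex_im, Complex.exp_im]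
    simp [mul_comm]
  simp_rw [e] at him
  rw [him]
  simp [Complex.div_im, Complex.normSq_apply]
  have : a ^ 2 + s ^ 2 ≠ 0 := by positivity
  have : a * a + s * s ≠ 0 := by nlinarith [mul_pos ha ha, mul_self_nonneg s]
  field_simp

/-- An absolutely convergent form of the Dirichlet integral: the cutoff is an average of
exponentials, and after exchanging the integrals each one contributes `s / (a² + s²)`. The result is
bounded by `π` uniformly in `s` and `ε`. -/
lemma integral_cutoff_mul_sin {ε : ℝ} (h0 : 0 < ε) (h1 : ε ≤ 1) (s : ℝ) :
    ∫ k in Ioi (0 : ℝ), cutoff ε k * Real.sin (k * s) =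
      Real.arctan (s / ε) - Real.arctan (s * ε) := by
  have hle : ε ≤ ε⁻¹ := h1.trans ((one_le_inv₀ h0).2 h1)
  have hswap : ∫ k in Ioi (0 : ℝ), cutoff ε k * Real.sin (k * s) =
      ∫ a in Ioc ε ε⁻¹, ∫ k in Ioi (0 : ℝ), rexp (-(a * k)) * Real.sin (k * s) := by
    rw [← integral_integral_swap (f := fun k a => rexp (-(a * k)) * Real.sin (k * s))]
    · refine integral_congr_ae (Eventually.of_forall fun k => ?_)
      simp only
      rw [cutoff, intervalIntegral.integral_of_le hle, integral_mul_const]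
    · have hb : Integrable (fun z : ℝ × ℝ => rexp (-ε * z.1) * 1)
          ((volume.restrict (Ioi 0)).prod (volume.restrict (Ioc ε ε⁻¹))) :=
        Integrable.mul_prod (integrableOn_exp_mul_Ioi (neg_lt_zero.2 h0) 0)
          (integrable_const (1 : ℝ))
      refine hb.mono' (by fun_prop) ?_
      rw [Measure.prod_restrict]
      filter_upwards [ae_restrict_mem (measurableSet_Ioi.prod measurableSet_Ioc)] with z hz
      have hz1 : 0 < z.1 := hz.1
      have hz2 : ε < z.2 := hz.2.1
      simp only [Function.uncurry, norm_mul, Real.norm_eq_abs, Real.abs_exp]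
      gcongr
      · nlinarith
      · exact Real.abs_sin_le_one _
  rw [hswap, setIntegral_congr_fun (g := fun a => s / (a ^ 2 + s ^ 2)) measurableSet_Ioc
    (fun a ha => integral_exp_mul_sin (h0.trans ha.1) s), ← intervalIntegral.integral_of_le hle]
  -- The antiderivative `-arctan (s / a)` is used instead of `arctan (a / s)`, since it is also
  -- correct for `s = 0`.
  have hd : ∀ a ∈ uIcc ε ε⁻¹, HasDerivAt (fun a => -Real.arctan (s / a)) (s / (a ^ 2 + s ^ 2)) a := by
    intro a ha
    rw [uIcc_of_le hle] at ha
    have ha0 : 0 < a := h0.trans_le ha.1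
    have := (((hasDerivAt_inv ha0.ne').const_mul s).arctan).neg
    simp_rw [← div_eq_mul_inv] at this
    refine this.congr_deriv ?_
    have : a ^ 2 + s ^ 2 ≠ 0 := by positivity
    field_simp
  rw [intervalIntegral.integral_eq_sub_of_hasDerivAt hd]
  · rw [div_inv_eq_mul]
    ring
  · apply ContinuousOn.intervalIntegrable
    intro a ha
    rw [uIcc_of_le hle] at ha
    have ha0 : 0 < a := h0.trans_le ha.1
    have : a ^ 2 + s ^ 2 ≠ 0 := by positivity
    fun_prop (disch := assumption)

lemma abs_arctan_sub_le (a b : ℝ) : |Real.arctan a - Real.arctan b| ≤ π := by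
  rw [abs_le]
  constructor <;>
  linarith [Real.arctan_lt_pi_div_two a, Real.arctan_lt_pi_div_two b,
    Real.neg_pi_div_two_lt_arctan a, Real.neg_pi_div_two_lt_arctan b]

lemma tendsto_arctan_sub (s : ℝ) :
    Tendsto (fun ε => Real.arctan (s / ε) - Real.arctan (s * ε)) (𝓝[>] 0)
      (𝓝 (π / 2 * Real.sign s)) := by
  have h2 : Tendsto (fun ε : ℝ => Real.arctan (s * ε)) (𝓝[>] 0) (𝓝 0) := by
    have : Continuous fun ε : ℝ => Real.arctan (s * ε) := by fun_prop
    simpa using (this.tendsto 0).mono_left nhdsWithin_le_nhds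
  have h1 : Tendsto (fun ε : ℝ => Real.arctan (s / ε)) (𝓝[>] 0) (𝓝 (π / 2 * Real.sign s)) := by
    rcases lt_trichotomy s 0 with hs | hs | hs
    · rw [Real.sign_of_neg hs, mul_neg, mul_one]
      refine (tendsto_nhds_of_tendsto_nhdsWithin Real.tendsto_arctan_atBot).comp
        (?_ : Tendsto (fun ε : ℝ => s / ε) (𝓝[>] 0) atBot)
      simp_rw [div_eq_mul_inv]
      exact tendsto_inv_nhdsGT_zero.const_mul_atTop_of_neg hs
    · simp [hs]
    · rw [Real.sign_of_pos hs, mul_one]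
      refine (tendsto_nhds_of_tendsto_nhdsWithin Real.tendsto_arctan_atTop).comp
        (?_ : Tendsto (fun ε : ℝ => s / ε) (𝓝[>] 0) atTop)
      simp_rw [div_eq_mul_inv]
      exact tendsto_inv_nhdsGT_zero.const_mul_atTop hs
  simpa using h1.sub h2

/-- Comparison of positive and negative frequencies. -/
lemma integral_cutoff_mul_osc_sub {α : Type*} [MeasurableSpace α] {ν : Measure α} [SFinite ν]
    {X : α → ℝ} {f : α → ℂ} (hX : Measurable X) (hf : Integrable f ν) {ε : ℝ} (h0 : 0 < ε)
    (h1 : ε ≤ 1) :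
    ∫ k in Ioi (0 : ℝ), (cutoff ε k : ℂ) * (oscIntegral ν X f k - oscIntegral ν X f (-k)) =
      -2 * Complex.I *
        ∫ a, ((Real.arctan (X a / ε) - Real.arctan (X a * ε) : ℝ) : ℂ) * f a ∂ν := by
  have e1 : ∀ k : ℝ, (cutoff ε k : ℂ) * (oscIntegral ν X f k - oscIntegral ν X f (-k)) =
      -2 * Complex.I * ∫ a, ((cutoff ε k * Real.sin (k * X a) : ℝ) : ℂ) * f a ∂ν := by
    intro k
    rw [oscIntegral, oscIntegral, ← integral_sub (integrable_osc hX hf k)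
      (integrable_osc hX hf (-k)), ← integral_const_mul, ← integral_const_mul]
    refine integral_congr_ae (Eventually.of_forall fun a => ?_)
    simp only [Complex.ofReal_mul, Complex.ofReal_sin, Complex.sin, Complex.ofReal_neg]
    have e2 : -(Complex.I * -(k : ℂ) * X a) = (k : ℂ) * X a * Complex.I := by ring
    have e3 : -(Complex.I * (k : ℂ) * X a) = -((k : ℂ) * X a) * Complex.I := by ring
    rw [e2, e3]
    linear_combination (cutoff ε k : ℂ) * (Complex.exp (-((k : ℂ) * X a) * Complex.I) -
      Complex.exp ((k : ℂ) * X a * Complex.I)) * f a * Complex.I_sq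
  simp_rw [e1]
  rw [integral_const_mul]
  congr 1
  rw [integral_integral_swap (f := fun (k : ℝ) a =>
    ((cutoff ε k * Real.sin (k * X a) : ℝ) : ℂ) * f a)]
  · refine integral_congr_ae (Eventually.of_forall fun a => ?_)
    simp only
    rw [integral_mul_const, integral_complex_ofReal, integral_cutoff_mul_sin h0 h1]
  · have hb : Integrable (fun z : ℝ × α => cutoff ε z.1 * ‖f z.2‖)
        ((volume.restrict (Ioi 0)).prod ν) :=
      Integrable.mul_prod (integrableOn_cutoff h0 h1) hf.norm
    refine hb.mono' ?_ (Eventually.of_forall fun z => ?_)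
    · have hc : Measurable fun z : ℝ × α => (cutoff ε z.1 * Real.sin (z.1 * X z.2)) :=
        ((measurable_cutoff ε).comp measurable_fst).mul (by fun_prop)
      exact (Complex.measurable_ofReal.comp hc).aestronglyMeasurable.mul hf.1.comp_snd
    · simp only [Function.uncurry, norm_mul, Complex.norm_real, Real.norm_eq_abs,
        abs_of_nonneg (cutoff_nonneg h0 h1 z.1)]
      have := Real.abs_sin_le_one (z.1 * X z.2)
      have hw := cutoff_nonneg h0 h1 z.1
      have : cutoff ε z.1 * |Real.sin (z.1 * X z.2)| ≤ cutoff ε z.1 := by nlinarith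
      gcongr

/-! ### Positive frequencies are controlled by negative frequencies -/

lemma measurable_arctan_sub (ε : ℝ) :
    Measurable fun s : ℝ => Real.arctan (s / ε) - Real.arctan (s * ε) := by fun_prop

lemma norm_integral_arctan_mul_le {α : Type*} [MeasurableSpace α] {ν : Measure α} {X : α → ℝ}
    {f : α → ℂ} (hf : Integrable f ν) (ε : ℝ) :
    ‖∫ a, ((Real.arctan (X a / ε) - Real.arctan (X a * ε) : ℝ) : ℂ) * f a ∂ν‖ ≤
      π * ∫ a, ‖f a‖ ∂ν := by
  rw [← integral_const_mul]
  refine norm_integral_le_of_norm_le (hf.norm.const_mul π) (Eventually.of_forall fun a => ?_)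
  rw [norm_mul, Complex.norm_real, Real.norm_eq_abs]
  gcongr
  exact abs_arctan_sub_le _ _

lemma ofReal_one_div_eq_two_mul (k : ℝ) :
    ENNReal.ofReal (1 / k) = 2 * ENNReal.ofReal (1 / (2 * k)) := by
  rw [← ENNReal.ofReal_ofNat, ← ENNReal.ofReal_mul (by norm_num)]
  congr 1
  rcases eq_or_ne k 0 with rfl | hk
  · simp
  · field_simp

/-- The difference `|F(k)|² - |F(-k)|²` is the odd part of an oscillatory integral of `f ⊗ f̄` with
phase `x(y) - x(y')`. Against the cutoff it is a double integral with a kernel bounded by `π`, up to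
a factor 2, which gives a bound independent of `ε`. -/
lemma lintegral_cutoff_oscIntegral_le {x : ℝ → ℝ} {f : ℝ → ℂ} (hx : Measurable x)
    (hf : Integrable f) {ε : ℝ} (h0 : 0 < ε) (h1 : ε ≤ 1) :
    ∫⁻ k in Ioi (0 : ℝ), ENNReal.ofReal (cutoff ε k) * ‖oscIntegral volume x f k‖ₑ ^ 2 ≤
      2 * ∫⁻ k, ‖oscIntegral volume x f (-k)‖ₑ ^ 2 ∂momentumMeasure +
        ENNReal.ofReal (2 * (π * (∫ y, ‖f y‖) ^ 2)) := by
  set F := oscIntegral volume x f with hF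
  have hFc : Continuous F := continuous_oscIntegral hx hf
  set M := ∫ y, ‖f y‖
  have hM : ∀ k, ‖F k‖ ≤ M := norm_oscIntegral_le
  have hM0 : 0 ≤ M := (norm_nonneg _).trans (hM 0)
  have hsq : ∀ k, F k * starRingEnd ℂ (F k) = ((‖F k‖ ^ 2 : ℝ) : ℂ) := fun k => by
    rw [Complex.mul_conj, Complex.normSq_eq_norm_sq]
  have hp : Integrable (fun z : ℝ × ℝ => f z.1 * starRingEnd ℂ (f z.2))
      ((volume : Measure ℝ).prod volume) :=
    hf.mul_prod (f := f) (g := fun t => starRingEnd ℂ (f t)) ((Complex.conjCLE.integrable_comp_iff).2 hf)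
  have hX : Measurable fun z : ℝ × ℝ => x z.1 - x z.2 := by fun_prop
  have key := integral_cutoff_mul_osc_sub hX hp h0 h1
  simp_rw [oscIntegral_prod (X := x) x f, ← hF, hsq] at key
  have hnorm : ∫ z : ℝ × ℝ, ‖f z.1 * starRingEnd ℂ (f z.2)‖ ∂((volume : Measure ℝ).prod volume) =
      M ^ 2 := by
    simp_rw [norm_mul, RCLike.norm_conj]
    rw [integral_prod_mul (fun y => ‖f y‖) (fun y => ‖f y‖), sq]
  have hbound : ‖∫ k in Ioi (0 : ℝ), ((cutoff ε k * (‖F k‖ ^ 2 - ‖F (-k)‖ ^ 2) : ℝ) : ℂ)‖ ≤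
      2 * (π * M ^ 2) := by
    push_cast at key ⊢
    rw [key, norm_mul]
    have := norm_integral_arctan_mul_le (X := fun z : ℝ × ℝ => x z.1 - x z.2) hp ε
    rw [hnorm] at this
    push_cast at this
    simp only [norm_mul, norm_neg, Complex.norm_ofNat, Complex.norm_I, mul_one]
    gcongr
  rw [integral_complex_ofReal, Complex.norm_real] at hbound
  have hi : ∀ h : ℝ → ℝ, Continuous h → (∀ k, ‖h k‖ ≤ M ^ 2) →
      IntegrableOn (fun k => cutoff ε k * h k) (Ioi 0) := fun h hc hb =>
    Integrable.mul_bdd (c := M ^ 2) (integrableOn_cutoff h0 h1) hc.aestronglyMeasurable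
      (Eventually.of_forall hb)
  have i1 : IntegrableOn (fun k => cutoff ε k * ‖F k‖ ^ 2) (Ioi 0) := by
    refine hi _ (by fun_prop) fun k => ?_
    rw [norm_pow, norm_norm]
    gcongr
    exact hM k
  have i2 : IntegrableOn (fun k => cutoff ε k * ‖F (-k)‖ ^ 2) (Ioi 0) := by
    refine hi _ (by fun_prop) fun k => ?_
    rw [norm_pow, norm_norm]
    gcongr
    exact hM _
  simp_rw [mul_sub] at hbound
  rw [integral_sub i1 i2] at hbound
  have hle := (le_abs_self _).trans hbound
  have conv : ∀ h : ℝ → ℂ, IntegrableOn (fun k => cutoff ε k * ‖h k‖ ^ 2) (Ioi 0) →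
      ENNReal.ofReal (∫ k in Ioi (0 : ℝ), cutoff ε k * ‖h k‖ ^ 2) =
        ∫⁻ k in Ioi (0 : ℝ), ENNReal.ofReal (cutoff ε k) * ‖h k‖ₑ ^ 2 := by
    intro h hh
    rw [ofReal_integral_eq_lintegral_ofReal hh (Eventually.of_forall fun k =>
      mul_nonneg (cutoff_nonneg h0 h1 k) (by positivity))]
    refine lintegral_congr fun k => ?_
    rw [ENNReal.ofReal_mul (cutoff_nonneg h0 h1 k), ENNReal.ofReal_pow (norm_nonneg _),
      ofReal_norm]
  rw [← conv F i1]
  refine (ENNReal.ofReal_le_ofReal (sub_le_iff_le_add'.1 hle)).trans ?_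
  refine ENNReal.ofReal_add_le.trans ?_
  gcongr
  rw [conv (fun k => F (-k)) i2, lintegral_momentumMeasure, ← lintegral_const_mul' _ _ (by norm_num)]
  refine setLIntegral_mono' measurableSet_Ioi fun k hk => ?_
  rw [← mul_assoc, ← ofReal_one_div_eq_two_mul]
  gcongr
  exact cutoff_le_inv h0 hk

/-- Fatou's lemma as `ε → 0` in `lintegral_cutoff_oscIntegral_le`, whose right side does not depend
on `ε`. Thus a finite vacuum number also makes the positive-frequency part square integrable. -/
lemma lintegral_oscIntegral_lt_top {x : ℝ → ℝ} {f : ℝ → ℂ} (hx : Measurable x)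
    (hf : Integrable f)
    (hneg : ∫⁻ k, ‖oscIntegral volume x f (-k)‖ₑ ^ 2 ∂momentumMeasure < ⊤) :
    ∫⁻ k, ‖oscIntegral volume x f k‖ₑ ^ 2 ∂momentumMeasure < ⊤ := by
  have hFc : Continuous (oscIntegral volume x f) := continuous_oscIntegral hx hf
  set B := 2 * ∫⁻ k, ‖oscIntegral volume x f (-k)‖ₑ ^ 2 ∂momentumMeasure +
    ENNReal.ofReal (2 * (π * (∫ y, ‖f y‖) ^ 2)) with hB
  have hBfin : B < ⊤ :=
    ENNReal.add_lt_top.2 ⟨ENNReal.mul_lt_top (by norm_num) hneg, ENNReal.ofReal_lt_top⟩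
  have hfatou := lintegral_liminf_le (μ := volume.restrict (Ioi (0 : ℝ))) (u := 𝓝[>] (0 : ℝ))
    (f := fun ε k => ENNReal.ofReal (cutoff ε k) * ‖oscIntegral volume x f k‖ₑ ^ 2)
    (fun ε => ((measurable_cutoff ε).ennreal_ofReal).mul (by fun_prop))
  have hlim : liminf (fun ε => ∫⁻ k in Ioi (0 : ℝ), ENNReal.ofReal (cutoff ε k) *
      ‖oscIntegral volume x f k‖ₑ ^ 2) (𝓝[>] 0) ≤ B := by
    refine liminf_le_of_frequently_le' (Eventually.frequently ?_)
    filter_upwards [Ioc_mem_nhdsGT (show (0 : ℝ) < 1 by norm_num)] with ε hε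
    exact lintegral_cutoff_oscIntegral_le hx hf hε.1 hε.2
  have heq : ∫⁻ k in Ioi (0 : ℝ), liminf (fun ε => ENNReal.ofReal (cutoff ε k) *
      ‖oscIntegral volume x f k‖ₑ ^ 2) (𝓝[>] 0) =
      2 * ∫⁻ k, ‖oscIntegral volume x f k‖ₑ ^ 2 ∂momentumMeasure := by
    rw [lintegral_momentumMeasure, ← lintegral_const_mul' _ _ (by norm_num)]
    refine setLIntegral_congr_fun measurableSet_Ioi fun k hk => ?_
    rw [← mul_assoc, ← ofReal_one_div_eq_two_mul]
    refine Tendsto.liminf_eq ?_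
    exact ENNReal.Tendsto.mul_const ((ENNReal.continuous_ofReal.tendsto _).comp
      (tendsto_cutoff hk)) (Or.inr (by simp))
  rw [heq] at hfatou
  have := (hfatou.trans hlim).trans_lt hBfin
  by_contra hcon
  rw [not_lt_top_iff.1 hcon] at this
  simp at this

lemma one_div_sqrt_two_pi_ne_zero : (1 / (Real.sqrt (2 * π) : ℂ)) ≠ 0 :=
  one_div_ne_zero (Complex.ofReal_ne_zero.2 (by positivity))

lemma lintegral_incomingMomentum_lt_top {x : ℝ → ℝ} {f : ℝ → ℂ} (hx : Measurable x)
    (hf : Integrable f)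
    (hneg : ∫⁻ k, ‖incomingMomentum x f (-k)‖ₑ ^ 2 ∂momentumMeasure < ⊤) :
    ∫⁻ k, ‖incomingMomentum x f k‖ₑ ^ 2 ∂momentumMeasure < ⊤ := by
  have hc0 := one_div_sqrt_two_pi_ne_zero
  simp only [incomingMomentum_eq, enorm_mul, mul_pow] at hneg ⊢
  rw [lintegral_const_mul' _ _ (ENNReal.pow_ne_top enorm_ne_top)] at hneg ⊢
  refine ENNReal.mul_lt_top (ENNReal.pow_lt_top enorm_lt_top) (lintegral_oscIntegral_lt_top hx hf ?_)
  by_contra hcon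
  rw [not_lt_top_iff.1 hcon, ENNReal.mul_top (pow_ne_zero 2 (enorm_ne_zero.2 hc0))] at hneg
  exact lt_irrefl _ hneg

/-! ### The primitive of an incoming wave -/

/-- The transform of an integrable function is continuous, so it vanishes at zero as a limit from
negative momenta. -/
lemma integral_eq_zero_of_momentum {g : ℝ → ℂ} (hg : Integrable g)
    (hneg : ∀ k < 0, momentum g k = 0) : ∫ t, g t = 0 := by
  have hc : Continuous (momentum g) := continuous_incomingMomentum measurable_id hg
  have h0 : momentum g 0 = 0 := by
    have h1 : Tendsto (momentum g) (𝓝[<] 0) (𝓝 (momentum g 0)) :=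
      (hc.tendsto 0).mono_left nhdsWithin_le_nhds
    refine tendsto_nhds_unique h1 ?_
    refine tendsto_const_nhds.congr' ?_
    filter_upwards [self_mem_nhdsWithin] with k hk using (hneg k hk).symm
  rw [momentum, incomingMomentum_eq] at h0
  simpa [oscIntegral] using (mul_eq_zero.1 h0).resolve_left one_div_sqrt_two_pi_ne_zero

lemma measurable_sign : Measurable Real.sign := by
  unfold Real.sign
  exact Measurable.ite measurableSet_Iio measurable_const
    (Measurable.ite measurableSet_Ioi measurable_const measurable_const)

/-- The integrals of `g` on the two sides of `s` are opposite, so their difference is twice the left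
one. -/
lemma integral_sign_mul {g : ℝ → ℂ} (hg : Integrable g) (h0 : ∫ t, g t = 0) (s : ℝ) :
    ∫ t, ((Real.sign (s - t) : ℝ) : ℂ) * g t = 2 * primitive g s := by
  have hsplit := integral_add_compl (measurableSet_Iic (a := s)) hg
  rw [compl_Iic, h0] at hsplit
  have hi : Integrable fun t => ((Real.sign (s - t) : ℝ) : ℂ) * g t := by
    refine hg.bdd_mul (c := 1) ?_ (Eventually.of_forall fun t => ?_)
    · exact (Complex.measurable_ofReal.comp (measurable_sign.comp (by fun_prop))).aestronglyMeasurable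
    · rw [Complex.norm_real]
      rcases Real.sign_apply_eq (s - t) with h | h | h <;> simp [h]
  rw [← integral_add_compl (measurableSet_Iic (a := s)) hi, compl_Iic]
  have e1 : ∫ t in Iic s, ((Real.sign (s - t) : ℝ) : ℂ) * g t = ∫ t in Iic s, g t := by
    rw [integral_Iic_eq_integral_Iio, integral_Iic_eq_integral_Iio]
    refine setIntegral_congr_fun measurableSet_Iio fun t ht => ?_
    rw [Real.sign_of_pos (sub_pos.2 ht)]
    simp
  have e2 : ∫ t in Ioi s, ((Real.sign (s - t) : ℝ) : ℂ) * g t = -∫ t in Ioi s, g t := by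
    rw [← integral_neg]
    refine setIntegral_congr_fun measurableSet_Ioi fun t ht => ?_
    rw [Real.sign_of_neg (sub_neg.2 ht)]
    simp
  rw [e1, e2, primitive]
  linear_combination -hsplit

lemma continuous_primitive {g : ℝ → ℂ} (hg : Integrable g) : Continuous (primitive g) := by
  have h : ∀ t, primitive g t = primitive g 0 + ∫ s in (0 : ℝ)..t, g s := fun t =>
    (eq_add_of_sub_eq' (intervalIntegral.integral_Iic_sub_Iic hg.integrableOn hg.integrableOn))
  have hc : Continuous fun t => primitive g 0 + ∫ s in (0 : ℝ)..t, g s :=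
    continuous_const.add (intervalIntegral.continuous_primitive (fun _ _ => hg.intervalIntegrable) 0)
  exact (funext h : primitive g = _) ▸ hc

lemma norm_primitive_le {g : ℝ → ℂ} (hg : Integrable g) (t : ℝ) :
    ‖primitive g t‖ ≤ ∫ s, ‖g s‖ :=
  (norm_integral_le_integral_norm _).trans
    (setIntegral_le_integral hg.norm (Eventually.of_forall fun _ => norm_nonneg _))

/-- The pairing of an outgoing test function with an incoming wave. -/
lemma integral_incomingMomentum_mul_conj {x : ℝ → ℝ} {f g : ℝ → ℂ} (hx : Measurable x)
    (hf : Integrable f) (hg : Integrable g) (hneg : ∀ k < 0, momentum g k = 0)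
    (hint : Integrable (fun k => incomingMomentum x f k * starRingEnd ℂ (momentum g k))
      momentumMeasure) :
    ∫ k, incomingMomentum x f k * starRingEnd ℂ (momentum g k) ∂momentumMeasure =
      -(Complex.I / 2) * ∫ y, f y * starRingEnd ℂ (primitive g (x y)) := by
  set F := oscIntegral volume x f with hF
  set G := oscIntegral volume (id : ℝ → ℝ) g with hG
  have hFc : Continuous F := continuous_oscIntegral hx hf
  have hGc : Continuous G := continuous_oscIntegral measurable_id hg
  set c : ℂ := 1 / (Real.sqrt (2 * π) : ℂ) with hc
  have hcc : c * starRingEnd ℂ c = 1 / (2 * π : ℝ) := by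
    rw [Complex.mul_conj, Complex.normSq_eq_norm_sq, hc, norm_div, norm_one, Complex.norm_real,
      Real.norm_of_nonneg (Real.sqrt_nonneg _), div_pow, Real.sq_sqrt (by positivity)]
    push_cast
    simp
  have hc0 : c ≠ 0 := one_div_sqrt_two_pi_ne_zero
  have hm : ∀ k, incomingMomentum x f k * starRingEnd ℂ (momentum g k) =
      (1 / (2 * π : ℝ) : ℂ) * (F k * starRingEnd ℂ (G k)) := by
    intro k
    rw [← hcc, momentum, incomingMomentum_eq, incomingMomentum_eq, map_mul]
    ring
  have hG0 : ∀ k < 0, G k = 0 := fun k hk => by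
    have := hneg k hk
    rw [momentum, incomingMomentum_eq] at this
    exact (mul_eq_zero.1 this).resolve_left hc0
  have hconj : Integrable fun t => starRingEnd ℂ (g t) := (Complex.conjCLE.integrable_comp_iff).2 hg
  have hp : Integrable (fun z : ℝ × ℝ => f z.1 * starRingEnd ℂ (g z.2))
      ((volume : Measure ℝ).prod volume) :=
    hf.mul_prod (f := f) (g := fun t => starRingEnd ℂ (g t)) hconj
  have hX : Measurable fun z : ℝ × ℝ => x z.1 - id z.2 := by fun_prop
  have hev : ∀ᶠ ε : ℝ in 𝓝[>] 0, ε ∈ Ioc (0 : ℝ) 1 := Ioc_mem_nhdsGT (by norm_num)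
  -- the limit on the side of the momenta
  have hint' : IntegrableOn (fun k : ℝ => ((1 / k : ℝ) : ℂ) * (F k * starRingEnd ℂ (G k)))
      (Ioi 0) := by
    have h := (integrable_momentumMeasure.1 hint).const_mul (4 * π : ℂ)
    refine h.congr ?_
    filter_upwards [ae_restrict_mem measurableSet_Ioi] with k hk
    have hk0 : (k : ℂ) ≠ 0 := Complex.ofReal_ne_zero.2 (ne_of_gt hk)
    have hpi : (π : ℂ) ≠ 0 := Complex.ofReal_ne_zero.2 Real.pi_ne_zero
    rw [hm]
    push_cast
    field_simp
    ring
  have hlim1 : Tendsto (fun ε => ∫ k in Ioi (0 : ℝ), (cutoff ε k : ℂ) *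
      (F k * starRingEnd ℂ (G k))) (𝓝[>] 0)
      (𝓝 (∫ k in Ioi (0 : ℝ), ((1 / k : ℝ) : ℂ) * (F k * starRingEnd ℂ (G k)))) := by
    refine tendsto_integral_filter_of_dominated_convergence
      (fun k => ‖((1 / k : ℝ) : ℂ) * (F k * starRingEnd ℂ (G k))‖) ?_ ?_ hint'.norm ?_
    · refine Eventually.of_forall fun ε => ?_
      exact ((Complex.measurable_ofReal.comp (measurable_cutoff ε)).mul
        (by fun_prop)).aestronglyMeasurable
    · filter_upwards [hev] with ε hε
      filter_upwards [ae_restrict_mem measurableSet_Ioi] with k hk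
      have hk0 : (0 : ℝ) < k := hk
      rw [norm_mul, norm_mul _ (F k * _), Complex.norm_real, Complex.norm_real,
        Real.norm_of_nonneg (cutoff_nonneg hε.1 hε.2 k), Real.norm_of_nonneg (by positivity)]
      gcongr
      exact cutoff_le_inv hε.1 hk
    · filter_upwards [ae_restrict_mem measurableSet_Ioi] with k hk
      exact ((Complex.continuous_ofReal.tendsto _).comp (tendsto_cutoff hk)).mul_const _
  -- the limit on the side of the positions
  have hlim2 : Tendsto (fun ε => ∫ z : ℝ × ℝ, ((Real.arctan ((x z.1 - id z.2) / ε) -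
      Real.arctan ((x z.1 - id z.2) * ε) : ℝ) : ℂ) * (f z.1 * starRingEnd ℂ (g z.2))
      ∂((volume : Measure ℝ).prod volume)) (𝓝[>] 0)
      (𝓝 (∫ z : ℝ × ℝ, ((π / 2 * Real.sign (x z.1 - id z.2) : ℝ) : ℂ) *
        (f z.1 * starRingEnd ℂ (g z.2)) ∂((volume : Measure ℝ).prod volume))) := by
    refine tendsto_integral_filter_of_dominated_convergence
      (fun z => π * ‖f z.1 * starRingEnd ℂ (g z.2)‖) ?_ ?_ (hp.norm.const_mul π) ?_
    · refine Eventually.of_forall fun ε => ?_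
      exact (Complex.measurable_ofReal.comp
        ((measurable_arctan_sub ε).comp hX)).aestronglyMeasurable.mul hp.1
    · refine Eventually.of_forall fun ε => Eventually.of_forall fun z => ?_
      rw [norm_mul, Complex.norm_real, Real.norm_eq_abs]
      gcongr
      exact abs_arctan_sub_le _ _
    · refine Eventually.of_forall fun z => ?_
      exact ((Complex.continuous_ofReal.tendsto _).comp (tendsto_arctan_sub _)).mul_const _
  -- The odd part at `k > 0` is `F(k)` times the conjugate of `G(k)` minus the same at `-k`. The
  -- second term vanishes because `g` has no negative momenta.
  have hkey : ∀ᶠ ε : ℝ in 𝓝[>] 0, -2 * Complex.I * ∫ z : ℝ × ℝ,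
      ((Real.arctan ((x z.1 - id z.2) / ε) - Real.arctan ((x z.1 - id z.2) * ε) : ℝ) : ℂ) *
        (f z.1 * starRingEnd ℂ (g z.2)) ∂((volume : Measure ℝ).prod volume) =
      ∫ k in Ioi (0 : ℝ), (cutoff ε k : ℂ) * (F k * starRingEnd ℂ (G k)) := by
    filter_upwards [hev] with ε hε
    rw [← integral_cutoff_mul_osc_sub hX hp hε.1 hε.2]
    refine setIntegral_congr_fun measurableSet_Ioi fun k hk => ?_
    simp only [oscIntegral_prod (X := x) id g]
    rw [← hF, ← hG, hG0 (-k) (neg_lt_zero.2 hk)]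
    simp
  have heq := tendsto_nhds_unique ((hlim2.const_mul (-2 * Complex.I)).congr' hkey) hlim1
  have hinner : ∀ y, ∫ t, ((π / 2 * Real.sign (x y - id t) : ℝ) : ℂ) *
      (f y * starRingEnd ℂ (g t)) = π * (f y * starRingEnd ℂ (primitive g (x y))) := by
    intro y
    have h := congrArg (starRingEnd ℂ)
      (integral_sign_mul hg (integral_eq_zero_of_momentum hg hneg) (x y))
    rw [← integral_conj] at h
    simp only [map_mul, Complex.conj_ofReal] at h
    calc _ = ∫ t, (π / 2 * f y) * ((Real.sign (x y - t) : ℂ) * starRingEnd ℂ (g t)) := by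
          congr 1
          funext t
          push_cast [id]
          ring
      _ = _ := by
          rw [integral_const_mul, h, Complex.conj_ofNat]
          ring
  have hpi' : Integrable (fun z : ℝ × ℝ => ((π / 2 * Real.sign (x z.1 - id z.2) : ℝ) : ℂ) *
        (f z.1 * starRingEnd ℂ (g z.2))) ((volume : Measure ℝ).prod volume) := by
    refine hp.bdd_mul (c := π / 2) ?_ (Eventually.of_forall fun z => ?_)
    · exact (Complex.measurable_ofReal.comp
        ((measurable_sign.comp hX).const_mul (π / 2))).aestronglyMeasurable
    · rw [Complex.norm_real]
      have : (0 : ℝ) ≤ π / 2 := by positivity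
      rcases Real.sign_apply_eq (x z.1 - id z.2) with h | h | h <;> simp only [h] <;>
        simp [abs_of_nonneg, Real.pi_pos.le, this]
  -- The inner integral of the sign kernel against `g` produces the primitive, with total factor
  -- `π/2 · 2 = π`.
  rw [integral_prod _ hpi'] at heq
  simp_rw [hinner] at heq
  rw [integral_const_mul] at heq
  simp_rw [hm]
  rw [integral_const_mul, integral_momentumMeasure]
  have hhalf : ∫ k in Ioi (0 : ℝ), ((1 / (2 * k) : ℝ) : ℂ) * (F k * starRingEnd ℂ (G k)) =
      1 / 2 * ∫ k in Ioi (0 : ℝ), ((1 / k : ℝ) : ℂ) * (F k * starRingEnd ℂ (G k)) := by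
    rw [← integral_const_mul]
    congr 1
    funext k
    push_cast
    ring
  rw [hhalf, ← heq]
  have hpi : (π : ℂ) ≠ 0 := Complex.ofReal_ne_zero.2 Real.pi_ne_zero
  push_cast
  field_simp

/-- The number of extra particles with wave function `f`. -/
def extraPart (x : ℝ → ℝ) (g f : ℝ → ℂ) : ℝ≥0∞ :=
  ‖(1 / 2 : ℂ) * ∫ y, f y * starRingEnd ℂ (primitive g (x y))‖ₑ ^ 2 +
    ‖(1 / 2 : ℂ) * ∫ y, f y * primitive g (x y)‖ₑ ^ 2

theorem meanNumber_oneParticle {x : ℝ → ℝ} {f g : ℝ → ℂ} (hx : Measurable x)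
    (hf : Integrable f) (hg : IsIncomingWave g) :
    meanNumber x (oneParticle g) f = meanNumber x vacuum f + extraPart x g f := by
  have hFc : Continuous (incomingMomentum x f) := continuous_incomingMomentum hx hf
  have hgc : Continuous (momentum g) := continuous_incomingMomentum measurable_id hg.integrable
  rw [meanNumber_oneParticle_eq x f g hFc.measurable hgc.measurable hg.normalized]
  by_cases hfin : meanNumber x vacuum f < ⊤
  swap
  · rw [not_lt_top_iff.1 hfin, top_add, top_add]
  congr 1
  rw [meanNumber_vacuum] at hfin
  have hg2 : MemLp (momentum g) 2 momentumMeasure :=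
    (memLp_two_iff_lintegral hgc.aestronglyMeasurable).2 (by rw [hg.normalized]; simp)
  have main : ∀ f : ℝ → ℂ, Integrable f →
      ∫⁻ k, ‖incomingMomentum x f k‖ₑ ^ 2 ∂momentumMeasure < ⊤ →
      ∫ k, incomingMomentum x f k * starRingEnd ℂ (momentum g k) ∂momentumMeasure =
      -(Complex.I / 2) * ∫ y, f y * starRingEnd ℂ (primitive g (x y)) := fun f hf h =>
    integral_incomingMomentum_mul_conj hx hf hg.integrable hg.momentum_neg
      (MemLp.integrable_mul_conj ((memLp_two_iff_lintegral
        (continuous_incomingMomentum hx hf).aestronglyMeasurable).2 h) hg2)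
  have hconj : Integrable fun t => starRingEnd ℂ (f t) := (Complex.conjCLE.integrable_comp_iff).2 hf
  have hA := main f hf (lintegral_incomingMomentum_lt_top hx hf hfin)
  -- Conjugating `f` exchanges positive and negative frequencies. The second overlap is thus the
  -- conjugate of one of the first kind, and the square integrability it needs is finiteness of the
  -- vacuum number itself.
  have hB := main (fun t => starRingEnd ℂ (f t)) hconj (by
    simpa only [incomingMomentum_conj, RCLike.enorm_conj] using hfin)
  have hB' := congrArg (starRingEnd ℂ) hB
  rw [← integral_conj, map_mul, ← integral_conj] at hB'
  simp only [incomingMomentum_conj, map_mul, Complex.conj_conj] at hB'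
  have hIhalf : ‖-(Complex.I / 2)‖ₑ = ‖(1 / 2 : ℂ)‖ₑ := by
    rw [← ofReal_norm, ← ofReal_norm]
    simp
  have hIhalf' : ‖starRingEnd ℂ (-(Complex.I / 2))‖ₑ = ‖(1 / 2 : ℂ)‖ₑ := by
    rw [RCLike.enorm_conj, hIhalf]
  rw [hA, hB', extraPart, enorm_mul, enorm_mul, enorm_mul, enorm_mul, hIhalf, hIhalf']

/-! ### Wave packets -/

/-- The wave function with the Fourier transform `φ`. -/
def packet (φ : ℝ → ℝ) (y : ℝ) : ℂ :=
  (1 / (Real.sqrt (2 * π) : ℂ)) * ∫ q : ℝ, Complex.exp (Complex.I * q * y) * (φ q : ℝ)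

lemma wavePacket_eq_packet (η : ℝ → ℝ) : wavePacket η = packet fun q => 2 * q * η q := rfl

/-- A packet is an inverse Fourier transform of a test function; the dilation by `(2π)⁻¹` passes
between the phases `qy` and `2πqy`. -/
lemma exists_schwartz_eq_packet {φ : ℝ → ℝ} (hs : ContDiff ℝ ∞ φ) (hc : HasCompactSupport φ) :
    ∃ Φ : 𝓢(ℝ, ℂ), packet φ = Φ := by
  have hc' : HasCompactSupport fun q => (φ q : ℂ) := hc.comp_left (g := Complex.ofReal) rfl
  have hs' : ContDiff ℝ ∞ fun q => (φ q : ℂ) := Complex.ofRealCLM.contDiff.comp hs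
  set ψ : 𝓢(ℝ, ℂ) := hc'.toSchwartzMap hs'
  have h2 : (2 * π)⁻¹ ≠ 0 := by positivity
  let e : ℝ ≃L[ℝ] ℝ := ContinuousLinearEquiv.smulLeft (Units.mk0 (2 * π)⁻¹ h2)
  refine ⟨(1 / (Real.sqrt (2 * π) : ℂ)) •
    SchwartzMap.compCLMOfContinuousLinearEquiv ℂ e (FourierTransform.fourierInv ψ), ?_⟩
  funext y
  simp only [smul_apply, SchwartzMap.compCLMOfContinuousLinearEquiv_apply, smul_eq_mul,
    packet, Function.comp]
  congr 1
  rw [SchwartzMap.fourierInv_coe, Real.fourierInv_eq']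
  refine integral_congr_ae (Eventually.of_forall fun q => ?_)
  have he : e y = (2 * π)⁻¹ * y := rfl
  simp only [he, smul_eq_mul]
  change _ = Complex.exp _ * (φ q : ℂ)
  congr 2
  simp only [RCLike.inner_apply, conj_trivial]
  have hpi : (π : ℂ) ≠ 0 := Complex.ofReal_ne_zero.2 Real.pi_ne_zero
  push_cast
  field_simp

lemma IsDensityNear.smooth_mul {p ε : ℝ} {η : ℝ → ℝ} (h : IsDensityNear p ε η) :
    ContDiff ℝ ∞ fun q => 2 * q * η q := (contDiff_const.mul contDiff_id).mul h.smooth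

lemma IsDensityNear.compact_mul {p ε : ℝ} {η : ℝ → ℝ} (h : IsDensityNear p ε η) :
    HasCompactSupport fun q => 2 * q * η q := h.compact.mul_left

lemma IsDensityNear.integrable {p ε : ℝ} {η : ℝ → ℝ} (h : IsDensityNear p ε η) :
    Integrable η := h.smooth.continuous.integrable_of_hasCompactSupport h.compact

lemma exists_schwartz_eq_wavePacket {p ε : ℝ} {η : ℝ → ℝ} (h : IsDensityNear p ε η) :
    ∃ Φ : 𝓢(ℝ, ℂ), wavePacket η = Φ :=
  exists_schwartz_eq_packet h.smooth_mul h.compact_mul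

lemma integrable_wavePacket {p ε : ℝ} {η : ℝ → ℝ} (h : IsDensityNear p ε η) :
    Integrable (wavePacket η) := by
  obtain ⟨Φ, hΦ⟩ := exists_schwartz_eq_wavePacket h
  exact hΦ ▸ Φ.integrable

lemma norm_exp_I_mul (k t : ℝ) : ‖Complex.exp (Complex.I * k * t)‖ = 1 := by
  rw [Complex.norm_exp]
  simp

/-- A wave packet has a rapidly decreasing primitive. -/
lemma hasDerivAt_packet {p ε : ℝ} {η : ℝ → ℝ} (h : IsDensityNear p ε η) (y : ℝ) :
    HasDerivAt (fun y => -Complex.I * packet (fun q => 2 * η q) y) (wavePacket η y) y := by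
  have hη := h.smooth.continuous
  have hint : Integrable fun q => 2 * q * η q :=
    h.smooth_mul.continuous.integrable_of_hasCompactSupport h.compact_mul
  have key := hasDerivAt_integral_of_dominated_loc_of_deriv_le (μ := (volume : Measure ℝ))
    (F := fun (y : ℝ) (q : ℝ) => Complex.exp (Complex.I * q * y) * ((2 * η q : ℝ) : ℂ))
    (F' := fun (y : ℝ) (q : ℝ) =>
      Complex.exp (Complex.I * q * y) * (Complex.I * q) * ((2 * η q : ℝ) : ℂ))
    (x₀ := y) (bound := fun q => ‖2 * q * η q‖) (s := univ) univ_mem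
    (Eventually.of_forall fun y => by
      apply Continuous.aestronglyMeasurable; fun_prop)
    ((h.integrable.const_mul 2).ofReal.bdd_mul (c := 1)
      (by apply Continuous.aestronglyMeasurable; fun_prop)
      (Eventually.of_forall fun q => (norm_exp_I_mul q y).le))
    (by apply Continuous.aestronglyMeasurable; fun_prop)
    (Eventually.of_forall fun q y _ => by
      simp only [norm_mul, norm_exp_I_mul, Complex.norm_I, Complex.norm_real]
      exact le_of_eq (by ring))
    hint.norm
    (Eventually.of_forall fun q y _ => by
      have h1 : HasDerivAt (fun y : ℝ => Complex.I * q * (y : ℂ)) (Complex.I * q) y := by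
        simpa using (Complex.ofRealCLM.hasDerivAt (x := y)).const_mul (Complex.I * q)
      exact (h1.cexp).mul_const _)
  have h2 := (key.2.const_mul (1 / (Real.sqrt (2 * π) : ℂ))).const_mul (-Complex.I)
  refine h2.congr_deriv ?_
  rw [wavePacket, ← mul_assoc, mul_comm (-Complex.I), mul_assoc, ← integral_const_mul]
  congr 1
  refine integral_congr_ae (Eventually.of_forall fun q => ?_)
  push_cast
  linear_combination (-2 * q * η q * Complex.exp (Complex.I * q * y)) * Complex.I_sq

/-- Integration by parts against an absolutely continuous function. -/
lemma integral_mul_primitive_of_hasDerivAt {f K h : ℝ → ℂ} (c : ℂ)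
    (hK : ∀ y, HasDerivAt K (f y) y) (hf : Integrable f) (hbot : Tendsto K atBot (𝓝 0))
    (htop : Tendsto K atTop (𝓝 0)) (hh : Integrable h) :
    ∫ y, f y * (c + primitive h y) = -∫ t, h t * K t := by
  -- The total integral of `f` vanishes, so the constant `c` does not contribute.
  have h0 : ∫ y, f y = 0 := by
    simpa using integral_of_hasDerivAt_of_tendsto hK hf hbot htop
  -- Since `h` is only integrable, its primitive need not be differentiable. Fubini on the region `t
  -- ≤ y` replaces the pointwise product rule.
  have hmeas : MeasurableSet {z : ℝ × ℝ | z.2 ≤ z.1} := measurableSet_le measurable_snd measurable_fst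
  have hp : Integrable (fun z : ℝ × ℝ => {z : ℝ × ℝ | z.2 ≤ z.1}.indicator
      (fun z => f z.1 * h z.2) z) ((volume : Measure ℝ).prod volume) :=
    (hf.mul_prod hh).indicator hmeas
  have e1 : ∀ y, f y * primitive h y =
      ∫ t, {z : ℝ × ℝ | z.2 ≤ z.1}.indicator (fun z => f z.1 * h z.2) (y, t) := by
    intro y
    rw [primitive, ← integral_const_mul, ← integral_indicator measurableSet_Iic]
    rfl
  have e2 : ∀ t, ∫ y, {z : ℝ × ℝ | z.2 ≤ z.1}.indicator (fun z => f z.1 * h z.2) (y, t) =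
      -(h t * K t) := by
    intro t
    have : ∀ y, {z : ℝ × ℝ | z.2 ≤ z.1}.indicator (fun z => f z.1 * h z.2) (y, t) =
        (Ici t).indicator (fun y => f y * h t) y := fun y => rfl
    simp_rw [this]
    rw [integral_indicator measurableSet_Ici, integral_mul_const, integral_Ici_eq_integral_Ioi,
      integral_Ioi_of_hasDerivAt_of_tendsto' (fun x _ => hK x) hf.integrableOn htop]
    ring
  have i2 : Integrable fun y => f y * primitive h y := by
    refine hf.mul_bdd (c := ∫ s, ‖h s‖) (continuous_primitive hh).aestronglyMeasurable
      (Eventually.of_forall fun y => norm_primitive_le hh y)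
  simp_rw [mul_add]
  rw [integral_add (hf.mul_const c) i2, integral_mul_const, h0, zero_mul, zero_add]
  simp_rw [e1]
  rw [integral_integral_swap hp]
  simp_rw [e2]
  rw [integral_neg]

/-- Integration by parts divides the transform `2q η(q)` of the packet by `iq`, which removes the
factor `q`. What remains is the transform of `h` averaged over `η`, whatever the constant `c`. -/
lemma integral_wavePacket_mul {p ε : ℝ} {η : ℝ → ℝ} (hη : IsDensityNear p ε η) (c : ℂ)
    {h : ℝ → ℂ} (hh : Integrable h) :
    ∫ y, wavePacket η y * (c + primitive h y) =
      2 * Complex.I * ∫ q, (η q : ℂ) * momentum h (-q) := by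
  obtain ⟨Φ, hΦ⟩ := exists_schwartz_eq_packet (φ := fun q => 2 * η q)
    (contDiff_const.mul hη.smooth) hη.compact.mul_left
  have hlim := (Φ.tendsto_cocompact).const_mul (-Complex.I)
  rw [mul_zero] at hlim
  have hd := hasDerivAt_packet hη
  rw [hΦ] at hd
  rw [integral_mul_primitive_of_hasDerivAt c hd (integrable_wavePacket hη)
    (hlim.mono_left atBot_le_cocompact) (hlim.mono_left atTop_le_cocompact) hh, ← hΦ]
  have hp : Integrable (fun z : ℝ × ℝ => Complex.exp (Complex.I * z.2 * z.1) *
      (h z.1 * ((2 * η z.2 : ℝ) : ℂ))) ((volume : Measure ℝ).prod volume) := by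
    refine (hh.mul_prod (hη.integrable.const_mul 2).ofReal).bdd_mul (c := 1)
      (by apply Continuous.aestronglyMeasurable; fun_prop)
      (Eventually.of_forall fun z => (norm_exp_I_mul _ _).le)
  have e1 : ∀ t, h t * (-Complex.I * packet (fun q => 2 * η q) t) =
      -Complex.I * (1 / (Real.sqrt (2 * π) : ℂ)) *
        ∫ q : ℝ, Complex.exp (Complex.I * q * t) * (h t * ((2 * η q : ℝ) : ℂ)) := by
    intro t
    have : ∀ q : ℝ, Complex.exp (Complex.I * q * t) * (h t * ((2 * η q : ℝ) : ℂ)) =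
        h t * (Complex.exp (Complex.I * q * t) * ((2 * η q : ℝ) : ℂ)) := fun q => by ring
    simp_rw [this]
    rw [integral_const_mul, packet]
    ring
  simp_rw [e1]
  rw [integral_const_mul, integral_integral_swap hp]
  have e2 : ∀ q : ℝ, ∫ t : ℝ, Complex.exp (Complex.I * q * t) * (h t * ((2 * η q : ℝ) : ℂ)) =
      2 * (η q : ℂ) * oscIntegral volume id h (-q) := by
    intro q
    rw [oscIntegral, ← integral_const_mul]
    refine integral_congr_ae (Eventually.of_forall fun t => ?_)
    simp only [id]
    push_cast
    rw [show -(Complex.I * -(q : ℂ) * t) = Complex.I * q * t by ring]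
    ring
  simp_rw [e2, momentum, incomingMomentum_eq]
  rw [← integral_const_mul, ← integral_const_mul, ← integral_neg]
  refine integral_congr_ae (Eventually.of_forall fun q => ?_)
  ring

/-! ### The limit of sharp modes -/

lemma hasBasis_modeFilter (p : ℝ) :
    (modeFilter p).HasBasis (fun ε : ℝ => 0 < ε) fun ε => {η | IsDensityNear p ε η} := by
  have hd : Directed (· ≥ ·) fun ε : {ε : ℝ // 0 < ε} => {η | IsDensityNear p ε η} := by
    have hmono : ∀ a b : ℝ, a ≤ b → {η | IsDensityNear p a η} ⊆ {η | IsDensityNear p b η} :=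
      fun a b hab η hη => ⟨hη.smooth, hη.compact, hη.support.trans
        (inter_subset_inter_right _ (Metric.ball_subset_ball hab)), hη.nonneg, hη.integral_one⟩
    intro a b
    exact ⟨⟨min a.1 b.1, lt_min a.2 b.2⟩, hmono _ _ (min_le_left _ _),
      hmono _ _ (min_le_right _ _)⟩
  have : Nonempty {ε : ℝ // 0 < ε} := ⟨⟨1, one_pos⟩⟩
  refine ⟨fun t => ?_⟩
  rw [modeFilter, (hasBasis_iInf_principal hd).mem_iff]
  simp

lemma eventually_modeFilter (p : ℝ) {ε : ℝ} (hε : 0 < ε) :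
    ∀ᶠ η in modeFilter p, IsDensityNear p ε η := (hasBasis_modeFilter p).mem_of_mem hε

/-- Required for Fatou's lemma along this filter, in `tendsto_meanNumber_vacuum`. -/
instance (p : ℝ) : (modeFilter p).IsCountablyGenerated := by
  have hu : ∀ n : ℕ, 0 < 1 / ((n : ℝ) + 1) := fun n => by positivity
  have hb : (modeFilter p).HasBasis (fun _ : ℕ => True)
      fun n => {η | IsDensityNear p (1 / ((n : ℝ) + 1)) η} := by
    refine (hasBasis_modeFilter p).to_hasBasis (fun ε hε => ?_) fun n _ => ⟨_, hu n, subset_rfl⟩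
    obtain ⟨n, hn⟩ := exists_nat_one_div_lt hε
    exact ⟨n, trivial, fun η hη => ⟨hη.smooth, hη.compact, hη.support.trans
        (inter_subset_inter_right _ (Metric.ball_subset_ball hn.le)), hη.nonneg, hη.integral_one⟩⟩
  exact HasCountableBasis.isCountablyGenerated ⟨hb, to_countable _⟩

lemma neBot_modeFilter {p : ℝ} (hp : 0 ≤ p) : (modeFilter p).NeBot := by
  rw [(hasBasis_modeFilter p).neBot_iff]
  intro ε hε
  -- The centre is moved to the right of `p` by `ε/2`, more than the outer radius `ε/4`, so that the
  -- support lies in `(0, ∞)` even for `p = 0`.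
  let φ : ContDiffBump (p + ε / 2) := ⟨ε / 8, ε / 4, by positivity, by linarith⟩
  refine ⟨φ.normed volume, φ.contDiff_normed, φ.hasCompactSupport_normed, ?_, φ.nonneg_normed,
    φ.integral_normed⟩
  rw [φ.tsupport_normed_eq]
  intro q hq
  rw [Metric.mem_closedBall, Real.dist_eq, abs_le] at hq
  change -(ε / 4) ≤ _ ∧ _ ≤ ε / 4 at hq
  refine ⟨?_, ?_⟩
  · rw [mem_Ioi]; linarith
  · rw [Metric.mem_ball, Real.dist_eq, abs_lt]
    constructor <;> linarith

lemma IsDensityNear.eq_zero {p ε : ℝ} {η : ℝ → ℝ} (h : IsDensityNear p ε η) {q : ℝ}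
    (hq : ¬(0 < q ∧ |q - p| < ε)) : η q = 0 := by
  by_contra h0
  exact hq (h.support (subset_tsupport _ h0))

lemma IsDensityNear.integrable_mul {p ε : ℝ} {η : ℝ → ℝ} (hη : IsDensityNear p ε η)
    {h : ℝ → ℂ} (hc : ContinuousOn h (Ioi 0)) : Integrable fun q => (η q : ℂ) * h q := by
  have h1 : IntegrableOn (fun q => (η q : ℂ) * h q) (tsupport η) := by
    refine ContinuousOn.integrableOn_compact hη.compact ?_
    refine ContinuousOn.mul (Complex.continuous_ofReal.comp hη.smooth.continuous).continuousOn ?_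
    exact hc.mono (hη.support.trans inter_subset_left)
  refine (integrableOn_iff_integrable_of_support_subset fun q hq => ?_).1 h1
  refine subset_tsupport _ fun h0 => hq ?_
  simp [h0]

/-- The densities form an approximate identity at `p`. Continuity on `(0, ∞)` serves only to make
the integrals exist; the limit uses continuity at `p`, which may be the endpoint 0. -/
lemma tendsto_integral_modeFilter {p : ℝ} {h : ℝ → ℂ} (hc : ContinuousOn h (Ioi 0))
    (hp : ContinuousAt h p) :
    Tendsto (fun η : ℝ → ℝ => ∫ q, (η q : ℂ) * h q) (modeFilter p) (𝓝 (h p)) := by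
  rw [Metric.tendsto_nhds]
  intro ε hε
  obtain ⟨δ, hδ, hclose⟩ := Metric.continuousAt_iff.1 hp (ε / 2) (by positivity)
  filter_upwards [eventually_modeFilter p hδ] with η hη
  have i1 := hη.integrable_mul hc
  have i2 : Integrable fun q => (η q : ℂ) * h p := hη.integrable.ofReal.mul_const _
  have e : (∫ q, (η q : ℂ) * h q) - h p = ∫ q, (η q : ℂ) * (h q - h p) := by
    simp_rw [mul_sub]
    rw [integral_sub i1 i2, integral_mul_const, integral_complex_ofReal, hη.integral_one]
    simp
  rw [dist_eq_norm, e]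
  refine lt_of_le_of_lt (norm_integral_le_of_norm_le (hη.integrable.mul_const (ε / 2))
    (Eventually.of_forall fun q => ?_)) (b := ∫ q, η q * (ε / 2)) ?_
  · rw [norm_mul, Complex.norm_real, Real.norm_of_nonneg (hη.nonneg q)]
    by_cases hq : 0 < q ∧ |q - p| < δ
    · have := hclose (x := q) (by rw [Real.dist_eq]; exact hq.2)
      rw [dist_eq_norm] at this
      exact mul_le_mul_of_nonneg_left this.le (hη.nonneg q)
    · simp [hη.eq_zero hq]
  · rw [integral_mul_const, hη.integral_one]
    linarith

/-- The truncated differences `v - a` and `a - v` both tend to zero, and adding a null sequence does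
not change an upper limit. Nothing is assumed of `u`, so the vacuum numbers need neither converge
nor be finite. -/
lemma limsup_add_of_tendsto {ι : Type*} {l : Filter ι} [l.NeBot] {u v : ι → ℝ≥0∞} {a : ℝ≥0∞}
    (ha : a ≠ ⊤) (hv : Tendsto v l (𝓝 a)) :
    limsup (fun i => u i + v i) l = limsup u l + a := by
  have hconst : limsup (fun i => u i + a) l = limsup u l + a :=
    limsup_add_const l u a (by isBoundedDefault) (by isBoundedDefault)
  have h1 : Tendsto (fun i => v i - a) l (𝓝 0) := by
    simpa using ENNReal.Tendsto.sub hv tendsto_const_nhds (Or.inr ha)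
  have h2 : Tendsto (fun i => a - v i) l (𝓝 0) := by
    simpa using ENNReal.Tendsto.sub tendsto_const_nhds hv (Or.inl ha)
  refine le_antisymm ?_ ?_
  · rw [← hconst, ← ENNReal.limsup_add_of_right_tendsto_zero h1 (fun i => u i + a)]
    refine limsup_le_limsup (Eventually.of_forall fun i => ?_)
    simp only [Pi.add_apply]
    rw [add_assoc]
    gcongr
    exact (le_add_tsub : v i ≤ a + (v i - a))
  · rw [← hconst, ← ENNReal.limsup_add_of_right_tendsto_zero h2 (fun i => u i + v i)]
    refine limsup_le_limsup (Eventually.of_forall fun i => ?_)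
    simp only [Pi.add_apply]
    rw [add_assoc]
    gcongr
    exact (le_add_tsub : a ≤ v i + (a - v i))

/-! ### Smooth changes of coordinates -/

section Smooth

variable {x : ℝ → ℝ}

lemma integrable_outgoing (hx : Differentiable ℝ x) (hpos : ∀ y, 0 < deriv x y) {g : ℝ → ℂ}
    (hg : Integrable g) : Integrable (outgoing x g) := by
  have hinj : InjOn x univ := (strictMono_of_deriv_pos hpos).injective.injOn
  have h := (integrableOn_image_iff_integrableOn_abs_deriv_smul (f' := deriv x)
    MeasurableSet.univ (fun y _ => (hx y).hasDerivAt.hasDerivWithinAt) hinj g).1 hg.integrableOn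
  rw [integrableOn_univ] at h
  refine h.congr (Eventually.of_forall fun y => ?_)
  simp [outgoing, abs_of_pos (hpos y)]

lemma setIntegral_outgoing (hx : Differentiable ℝ x) (hpos : ∀ y, 0 < deriv x y) (g : ℝ → ℂ)
    {s : Set ℝ} (hs : MeasurableSet s) : ∫ y in s, outgoing x g y = ∫ t in x '' s, g t := by
  have hinj : InjOn x s := (strictMono_of_deriv_pos hpos).injective.injOn
  rw [integral_image_eq_integral_abs_deriv_smul (f' := deriv x) hs
    (fun y _ => (hx y).hasDerivAt.hasDerivWithinAt) hinj g]
  refine setIntegral_congr_fun hs fun y _ => ?_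
  simp [outgoing, abs_of_pos (hpos y)]

/-- A point up to `x(y)` either lies below the whole range of `x` or is `x(z)` with `z ≤ y`. The
first kind contributes a constant, which is invisible to wave packets because their integral is
zero. -/
lemma primitive_comp (hx : Differentiable ℝ x) (hpos : ∀ y, 0 < deriv x y) {g : ℝ → ℂ}
    (hg : Integrable g) (y : ℝ) :
    primitive g (x y) = (∫ t in lowerBounds (range x), g t) + primitive (outgoing x g) y := by
  have hmono := strictMono_of_deriv_pos hpos
  have himg : MeasurableSet (x '' Iic y) :=
    ((ordConnected_Iic.isPreconnected.image x hx.continuous.continuousOn).ordConnected).measurableSet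
  have hlb : MeasurableSet (lowerBounds (range x)) := by
    have : (lowerBounds (range x)).OrdConnected :=
      ⟨fun a _ b hb c hc => fun z hz => hc.2.trans (hb hz)⟩
    exact this.measurableSet
  have hunion : Iic (x y) = lowerBounds (range x) ∪ x '' Iic y := by
    ext t
    simp only [mem_Iic, mem_union, mem_image]
    constructor
    · intro ht
      by_cases hl : t ∈ lowerBounds (range x)
      · exact Or.inl hl
      · right
        simp only [lowerBounds, mem_ofPred_eq, not_forall, not_le] at hl
        obtain ⟨_, ⟨z, rfl⟩, hz⟩ := hl
        have hzy : z ≤ y := hmono.le_iff_le.1 (hz.le.trans ht)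
        obtain ⟨w, hw, rfl⟩ := intermediate_value_Icc hzy hx.continuous.continuousOn ⟨hz.le, ht⟩
        exact ⟨w, hw.2, rfl⟩
    · rintro (hl | ⟨z, hz, rfl⟩)
      · exact hl (mem_range_self y)
      · exact hmono.le_iff_le.2 hz
  have hdisj : Disjoint (lowerBounds (range x)) (x '' Iic y) := by
    rw [Set.disjoint_left]
    rintro _ hl ⟨z, -, rfl⟩
    have := hmono.le_iff_le.1 (hl (mem_range_self (z - 1)))
    linarith
  rw [primitive, hunion, setIntegral_union hdisj himg hg.integrableOn hg.integrableOn, primitive,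
    setIntegral_outgoing hx hpos g measurableSet_Iic]

/-- The number of extra particles in the mode `f_p`. -/
def modeLimit (x : ℝ → ℝ) (g : ℝ → ℂ) (p : ℝ) : ℝ≥0∞ :=
  ‖momentum (outgoing x g) p‖ₑ ^ 2 + ‖momentum (outgoing x g) (-p)‖ₑ ^ 2

lemma modeLimit_ne_top (x : ℝ → ℝ) (g : ℝ → ℂ) (p : ℝ) : modeLimit x g p ≠ ⊤ :=
  (ENNReal.add_lt_top.2
    ⟨ENNReal.pow_lt_top enorm_lt_top, ENNReal.pow_lt_top enorm_lt_top⟩).ne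

/-- The factor `1/2` of the overlaps cancels the factor `2i` of `integral_wavePacket_mul`.
Conjugating the primitive reflects the momentum, so the two terms sample one transform at `q` and at
`-q`. -/
lemma extraPart_wavePacket (hx : Differentiable ℝ x) (hpos : ∀ y, 0 < deriv x y) {g : ℝ → ℂ}
    (hg : Integrable g) {p ε : ℝ} {η : ℝ → ℝ} (hη : IsDensityNear p ε η) :
    extraPart x g (wavePacket η) =
      ‖∫ q, (η q : ℂ) * momentum (outgoing x g) q‖ₑ ^ 2 +
        ‖∫ q, (η q : ℂ) * momentum (outgoing x g) (-q)‖ₑ ^ 2 := by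
  have hh := integrable_outgoing hx hpos hg
  have hconj : Integrable fun t => starRingEnd ℂ (outgoing x g t) :=
    (Complex.conjCLE.integrable_comp_iff).2 hh
  have hpc : ∀ y, starRingEnd ℂ (primitive g (x y)) =
      starRingEnd ℂ (∫ t in lowerBounds (range x), g t) +
        primitive (fun t => starRingEnd ℂ (outgoing x g t)) y := by
    intro y
    rw [primitive_comp hx hpos hg, map_add]
    simp only [primitive, integral_conj]
  have e1 : ∫ q, (η q : ℂ) * momentum (fun t => starRingEnd ℂ (outgoing x g t)) (-q) =
      starRingEnd ℂ (∫ q, (η q : ℂ) * momentum (outgoing x g) q) := by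
    rw [← integral_conj]
    refine integral_congr_ae (Eventually.of_forall fun q => ?_)
    simp only [momentum, incomingMomentum_conj, neg_neg, map_mul, Complex.conj_ofReal]
  have e2 : ∀ z : ℂ, ‖(1 / 2 : ℂ) * (2 * Complex.I * z)‖ₑ = ‖z‖ₑ := by
    intro z
    rw [← ofReal_norm, ← ofReal_norm]
    simp
  rw [extraPart]
  simp_rw [hpc, primitive_comp hx hpos hg]
  rw [integral_wavePacket_mul hη _ hconj, integral_wavePacket_mul hη _ hh, e1, e2, e2,
    RCLike.enorm_conj]

lemma continuous_momentum_outgoing (hx : Differentiable ℝ x) (hpos : ∀ y, 0 < deriv x y)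
    {g : ℝ → ℂ} (hg : Integrable g) : Continuous (momentum (outgoing x g)) :=
  continuous_incomingMomentum measurable_id (integrable_outgoing hx hpos hg)

lemma tendsto_extraPart (hx : Differentiable ℝ x) (hpos : ∀ y, 0 < deriv x y) {g : ℝ → ℂ}
    (hg : Integrable g) (p : ℝ) :
    Tendsto (fun η => extraPart x g (wavePacket η)) (modeFilter p) (𝓝 (modeLimit x g p)) := by
  have hc := continuous_momentum_outgoing hx hpos hg
  have h1 := tendsto_integral_modeFilter hc.continuousOn (hc.continuousAt (x := p))
  have hc' : Continuous fun q => momentum (outgoing x g) (-q) := hc.comp continuous_neg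
  have h2 := tendsto_integral_modeFilter hc'.continuousOn (hc'.continuousAt (x := p))
  have h3 := (ENNReal.Tendsto.pow (n := 2) h1.enorm).add (ENNReal.Tendsto.pow (n := 2) h2.enorm)
  refine h3.congr' ?_
  filter_upwards [eventually_modeFilter p one_pos] with η hη
  exact (extraPart_wavePacket hx hpos hg hη).symm

lemma eventually_meanNumber (hx : Differentiable ℝ x) {g : ℝ → ℂ} (hg : IsIncomingWave g)
    (p : ℝ) :
    ∀ᶠ η in modeFilter p, meanNumber x (oneParticle g) (wavePacket η) =
      meanNumber x vacuum (wavePacket η) + extraPart x g (wavePacket η) := by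
  filter_upwards [eventually_modeFilter p one_pos] with η hη
  exact meanNumber_oneParticle hx.continuous.measurable (integrable_wavePacket hη) hg

lemma modeNumber_oneParticle (hx : Differentiable ℝ x) (hpos : ∀ y, 0 < deriv x y) {g : ℝ → ℂ}
    (hg : IsIncomingWave g) {p : ℝ} (hp : 0 ≤ p) :
    modeNumber x (oneParticle g) p = modeNumber x vacuum p + modeLimit x g p := by
  have := neBot_modeFilter hp
  rw [modeNumber, limsup_congr (eventually_meanNumber hx hg p),
    limsup_add_of_tendsto (modeLimit_ne_top x g p) (tendsto_extraPart hx hpos hg.integrable p)]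
  rfl

/-- The two terms of `modeLimit` are the two half lines of the norm, the negative one being
reflected. -/
lemma lintegral_modeLimit (hx : Differentiable ℝ x) (hpos : ∀ y, 0 < deriv x y) {g : ℝ → ℂ}
    (hg : Integrable g) :
    ∫⁻ p, modeLimit x g p ∂momentumMeasure = momentumNormSq (momentum (outgoing x g)) := by
  have hc := continuous_momentum_outgoing hx hpos hg
  set h := momentum (outgoing x g)
  have hsplit : momentumNormSq h = (∫⁻ p in Iio (0 : ℝ), ‖h p‖ₑ ^ 2 / ENNReal.ofReal (2 * |p|)) +
      ∫⁻ p in Ioi (0 : ℝ), ‖h p‖ₑ ^ 2 / ENNReal.ofReal (2 * |p|) := by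
    rw [momentumNormSq, ← lintegral_add_compl _ (measurableSet_Iio (a := (0 : ℝ))), compl_Iio,
      setLIntegral_congr Ioi_ae_eq_Ici]
  have hneg : ∫⁻ p in Iio (0 : ℝ), ‖h p‖ₑ ^ 2 / ENNReal.ofReal (2 * |p|) =
      ∫⁻ p in Ioi (0 : ℝ), ‖h (-p)‖ₑ ^ 2 / ENNReal.ofReal (2 * |p|) := by
    have := (Measure.measurePreserving_neg (volume : Measure ℝ)).setLIntegral_comp_preimage_emb
      (MeasurableEquiv.neg ℝ).measurableEmbedding
      (fun p => ‖h p‖ₑ ^ 2 / ENNReal.ofReal (2 * |p|)) (Iio 0)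
    rw [← this]
    simp
  rw [lintegral_momentumMeasure, hsplit, hneg, add_comm, ← lintegral_add_left]
  · refine setLIntegral_congr_fun measurableSet_Ioi fun p hp => ?_
    have hp0 : (0 : ℝ) < p := hp
    rw [abs_of_pos hp0, one_div, ENNReal.ofReal_inv_of_pos (by positivity), modeLimit, mul_comm,
      add_mul, ENNReal.div_eq_inv_mul, ENNReal.div_eq_inv_mul]
    ring
  · fun_prop

theorem totalNumber_oneParticle (hx : Differentiable ℝ x) (hpos : ∀ y, 0 < deriv x y)
    {g : ℝ → ℂ} (hg : IsIncomingWave g) :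
    totalNumber x (oneParticle g) =
      totalNumber x vacuum + momentumNormSq (momentum (outgoing x g)) := by
  have hc := continuous_momentum_outgoing hx hpos hg.integrable
  rw [← lintegral_modeLimit hx hpos hg.integrable, totalNumber, totalNumber, ← lintegral_add_right]
  · refine lintegral_congr_ae ?_
    filter_upwards [ae_momentumMeasure_pos] with p hp
    exact modeNumber_oneParticle hx hpos hg hp.le
  · unfold modeLimit
    fun_prop

end Smooth

/-! ### The black-hole coordinates -/

namespace BlackHole

/-- The reciprocal of the derivative of the coordinate of a black hole. -/
def invSlope : BlackHole → ℝ → ℝ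
  | .relativistic, y => rexp y
  | .cghs, y => 1 + rexp y

lemma exp_le_invSlope (b : BlackHole) (y : ℝ) : rexp y ≤ b.invSlope y := by
  cases b <;> simp [invSlope]

lemma invSlope_le (b : BlackHole) (y : ℝ) : b.invSlope y ≤ 1 + rexp y := by
  cases b <;> simp [invSlope]

lemma invSlope_pos (b : BlackHole) (y : ℝ) : 0 < b.invSlope y :=
  (Real.exp_pos y).trans_le (b.exp_le_invSlope y)

lemma hasDerivAt_invSlope (b : BlackHole) (y : ℝ) : HasDerivAt b.invSlope (rexp y) y := by
  cases b
  · exact Real.hasDerivAt_exp y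
  · exact (Real.hasDerivAt_exp y).const_add 1

lemma hasDerivAt_coord (b : BlackHole) (y : ℝ) : HasDerivAt b.coord (b.invSlope y)⁻¹ y := by
  have h : HasDerivAt (fun y => rexp (-y)) (-rexp (-y)) y := by
    simpa using (hasDerivAt_neg y).exp
  cases b
  · refine h.neg.congr_deriv ?_
    rw [invSlope, neg_neg, Real.exp_neg]
  · have h1 : 1 + rexp (-y) ≠ 0 := by positivity
    refine ((h.const_add 1).log h1).neg.congr_deriv ?_
    have h2 : 1 + rexp y ≠ 0 := by positivity
    rw [invSlope, Real.exp_neg] at *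
    have := Real.exp_pos y
    field_simp
    ring

lemma deriv_coord (b : BlackHole) (y : ℝ) : deriv b.coord y = (b.invSlope y)⁻¹ :=
  (b.hasDerivAt_coord y).deriv

lemma differentiable_coord (b : BlackHole) : Differentiable ℝ b.coord :=
  fun y => (b.hasDerivAt_coord y).differentiableAt

lemma deriv_coord_pos (b : BlackHole) (y : ℝ) : 0 < deriv b.coord y := by
  rw [deriv_coord]
  exact inv_pos.2 (b.invSlope_pos y)

lemma abs_coord_le (b : BlackHole) (y : ℝ) : |b.coord y| ≤ rexp |y| := by
  have h : rexp (-y) ≤ rexp |y| := Real.exp_le_exp.2 (neg_le_abs y)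
  have h0 := Real.exp_pos (-y)
  cases b
  · rw [coord, abs_neg, abs_of_pos h0]
    exact h
  · rw [coord, abs_neg, abs_of_nonneg (Real.log_nonneg (by linarith))]
    have := Real.log_le_sub_one_of_pos (show 0 < 1 + rexp (-y) by linarith)
    linarith

end BlackHole

/-! ### The vacuum contains finitely many particles in each wave packet -/

lemma exp_neg_half_le {l : ℝ} (hl : 0 ≤ l) : rexp (-(l / 2)) ≤ 2 / (1 + l) := by
  rw [Real.exp_neg, inv_eq_one_div, div_le_div_iff₀ (Real.exp_pos _) (by positivity)]
  have := Real.add_one_le_exp (l / 2)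
  linarith

/-- For `|y| ≥ l/2` the trivial bound 2 suffices. For `|y| ≤ l/2` the phase is at most `e^{-l}
e^{|y|} ≤ e^{-l/2}`, because `x` grows at most exponentially. -/
lemma norm_exp_sub_one_le (b : BlackHole) {l k : ℝ} (hl : 0 ≤ l) (hk : |k| = rexp (-l)) (y : ℝ) :
    ‖Complex.exp (-(Complex.I * k * b.coord y)) - 1‖ ≤ 4 * (1 + |y|) / (1 + l) := by
  rcases le_total (l / 2) |y| with h | h
  · have h2 : ‖Complex.exp (-(Complex.I * k * b.coord y)) - 1‖ ≤ 2 := by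
      refine (norm_sub_le _ _).trans ?_
      rw [norm_exp_neg_I_mul, norm_one]
      norm_num
    refine h2.trans ?_
    rw [le_div_iff₀ (by positivity)]
    linarith
  · have h1 : ‖Complex.exp (-(Complex.I * k * b.coord y)) - 1‖ ≤ |k| * |b.coord y| := by
      have := Real.norm_exp_I_mul_ofReal_sub_one_le (x := -(k * b.coord y))
      rw [Real.norm_eq_abs, abs_neg, abs_mul] at this
      refine le_trans (le_of_eq ?_) this
      congr 3
      push_cast
      ring
    refine h1.trans ?_
    calc |k| * |b.coord y| ≤ rexp (-l) * rexp |y| := by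
          rw [hk]
          gcongr
          exact b.abs_coord_le y
      _ = rexp (-l + |y|) := (Real.exp_add _ _).symm
      _ ≤ rexp (-(l / 2)) := by gcongr; linarith
      _ ≤ 2 / (1 + l) := exp_neg_half_le hl
      _ ≤ _ := by
          gcongr
          linarith [abs_nonneg y]

lemma SchwartzMap.integrable_one_add_abs_mul_norm (Φ : 𝓢(ℝ, ℂ)) :
    Integrable fun y => (1 + |y|) * ‖Φ y‖ := by
  have h := (Φ.integrable_pow_mul volume 0).add (Φ.integrable_pow_mul volume 1)
  refine h.congr (Eventually.of_forall fun y => ?_)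
  simp [add_mul]

/-- Since `Φ` has zero integral, the exponential may be replaced by its difference from 1, which is
small at low momentum. -/
lemma norm_oscIntegral_le_of_low (b : BlackHole) (Φ : 𝓢(ℝ, ℂ)) (h0 : ∫ y, Φ y = 0) {l k : ℝ}
    (hl : 0 ≤ l) (hk : |k| = rexp (-l)) :
    ‖oscIntegral volume b.coord Φ k‖ ≤ 4 * (∫ y, (1 + |y|) * ‖Φ y‖) / (1 + l) := by
  have hi := integrable_osc b.differentiable_coord.continuous.measurable Φ.integrable k
    (ν := volume)
  have e : oscIntegral volume b.coord Φ k =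
      ∫ y, (Complex.exp (-(Complex.I * k * b.coord y)) - 1) * Φ y := by
    simp_rw [sub_mul, one_mul]
    rw [integral_sub hi Φ.integrable, h0, sub_zero, oscIntegral]
  have e2 : 4 * (∫ y, (1 + |y|) * ‖Φ y‖) / (1 + l) =
      ∫ y, 4 / (1 + l) * ((1 + |y|) * ‖Φ y‖) := by
    rw [integral_const_mul]
    ring
  rw [e, e2]
  refine norm_integral_le_of_norm_le
    ((SchwartzMap.integrable_one_add_abs_mul_norm Φ).const_mul _) (Eventually.of_forall fun y => ?_)
  rw [norm_mul]
  refine (mul_le_mul_of_nonneg_right (norm_exp_sub_one_le b hl hk y) (norm_nonneg _)).trans_eq ?_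
  ring

/-- The line is split at `y = l/2`. Beyond it the decay of `Φ` gives `1/(1+l)`. Before it the phase
has derivative `k / invSlope` with `invSlope ≤ 2 e^{l/2}`, so one partial integration gains `e^{-l}
e^{l/2}`. -/
lemma norm_oscIntegral_le_of_high (b : BlackHole) (Φ : 𝓢(ℝ, ℂ)) :
    ∃ C, ∀ l k : ℝ, 0 ≤ l → |k| = rexp l → ‖oscIntegral volume b.coord Φ k‖ ≤ C / (1 + l) := by
  obtain ⟨B, hB0, hB⟩ := Φ.decay 0 0
  simp only [pow_zero, one_mul, norm_iteratedFDeriv_zero] at hB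
  set Ψ : 𝓢(ℝ, ℂ) := SchwartzMap.derivCLM ℂ ℂ Φ with hΨ
  have hd : ∀ y, HasDerivAt Φ (Ψ y) y := fun y => by
    rw [hΨ, SchwartzMap.derivCLM_apply]
    exact (Φ.differentiableAt).hasDerivAt
  set D := ∫ y, (‖Ψ y‖ + ‖Φ y‖)
  set M := ∫ y, (1 + |y|) * ‖Φ y‖
  have hD0 : 0 ≤ D := integral_nonneg fun y => by positivity
  refine ⟨2 * M + 4 * (B + D), fun l k hl hk => ?_⟩
  set Y := l / 2 with hY
  have hY0 : 0 ≤ Y := by positivity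
  set E : ℝ → ℂ := fun y => Complex.exp (-(Complex.I * k * b.coord y)) with hE
  have hEn : ∀ y, ‖E y‖ = 1 := fun y => norm_exp_neg_I_mul _ _
  have hEd : ∀ y, HasDerivAt E (-(Complex.I * k * ((b.invSlope y)⁻¹ : ℝ)) * E y) y := by
    intro y
    have h1 : HasDerivAt (fun y => ((b.coord y : ℝ) : ℂ)) (((b.invSlope y)⁻¹ : ℝ) : ℂ) y :=
      (b.hasDerivAt_coord y).ofReal_comp
    refine ((h1.const_mul (Complex.I * k)).neg.cexp).congr_deriv ?_
    simp only [Pi.neg_apply]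
    ring
  have hEc : Continuous E := continuous_iff_continuousAt.2 fun y => (hEd y).continuousAt
  have hi : Integrable fun y => E y * Φ y :=
    integrable_osc b.differentiable_coord.continuous.measurable Φ.integrable k
  have hsplit := integral_add_compl (measurableSet_Iic (a := Y)) hi
  rw [compl_Iic] at hsplit
  have hsc : Continuous b.invSlope :=
    continuous_iff_continuousAt.2 fun y => (b.hasDerivAt_invSlope y).continuousAt
  -- the late times
  have htail : ‖∫ y in Ioi Y, E y * Φ y‖ ≤ 2 * M / (1 + l) := by
    have e2 : 2 * M / (1 + l) = ∫ y, 2 / (1 + l) * ((1 + |y|) * ‖Φ y‖) := by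
      rw [integral_const_mul]
      ring
    have hw := (SchwartzMap.integrable_one_add_abs_mul_norm Φ).const_mul (2 / (1 + l))
    rw [e2]
    refine (norm_integral_le_of_norm_le hw.integrableOn ?_).trans
      (setIntegral_le_integral hw (Eventually.of_forall fun y => by positivity))
    filter_upwards [ae_restrict_mem measurableSet_Ioi] with y hy
    have hy' : l / 2 < y := hy
    rw [norm_mul, hEn, one_mul, ← mul_assoc]
    refine le_mul_of_one_le_left (norm_nonneg _) ?_
    rw [div_mul_eq_mul_div, le_div_iff₀ (by positivity)]
    linarith [le_abs_self y]
  -- the early times, by partial integration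
  have hslope : ∀ y ≤ Y, b.invSlope y ≤ 2 * rexp Y := fun y hy => by
    have h1 := b.invSlope_le y
    have h2 := Real.exp_le_exp.2 hy
    have h3 := Real.one_le_exp hY0
    linarith
  -- The term left by the partial integration: `E` times the derivative of `Φ · invSlope`.
  set R : ℝ → ℂ := fun y => E y * (Ψ y * b.invSlope y + Φ y * (rexp y : ℝ)) with hR
  have hRb : ∀ y ≤ Y, ‖R y‖ ≤ 2 * rexp Y * (‖Ψ y‖ + ‖Φ y‖) := by
    intro y hy
    rw [hR]
    simp only
    rw [norm_mul, hEn, one_mul]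
    refine (norm_add_le _ _).trans ?_
    rw [norm_mul, norm_mul, Complex.norm_real, Complex.norm_real,
      Real.norm_of_nonneg (b.invSlope_pos y).le, Real.norm_of_nonneg (Real.exp_pos y).le]
    have h1 := hslope y hy
    have h2 := (b.exp_le_invSlope y).trans h1
    nlinarith [norm_nonneg (Ψ y), norm_nonneg (Φ y)]
  have hbd : IntegrableOn (fun y => 2 * rexp Y * (‖Ψ y‖ + ‖Φ y‖)) (Iic Y) :=
    ((Ψ.integrable.norm.add Φ.integrable.norm).const_mul _).integrableOn
  have hRi : IntegrableOn R (Iic Y) := by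
    refine hbd.mono' ?_ ?_
    · apply Continuous.aestronglyMeasurable
      have := Ψ.continuous
      have := Φ.continuous
      fun_prop
    · filter_upwards [ae_restrict_mem measurableSet_Iic] with y hy using hRb y hy
  have hud : ∀ y ∈ Iic Y, HasDerivAt (fun y => E y * (Φ y * b.invSlope y))
      (-(Complex.I * k) * (E y * Φ y) + R y) y := by
    intro y _
    have h1 := (hEd y).mul ((hd y).mul (b.hasDerivAt_invSlope y).ofReal_comp)
    refine h1.congr_deriv ?_
    have hne : (b.invSlope y : ℂ) ≠ 0 := Complex.ofReal_ne_zero.2 (b.invSlope_pos y).ne'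
    simp only [hR, Pi.mul_apply]
    push_cast
    field_simp
  have hu0 : Tendsto (fun y => E y * (Φ y * b.invSlope y)) atBot (𝓝 0) := by
    have h1 : Tendsto (fun y => ‖Φ y‖ * (2 * rexp Y)) atBot (𝓝 0) := by
      simpa using ((Φ.tendsto_cocompact).mono_left atBot_le_cocompact).norm.mul_const (2 * rexp Y)
    refine squeeze_zero_norm' ?_ h1
    filter_upwards [Iic_mem_atBot Y] with y hy
    rw [norm_mul, hEn, one_mul, norm_mul, Complex.norm_real,
      Real.norm_of_nonneg (b.invSlope_pos y).le]
    gcongr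
    exact hslope y hy
  have hibp := integral_Iic_of_hasDerivAt_of_tendsto' hud
    ((hi.integrableOn.const_mul _).add hRi) hu0
  rw [integral_add (hi.integrableOn.const_mul _) hRi, integral_const_mul, sub_zero] at hibp
  have hRint : ‖∫ y in Iic Y, R y‖ ≤ 2 * rexp Y * D := by
    refine (norm_integral_le_of_norm_le hbd ?_).trans ?_
    · filter_upwards [ae_restrict_mem measurableSet_Iic] with y hy using hRb y hy
    · rw [integral_const_mul]
      gcongr
      exact setIntegral_le_integral (Ψ.integrable.norm.add Φ.integrable.norm)
        (Eventually.of_forall fun y => by positivity)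
  have hearly : ‖∫ y in Iic Y, E y * Φ y‖ ≤ 4 * (B + D) / (1 + l) := by
    have e1 : Complex.I * k * ∫ y in Iic Y, E y * Φ y =
        (∫ y in Iic Y, R y) - E Y * (Φ Y * b.invSlope Y) := by
      linear_combination -hibp
    have e2 := congrArg norm e1
    rw [norm_mul, norm_mul, Complex.norm_I, one_mul, Complex.norm_real, Real.norm_eq_abs, hk] at e2
    have e3 : ‖E Y * (Φ Y * b.invSlope Y)‖ ≤ 2 * rexp Y * B := by
      rw [norm_mul, hEn, one_mul, norm_mul, Complex.norm_real,
        Real.norm_of_nonneg (b.invSlope_pos Y).le, mul_comm]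
      exact mul_le_mul (hslope Y le_rfl) (hB Y) (norm_nonneg _) (by positivity)
    have e4 : rexp l * ‖∫ y in Iic Y, E y * Φ y‖ ≤ 2 * rexp Y * (B + D) := by
      rw [e2]
      refine (norm_sub_le _ _).trans ?_
      linarith
    have e5 : ‖∫ y in Iic Y, E y * Φ y‖ ≤ 2 * rexp (-(l / 2)) * (B + D) := by
      refine le_of_mul_le_mul_left (e4.trans_eq ?_) (Real.exp_pos l)
      have : rexp Y = rexp l * rexp (-(l / 2)) := by
        rw [← Real.exp_add]
        congr 1
        rw [hY]
        ring
      rw [this]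
      ring
    refine e5.trans ?_
    have := exp_neg_half_le hl
    calc 2 * rexp (-(l / 2)) * (B + D) ≤ 2 * (2 / (1 + l)) * (B + D) := by gcongr
      _ = _ := by ring
  rw [oscIntegral, ← hsplit]
  refine (norm_add_le _ _).trans ?_
  rw [add_div]
  linarith

lemma integral_wavePacket {p ε : ℝ} {η : ℝ → ℝ} (hη : IsDensityNear p ε η) :
    ∫ y, wavePacket η y = 0 := by
  have h := integral_wavePacket_mul hη 1 (integrable_zero ℝ ℂ volume)
  simpa [primitive, momentum, incomingMomentum] using h

/-- In `s = log k` the measure is `ds/2`, and the bounds at low and high momentum together give an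
amplitude `O(1/(1+|s|))`, which is square integrable. -/
lemma meanNumber_vacuum_lt_top (b : BlackHole) {p ε : ℝ} {η : ℝ → ℝ}
    (hη : IsDensityNear p ε η) : meanNumber b.coord vacuum (wavePacket η) < ⊤ := by
  obtain ⟨Φ, hΦ⟩ := exists_schwartz_eq_wavePacket hη
  have h0 := integral_wavePacket hη
  rw [hΦ] at h0 ⊢
  obtain ⟨C₁, hC₁⟩ := norm_oscIntegral_le_of_high b Φ
  set C₂ := 4 * ∫ y, (1 + |y|) * ‖Φ y‖
  have hbound : ∀ s : ℝ, ‖oscIntegral volume b.coord Φ (-rexp s)‖ ≤ max C₁ C₂ / (1 + |s|) := by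
    intro s
    have hk : |-rexp s| = rexp s := by rw [abs_neg, Real.abs_exp]
    rcases le_total 0 s with hs | hs
    · rw [abs_of_nonneg hs]
      refine (hC₁ s _ hs hk).trans ?_
      gcongr
      exact le_max_left _ _
    · rw [abs_of_nonpos hs]
      refine (norm_oscIntegral_le_of_low b Φ h0 (neg_nonneg.2 hs) (by rw [hk, neg_neg])).trans ?_
      have : (0 : ℝ) ≤ -s := by linarith
      gcongr
      exact le_max_right _ _
  have hint : Integrable fun s : ℝ => (1 + ‖s‖) ^ (-(2 : ℝ)) :=
    integrable_one_add_norm (by simp)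
  rw [meanNumber_vacuum, lintegral_momentumMeasure_exp]
  set c : ℝ := ‖(1 / (Real.sqrt (2 * π) : ℂ))‖
  refine lt_of_le_of_lt (lintegral_mono fun s => ?_)
    (hint.const_mul (1 / 2 * (c * max C₁ C₂) ^ 2)).lintegral_lt_top
  rw [← ofReal_norm, ← ENNReal.ofReal_pow (norm_nonneg _), ← ENNReal.ofReal_mul (by norm_num)]
  refine ENNReal.ofReal_le_ofReal ?_
  rw [incomingMomentum_eq, norm_mul, mul_assoc]
  gcongr
  have h1 : (1 + ‖s‖) ^ (-(2 : ℝ)) = ((1 + |s|)⁻¹) ^ 2 := by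
    rw [Real.rpow_neg (by positivity), Real.rpow_two, inv_pow, Real.norm_eq_abs]
  rw [h1, ← mul_pow]
  refine pow_le_pow_left₀ (by positivity) ?_ 2
  rw [mul_assoc, ← div_eq_mul_inv]
  exact mul_le_mul_of_nonneg_left (hbound s) (norm_nonneg _)

/-! ### The Gamma function -/

lemma continuousAt_Gamma_of_im_ne_zero {s : ℂ} (hs : s.im ≠ 0) : ContinuousAt Complex.Gamma s :=
  (Complex.differentiableAt_Gamma s fun m h => hs (by simp [h])).continuousAt

lemma Gamma_ne_zero_of_im_ne_zero {s : ℂ} (hs : s.im ≠ 0) : Complex.Gamma s ≠ 0 :=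
  Complex.Gamma_ne_zero fun m h => hs (by simp [h])

lemma one_div_mem_slitPlane {z : ℂ} (hz : 0 < z.re ∨ z.im ≠ 0) : 1 / z ∈ Complex.slitPlane := by
  have h0 : z ≠ 0 := by
    rintro rfl
    simp at hz
  have hn := Complex.normSq_pos.2 h0
  rw [one_div, Complex.mem_slitPlane_iff, Complex.inv_re, Complex.inv_im]
  refine hz.imp (fun h => div_pos h hn) fun h => div_ne_zero (neg_ne_zero.2 h) hn.ne'

/-- The reflection formula at `it`, where `Γ(1 - it) = -it Γ(-it)` and `Γ(-it)` is the conjugate of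
`Γ(it)`. -/
lemma norm_Gamma_I_mul_sq {t : ℝ} (ht : 0 < t) :
    ‖Complex.Gamma (Complex.I * t)‖ ^ 2 = π / (t * Real.sinh (π * t)) := by
  have hne : -(Complex.I * t) ≠ 0 := by simp [ht.ne']
  have h1 : Complex.Gamma (1 - Complex.I * t) =
      -(Complex.I * t) * starRingEnd ℂ (Complex.Gamma (Complex.I * t)) := by
    rw [← Complex.Gamma_conj, sub_eq_neg_add, Complex.Gamma_add_one _ hne]
    simp
  have h2 := Complex.Gamma_mul_Gamma_one_sub (Complex.I * t)
  have h3 : Complex.sin (π * (Complex.I * t)) = ((Real.sinh (π * t) : ℝ) : ℂ) * Complex.I := by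
    rw [show (π : ℂ) * (Complex.I * t) = ((π * t : ℝ) : ℂ) * Complex.I by push_cast; ring,
      Complex.sin_mul_I, Complex.ofReal_sinh]
  rw [h1, h3] at h2
  have h4 := congrArg norm h2
  have hs : 0 < Real.sinh (π * t) := Real.sinh_pos_iff.2 (by positivity)
  simp only [norm_mul, norm_neg, RCLike.norm_conj, norm_div, Complex.norm_I, Complex.norm_real,
    Real.norm_eq_abs, abs_of_pos ht, abs_of_pos hs, abs_of_pos Real.pi_pos, one_mul, mul_one] at h4
  rw [eq_div_iff (by positivity)]
  rw [eq_div_iff hs.ne'] at h4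
  linear_combination h4

/-- The Gamma integral with a complex decay rate. -/
lemma integral_cpow_mul_exp_neg_complex_mul_Ioi {a r : ℂ} (ha : 0 < a.re) (hr : 0 < r.re) :
    ∫ t : ℝ in Ioi 0, (t : ℂ) ^ (a - 1) * Complex.exp (-(r * t)) =
      (1 / r) ^ a * Complex.Gamma a := by
  set H : ℂ → ℂ := fun r => ∫ t : ℝ in Ioi 0, (t : ℂ) ^ (a - 1) * Complex.exp (-(r * t))
  set U : Set ℂ := {z | 0 < z.re} with hU
  have hUo : IsOpen U := isOpen_lt continuous_const Complex.continuous_re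
  have hnorm : ∀ (z : ℂ) (b : ℂ), ∀ t ∈ Ioi (0 : ℝ),
      ‖(t : ℂ) ^ b * Complex.exp (-(z * t))‖ = t ^ b.re * rexp (-(z.re * t)) := by
    intro z b t ht
    rw [norm_mul, Complex.norm_cpow_eq_rpow_re_of_pos ht, Complex.norm_exp]
    simp
  have hm : ∀ (z b : ℂ), AEStronglyMeasurable
      (fun t : ℝ => (t : ℂ) ^ b * Complex.exp (-(z * t))) (volume.restrict (Ioi 0)) := by
    intro z b
    refine ContinuousOn.aestronglyMeasurable (fun t ht => ContinuousAt.continuousWithinAt ?_)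
      measurableSet_Ioi
    refine ContinuousAt.mul ?_ (by fun_prop)
    exact (Complex.continuousAt_ofReal_cpow_const t b (Or.inr (ne_of_gt ht)))
  have hint : ∀ (s c : ℝ), -1 < s → 0 < c →
      IntegrableOn (fun t : ℝ => t ^ s * rexp (-(c * t))) (Ioi 0) := by
    intro s c hs hc
    have := integrableOn_rpow_mul_exp_neg_mul_rpow hs one_pos hc
    simpa [Real.rpow_one] using this
  have hd : DifferentiableOn ℂ H U := by
    intro z hz
    have hz' : 0 < z.re := hz
    have key := hasDerivAt_integral_of_dominated_loc_of_deriv_le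
      (μ := volume.restrict (Ioi (0 : ℝ))) (x₀ := z) (s := {w : ℂ | z.re / 2 < w.re})
      (F := fun w (t : ℝ) => (t : ℂ) ^ (a - 1) * Complex.exp (-(w * t)))
      (F' := fun w (t : ℝ) => -((t : ℂ) ^ a * Complex.exp (-(w * t))))
      (bound := fun t => t ^ a.re * rexp (-(z.re / 2 * t)))
      ((isOpen_lt continuous_const Complex.continuous_re).mem_nhds
        (show z.re / 2 < z.re by linarith))
      (Eventually.of_forall fun w => hm w _)
      ((hint (a - 1).re z.re (by simpa using ha) hz').congr'
        (hm z _) (by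
          filter_upwards [ae_restrict_mem measurableSet_Ioi] with t ht
          rw [hnorm z (a - 1) t ht, Real.norm_of_nonneg]
          have : (0 : ℝ) < t := ht
          positivity))
      (hm z _).neg
      (by
        filter_upwards [ae_restrict_mem measurableSet_Ioi] with t ht w hw
        have ht' : (0 : ℝ) < t := ht
        have hw' : z.re / 2 < w.re := hw
        rw [norm_neg, hnorm w a t ht]
        gcongr)
      (hint a.re (z.re / 2) (by linarith) (by linarith))
      (by
        filter_upwards [ae_restrict_mem measurableSet_Ioi] with t ht w _
        have ht' : (t : ℂ) ≠ 0 := Complex.ofReal_ne_zero.2 (ne_of_gt ht)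
        have h1 : HasDerivAt (fun w : ℂ => -(w * t)) (-(t : ℂ)) w := by
          exact ((hasDerivAt_id w).mul_const (t : ℂ)).neg.congr_deriv (by simp)
        refine (h1.cexp.const_mul ((t : ℂ) ^ (a - 1))).congr_deriv ?_
        rw [Complex.cpow_sub _ _ ht', Complex.cpow_one]
        field_simp)
    exact key.2.differentiableAt.differentiableWithinAt
  have hd2 : DifferentiableOn ℂ (fun r : ℂ => (1 / r) ^ a * Complex.Gamma a) U := by
    intro z hz
    have hz' : 0 < z.re := hz
    have hz0 : z ≠ 0 := fun h => by simp [h] at hz'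
    have hs : 1 / z ∈ Complex.slitPlane := one_div_mem_slitPlane (Or.inl hz')
    exact ((((differentiableAt_const 1).div differentiableAt_id hz0).cpow_const hs).mul_const
      _).differentiableWithinAt
  have hpre : IsPreconnected U := (convex_halfSpace_re_gt 0).isPreconnected
  -- Identity theorem in the right half plane: both sides are holomorphic in `r` and agree for real
  -- `r > 1`, which accumulate at 1.
  refine AnalyticOnNhd.eqOn_of_preconnected_of_frequently_eq (hd.analyticOnNhd hUo)
    (hd2.analyticOnNhd hUo) hpre (z₀ := 1) (by simp [hU]) ?_ hr
  have hf : ∃ᶠ x : ℝ in 𝓝[>] 1, H x = (1 / (x : ℂ)) ^ a * Complex.Gamma a := by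
    refine Eventually.frequently ?_
    filter_upwards [self_mem_nhdsWithin] with x hx
    exact Complex.integral_cpow_mul_exp_neg_mul_Ioi ha (zero_lt_one.trans hx)
  have ht : Tendsto (fun x : ℝ => (x : ℂ)) (𝓝[>] 1) (𝓝[≠] 1) := by
    refine tendsto_nhdsWithin_iff.2 ⟨?_, ?_⟩
    · simpa using (Complex.continuous_ofReal.tendsto 1).mono_left nhdsWithin_le_nhds
    · filter_upwards [self_mem_nhdsWithin] with x hx
      have : (1 : ℝ) < x := hx
      simp [this.ne']
  exact ht.frequently hf

/-! ### Regularised mode functions -/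

namespace BlackHole

/-- A function comparable with `|y|`, used to regularise mode functions. -/
def damping : BlackHole → ℝ → ℝ
  | .relativistic, y => y + rexp (-y)
  | .cghs, y => y + 2 * Real.log (1 + rexp (-y))

lemma continuous_damping (b : BlackHole) : Continuous b.damping := by
  cases b
  · change Continuous fun y => y + rexp (-y)
    fun_prop
  · change Continuous fun y => y + 2 * Real.log (1 + rexp (-y))
    refine continuous_id.add (continuous_const.mul (Continuous.log (by fun_prop) fun y => ?_))
    positivity

lemma abs_le_damping (b : BlackHole) (y : ℝ) : |y| ≤ b.damping y := by
  have h0 := Real.exp_pos (-y)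
  cases b
  · simp only [damping]
    refine abs_le'.2 ⟨by linarith, ?_⟩
    have h1 : rexp (-y) = rexp (-y / 2) ^ 2 := by
      rw [← Real.exp_nat_mul]
      congr 1
      push_cast
      ring
    rcases le_total 0 y with hy | hy
    · linarith
    · have h2 := Real.add_one_le_exp (-y / 2)
      have h3 : (-y / 2 + 1) ^ 2 ≤ rexp (-y / 2) ^ 2 := by
        gcongr
        linarith
      nlinarith [sq_nonneg (1 + y / 2)]
  · simp only [damping]
    have h1 : -y ≤ Real.log (1 + rexp (-y)) := by
      rw [Real.le_log_iff_exp_le (by positivity)]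
      linarith
    have h2 : 0 ≤ Real.log (1 + rexp (-y)) := Real.log_nonneg (by linarith)
    exact abs_le'.2 ⟨by linarith, by linarith⟩

/-- The Fourier transform of the regularised mode function. -/
def regularMode (b : BlackHole) (k δ q : ℝ) : ℂ :=
  match b with
  | .relativistic => (1 / (δ + Complex.I * k)) ^ (δ - Complex.I * q : ℂ) *
      Complex.Gamma (δ - Complex.I * q)
  | .cghs => Complex.Gamma (δ + Complex.I * (k + q)) * Complex.Gamma (δ - Complex.I * q) /
      Complex.Gamma (2 * δ + Complex.I * k)

/-- The damping is chosen so that the integral stays of a classical type, with parameters shifted by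
`δ`: `t = e^{-y}` gives a Gamma integral with complex rate `δ + ik`, and the sigmoid substitution
gives a Beta integral. -/
lemma integral_regularised (b : BlackHole) (k q : ℝ) {δ : ℝ} (hδ : 0 < δ) :
    ∫ y : ℝ, Complex.exp (Complex.I * q * y) *
      ((rexp (-(δ * b.damping y)) : ℝ) * Complex.exp (Complex.I * k * b.coord y)) =
      b.regularMode k δ q := by
  cases b
  · simp only [regularMode]
    rw [← integral_cpow_mul_exp_neg_complex_mul_Ioi (by simpa using hδ) (by simpa using hδ)]
    have himg : Ioi (0 : ℝ) = (fun y => rexp (-y)) '' univ := by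
      rw [image_univ, ← Real.range_exp]
      exact (neg_surjective.range_comp rexp).symm
    have hd : ∀ y ∈ (univ : Set ℝ), HasDerivWithinAt (fun y => rexp (-y)) (-rexp (-y)) univ y := by
      intro y _
      exact HasDerivAt.hasDerivWithinAt (by simpa using (hasDerivAt_neg y).exp)
    have hinj : InjOn (fun y => rexp (-y)) univ := fun y _ z _ h => by simpa using h
    rw [himg, integral_image_eq_integral_abs_deriv_smul MeasurableSet.univ hd hinj,
      setIntegral_univ]
    refine integral_congr_ae (Eventually.of_forall fun y => ?_)
    have hpos := Real.exp_pos (-y)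
    simp only [abs_neg, abs_of_pos hpos, Complex.real_smul]
    rw [Complex.cpow_def_of_ne_zero (Complex.ofReal_ne_zero.2 hpos.ne'), ← Complex.ofReal_log hpos.le,
      Real.log_exp]
    simp only [Complex.ofReal_exp, ← Complex.exp_add]
    congr 1
    simp only [damping, coord]
    push_cast
    ring
  · simp only [regularMode]
    have hβ := Complex.betaIntegral_eq_Gamma_mul_div (δ + Complex.I * (k + q)) (δ - Complex.I * q)
      (by simpa using hδ) (by simpa using hδ)
    rw [show (δ : ℂ) + Complex.I * (k + q) + (δ - Complex.I * q) = 2 * δ + Complex.I * k by ring]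
      at hβ
    rw [← hβ, Complex.betaIntegral, intervalIntegral.integral_of_le zero_le_one,
      integral_Ioc_eq_integral_Ioo, ← Real.range_sigmoid, ← image_univ,
      integral_image_eq_integral_abs_deriv_smul MeasurableSet.univ
        (fun y _ => (hasDerivAt_sigmoid y).hasDerivWithinAt) Real.sigmoid_injective.injOn,
      setIntegral_univ]
    refine integral_congr_ae (Eventually.of_forall fun y => ?_)
    have h1 := Real.sigmoid_pos y
    have h2 : 0 < 1 - Real.sigmoid y := sub_pos.2 (Real.sigmoid_lt_one y)
    have hE : 0 < 1 + rexp (-y) := by positivity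
    have l1 : Real.log (Real.sigmoid y) = -Real.log (1 + rexp (-y)) := by
      rw [Real.sigmoid_def, Real.log_inv]
    have l2 : Real.log (1 - Real.sigmoid y) = -(y + Real.log (1 + rexp (-y))) := by
      rw [← Real.sigmoid_neg, ← Real.sigmoid_mul_rexp_neg, Real.log_mul h1.ne' (Real.exp_pos _).ne',
        l1, Real.log_exp]
      ring
    set L := Real.log (1 + rexp (-y)) with hL
    have e1 : ((Real.sigmoid y : ℝ) : ℂ) = Complex.exp (-L : ℝ) := by
      rw [← l1, ← Complex.ofReal_exp, Real.exp_log h1]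
    have e2 : (1 : ℂ) - ((Real.sigmoid y : ℝ) : ℂ) = Complex.exp (-(y + L) : ℝ) := by
      rw [← l2, ← Complex.ofReal_exp, Real.exp_log h2]
      push_cast
      rfl
    have c1 : ∀ w : ℂ, ((Real.sigmoid y : ℝ) : ℂ) ^ w = Complex.exp ((-L : ℝ) * w) := by
      intro w
      rw [Complex.cpow_def_of_ne_zero (Complex.ofReal_ne_zero.2 h1.ne'), ← Complex.ofReal_log h1.le,
        l1]
    have c2 : ∀ w : ℂ, ((1 : ℂ) - ((Real.sigmoid y : ℝ) : ℂ)) ^ w =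
        Complex.exp ((-(y + L) : ℝ) * w) := by
      intro w
      have : (1 : ℂ) - ((Real.sigmoid y : ℝ) : ℂ) = ((1 - Real.sigmoid y : ℝ) : ℂ) := by
        push_cast
        rfl
      rw [this, Complex.cpow_def_of_ne_zero (Complex.ofReal_ne_zero.2 h2.ne'),
        ← Complex.ofReal_log h2.le, l2]
    simp only [abs_of_pos (mul_pos h1 h2), Complex.real_smul]
    have e3 : ((Real.sigmoid y * (1 - Real.sigmoid y) : ℝ) : ℂ) =
        Complex.exp (-L : ℝ) * Complex.exp (-(y + L) : ℝ) := by
      rw [← e1, ← e2]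
      push_cast
      rfl
    rw [c1, c2, e3]
    simp only [Complex.ofReal_exp, ← Complex.exp_add]
    congr 1
    simp only [damping, coord, ← hL]
    push_cast
    ring

/-- The point is that `δ = 0` is included: for `k, q > 0` the Gamma arguments stay off the real
axis, hence away from the poles, and `1/(δ + ik)` stays off the branch cut. -/
lemma continuousOn_regularMode (b : BlackHole) {k : ℝ} (hk : 0 < k) :
    ContinuousOn (fun z : ℝ × ℝ => b.regularMode k z.1 z.2) (Icc 0 1 ×ˢ Ioi 0) := by
  rintro ⟨δ, q⟩ ⟨-, hq⟩
  have hq0 : (0 : ℝ) < q := hq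
  refine ContinuousAt.continuousWithinAt ?_
  have hG : ContinuousAt (fun z : ℝ × ℝ => Complex.Gamma (z.1 - Complex.I * z.2)) (δ, q) :=
    ContinuousAt.comp (f := fun z : ℝ × ℝ => (z.1 - Complex.I * z.2 : ℂ))
      (continuousAt_Gamma_of_im_ne_zero (by simpa using hq0.ne')) (by fun_prop)
  cases b
  · simp only [regularMode]
    refine ContinuousAt.mul (ContinuousAt.cpow ?_ (by fun_prop) ?_) hG
    · refine ContinuousAt.div (by fun_prop) (by fun_prop) fun h => ?_
      have := congrArg Complex.im h
      simp [hk.ne'] at this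
    · exact one_div_mem_slitPlane (Or.inr (by simpa using hk.ne'))
  · simp only [regularMode]
    refine ContinuousAt.div (ContinuousAt.mul ?_ hG) ?_ ?_
    · exact ContinuousAt.comp (f := fun z : ℝ × ℝ => (z.1 + Complex.I * (k + z.2) : ℂ))
        (continuousAt_Gamma_of_im_ne_zero (by simpa using (add_pos hk hq0).ne')) (by fun_prop)
    · exact ContinuousAt.comp (f := fun z : ℝ × ℝ => (2 * z.1 + Complex.I * k : ℂ))
        (continuousAt_Gamma_of_im_ne_zero (by simpa using hk.ne')) (by fun_prop)
    · exact Gamma_ne_zero_of_im_ne_zero (by simpa using hk.ne')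

/-- The momentum-space wave function of a sharp outgoing mode. -/
def limitMode (b : BlackHole) (k q : ℝ) : ℂ :=
  Complex.I / π * Complex.Gamma (1 - Complex.I * q) *
    match b with
    | .relativistic => (1 / (Complex.I * k)) ^ (-(Complex.I * q))
    | .cghs => Complex.Gamma (Complex.I * (k + q)) / Complex.Gamma (Complex.I * k)

/-- The value `q = 0` is allowed because the factor `q` has been absorbed in `Γ(1 - iq)`, which
removes the pole of `Γ(-iq)`. The mode `p = 0` is therefore covered. -/
lemma continuousAt_limitMode (b : BlackHole) {k q : ℝ} (hk : 0 < k) (hq : 0 ≤ q) :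
    ContinuousAt (b.limitMode k) q := by
  have hG : ContinuousAt (fun q : ℝ => Complex.Gamma (1 - Complex.I * q)) q := by
    refine ContinuousAt.comp (f := fun q : ℝ => (1 - Complex.I * q : ℂ)) (g := Complex.Gamma)
      ?_ (by fun_prop)
    refine (Complex.differentiableAt_Gamma _ fun m h => ?_).continuousAt
    have h1 := congrArg Complex.re h
    simp at h1
    have : (0 : ℝ) ≤ m := m.cast_nonneg
    linarith
  unfold limitMode
  refine ContinuousAt.mul (continuousAt_const.mul hG) ?_
  cases b
  · simp only
    refine ContinuousAt.cpow continuousAt_const (by fun_prop) ?_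
    exact one_div_mem_slitPlane (Or.inr (by simpa using hk.ne'))
  · simp only
    refine ContinuousAt.div_const ?_ _
    exact ContinuousAt.comp (f := fun q : ℝ => (Complex.I * (k + q) : ℂ)) (g := Complex.Gamma)
      (continuousAt_Gamma_of_im_ne_zero (by simpa using (add_pos_of_pos_of_nonneg hk hq).ne'))
      (by fun_prop)

lemma limitMode_eq (b : BlackHole) {k q : ℝ} (hq : 0 < q) :
    (1 / (2 * π) : ℂ) * (2 * q * b.regularMode k 0 q) = b.limitMode k q := by
  have hne : -(Complex.I * q) ≠ 0 := by simp [hq.ne']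
  have h1 : Complex.Gamma (1 - Complex.I * q) =
      -(Complex.I * q) * Complex.Gamma (-(Complex.I * q)) := by
    rw [sub_eq_neg_add, Complex.Gamma_add_one _ hne]
  rw [limitMode.eq_def, h1]
  cases b
  · simp only [regularMode, Complex.ofReal_zero, zero_add, zero_sub]
    generalize (1 / (Complex.I * (k : ℂ))) ^ (-(Complex.I * (q : ℂ))) = A
    generalize Complex.Gamma (-(Complex.I * (q : ℂ))) = B
    linear_combination (q * A * B / π) * Complex.I_sq
  · simp only [regularMode, Complex.ofReal_zero, zero_add, zero_sub, mul_zero]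
    generalize Complex.Gamma (-(Complex.I * (q : ℂ))) = B
    generalize Complex.Gamma (Complex.I * (k + q)) = A
    generalize Complex.Gamma (Complex.I * (k : ℂ)) = D
    linear_combination (q * A * B / D / π) * Complex.I_sq

/-- The relativistic power has modulus `e^{p arg}` with `arg > -π`. In the CGHS case
`norm_Gamma_I_mul_sq` reduces the claim to a ratio of `k sinh(πk)` at `k` and `k + p`. -/
lemma exists_le_norm_limitMode (b : BlackHole) {p : ℝ} (hp : 0 ≤ p) :
    ∃ c > 0, ∀ k, max 1 p ≤ k → c ≤ ‖b.limitMode k p‖ := by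
  have hG : Complex.Gamma (1 - Complex.I * p) ≠ 0 := by
    refine Complex.Gamma_ne_zero_of_re_pos ?_
    simp
  have hpi : (π : ℂ) ≠ 0 := Complex.ofReal_ne_zero.2 Real.pi_ne_zero
  have hpre : 0 < ‖Complex.I / π * Complex.Gamma (1 - Complex.I * p)‖ :=
    norm_pos_iff.2 (mul_ne_zero (div_ne_zero Complex.I_ne_zero hpi) hG)
  have hmain : ∃ c > 0, ∀ k : ℝ, max 1 p ≤ k →
      c ≤ ‖(match b with
        | .relativistic => (1 / (Complex.I * k)) ^ (-(Complex.I * p))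
        | .cghs => Complex.Gamma (Complex.I * (k + p)) / Complex.Gamma (Complex.I * k) : ℂ)‖ := by
    cases b
    · refine ⟨rexp (-(π * p)), Real.exp_pos _, fun k hk => ?_⟩
      have hk0 : 0 < k := zero_lt_one.trans_le ((le_max_left _ _).trans hk)
      have hz : 1 / (Complex.I * (k : ℂ)) ≠ 0 := by simp [hk0.ne']
      simp only
      rw [Complex.norm_cpow_of_ne_zero hz]
      simp only [Complex.neg_re, Complex.mul_re, Complex.I_re, Complex.ofReal_re, zero_mul,
        Complex.I_im, Complex.ofReal_im, mul_zero, sub_zero, neg_zero, Real.rpow_zero,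
        Complex.neg_im, Complex.mul_im, one_mul, zero_add, one_div, ← Real.exp_neg]
      refine Real.exp_le_exp.2 ?_
      have := Complex.neg_pi_lt_arg (Complex.I * (k : ℂ))⁻¹
      nlinarith
    -- By the addition theorem and `cosh(πk) ≤ 2 sinh(πk)` for `k ≥ 1`, `sinh(π(k+p)) ≤ S sinh(πk)`.
    -- The other factor 2 comes from `k + p ≤ 2k`.
    · set S := Real.cosh (π * p) + 2 * Real.sinh (π * p) with hS
      have hsp : 0 ≤ Real.sinh (π * p) := Real.sinh_nonneg_iff.2 (by positivity)
      have hSpos : 0 < S := by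
        have := Real.cosh_pos (π * p)
        positivity
      refine ⟨Real.sqrt (1 / (2 * S)), Real.sqrt_pos.2 (by positivity), fun k hk => ?_⟩
      have hk1 : 1 ≤ k := (le_max_left _ _).trans hk
      have hkp : p ≤ k := (le_max_right _ _).trans hk
      have hk0 : 0 < k := by linarith
      refine Real.sqrt_le_iff.2 ⟨norm_nonneg _, ?_⟩
      simp only
      have e1 : Complex.I * ((k : ℂ) + p) = Complex.I * ((k + p : ℝ) : ℂ) := by push_cast; rfl
      rw [norm_div, div_pow, e1, norm_Gamma_I_mul_sq (show 0 < k + p by linarith),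
        norm_Gamma_I_mul_sq hk0]
      have s1 : 0 < Real.sinh (π * k) := Real.sinh_pos_iff.2 (by positivity)
      have s2 : 0 < Real.sinh (π * (k + p)) := Real.sinh_pos_iff.2 (by positivity)
      have hcosh : Real.cosh (π * k) ≤ 2 * Real.sinh (π * k) := by
        rw [Real.cosh_eq, Real.sinh_eq]
        have h3 : (3 : ℝ) ≤ π * k := by nlinarith [Real.pi_gt_three]
        have h4 := Real.add_one_le_exp (π * k)
        have h5 : rexp (-(π * k)) ≤ 1 := Real.exp_le_one_iff.2 (by linarith)
        linarith
      have hsum : Real.sinh (π * (k + p)) ≤ Real.sinh (π * k) * S := by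
        rw [mul_add, Real.sinh_add, hS]
        nlinarith
      have hkp2 : 0 < k + p := by linarith
      have e2 : π / ((k + p) * Real.sinh (π * (k + p))) / (π / (k * Real.sinh (π * k))) =
          (k * Real.sinh (π * k)) / ((k + p) * Real.sinh (π * (k + p))) := by
        field_simp
      rw [e2, div_le_div_iff₀ (by positivity) (by positivity), one_mul]
      calc (k + p) * Real.sinh (π * (k + p)) ≤ (2 * k) * (Real.sinh (π * k) * S) := by
            gcongr
            linarith
        _ = _ := by ring
  obtain ⟨c, hc, hle⟩ := hmain
  refine ⟨_, mul_pos hpre hc, fun k hk => ?_⟩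
  rw [limitMode.eq_def]
  exact (mul_le_mul_of_nonneg_left (hle k hk) hpre.le).trans_eq (norm_mul _ _).symm

end BlackHole

/-! ### The vacuum contains infinitely many particles in each sharp mode -/

lemma integrable_exp_neg_mul_abs {δ : ℝ} (hδ : 0 < δ) :
    Integrable fun y : ℝ => rexp (-(δ * |y|)) := by
  rw [← integrableOn_univ, ← Iic_union_Ioi (a := (0 : ℝ)), integrableOn_union]
  constructor
  · refine (integrableOn_exp_mul_Iic hδ 0).congr_fun (fun y hy => ?_) measurableSet_Iic
    dsimp only
    rw [abs_of_nonpos hy]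
    congr 1
    ring
  · refine (integrableOn_exp_mul_Ioi (neg_lt_zero.2 hδ) 0).congr_fun (fun y hy => ?_)
      measurableSet_Ioi
    have hy' : (0 : ℝ) < y := hy
    dsimp only
    rw [abs_of_pos hy']
    congr 1
    ring

lemma norm_exp_I_mul_coord (b : BlackHole) (k y : ℝ) :
    ‖Complex.exp (Complex.I * k * b.coord y)‖ = 1 := norm_exp_I_mul _ _

lemma integral_regularised_packet (b : BlackHole) (k : ℝ) {δ : ℝ} (hδ : 0 < δ) {φ : ℝ → ℝ}
    (hφ : Integrable φ) :
    ∫ y, (rexp (-(δ * b.damping y)) : ℝ) * (Complex.exp (Complex.I * k * b.coord y) *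
      packet φ y) =
      (1 / (Real.sqrt (2 * π) : ℂ)) * ∫ q, (φ q : ℂ) * b.regularMode k δ q := by
  have hdc := b.continuous_damping
  have hcc := b.differentiable_coord.continuous
  have hr : Integrable fun y => rexp (-(δ * b.damping y)) := by
    refine (integrable_exp_neg_mul_abs hδ).mono' (by fun_prop) (Eventually.of_forall fun y => ?_)
    rw [Real.norm_of_nonneg (Real.exp_pos _).le]
    have := b.abs_le_damping y
    gcongr
  have hp : Integrable (fun z : ℝ × ℝ => (Complex.exp (Complex.I * z.2 * z.1) *
      Complex.exp (Complex.I * k * b.coord z.1)) *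
        (((rexp (-(δ * b.damping z.1)) : ℝ) : ℂ) * (φ z.2 : ℂ)))
      ((volume : Measure ℝ).prod volume) := by
    refine (hr.ofReal.mul_prod hφ.ofReal).bdd_mul (c := 1)
      (by apply Continuous.aestronglyMeasurable; fun_prop) (Eventually.of_forall fun z => ?_)
    rw [norm_mul, norm_exp_I_mul, norm_exp_I_mul_coord, one_mul]
  have e1 : ∀ y : ℝ, ((rexp (-(δ * b.damping y)) : ℝ) : ℂ) *
      (Complex.exp (Complex.I * k * b.coord y) * packet φ y) =
      (1 / (Real.sqrt (2 * π) : ℂ)) * ∫ q : ℝ, (Complex.exp (Complex.I * q * y) *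
      Complex.exp (Complex.I * k * b.coord y)) *
        (((rexp (-(δ * b.damping y)) : ℝ) : ℂ) * (φ q : ℂ)) := by
    intro y
    have : ∀ q : ℝ, (Complex.exp (Complex.I * q * y) * Complex.exp (Complex.I * k * b.coord y)) *
        (((rexp (-(δ * b.damping y)) : ℝ) : ℂ) * (φ q : ℂ)) =
        (((rexp (-(δ * b.damping y)) : ℝ) : ℂ) * Complex.exp (Complex.I * k * b.coord y)) *
          (Complex.exp (Complex.I * q * y) * (φ q : ℂ)) := fun q => by ring
    simp_rw [this]
    rw [integral_const_mul, packet]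
    ring
  simp_rw [e1]
  rw [integral_const_mul, integral_integral_swap hp]
  congr 1
  refine integral_congr_ae (Eventually.of_forall fun q => ?_)
  dsimp only
  rw [← b.integral_regularised k q hδ, ← integral_const_mul]
  refine integral_congr_ae (Eventually.of_forall fun y => ?_)
  dsimp only
  ring

/-- The position integral of a sharp mode is not absolutely convergent, so Fubini is applied with
the damping, and then `δ → 0` on both sides. The packet dominates on the position side, a
compactness bound on the momentum side. -/
lemma incomingMomentum_wavePacket_neg (b : BlackHole) {k : ℝ} (hk : 0 < k) {p ε : ℝ} {η : ℝ → ℝ}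
    (hη : IsDensityNear p ε η) :
    incomingMomentum b.coord (wavePacket η) (-k) = ∫ q, (η q : ℂ) * b.limitMode k q := by
  set φ : ℝ → ℝ := fun q => 2 * q * η q with hφ
  have hφi : Integrable φ :=
    hη.smooth_mul.continuous.integrable_of_hasCompactSupport hη.compact_mul
  have hdc := b.continuous_damping
  have hcc := b.differentiable_coord.continuous
  have hev : ∀ᶠ δ : ℝ in 𝓝[>] 0, δ ∈ Ioc (0 : ℝ) 1 := Ioc_mem_nhdsGT (by norm_num)
  have hlim1 : Tendsto (fun δ : ℝ => ∫ y, (rexp (-(δ * b.damping y)) : ℝ) *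
      (Complex.exp (Complex.I * k * b.coord y) * packet φ y)) (𝓝[>] 0)
      (𝓝 (∫ y, Complex.exp (Complex.I * k * b.coord y) * packet φ y)) := by
    have hw : Integrable (packet φ) := integrable_wavePacket hη
    refine tendsto_integral_filter_of_dominated_convergence (fun y => ‖packet φ y‖) ?_ ?_
      hw.norm ?_
    · refine Eventually.of_forall fun δ => ?_
      refine AEStronglyMeasurable.mul (by apply Continuous.aestronglyMeasurable; fun_prop) ?_
      exact AEStronglyMeasurable.mul (by apply Continuous.aestronglyMeasurable; fun_prop) hw.1
    · filter_upwards [hev] with δ hδ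
      refine Eventually.of_forall fun y => ?_
      rw [norm_mul, norm_mul, norm_exp_I_mul_coord, one_mul, Complex.norm_real,
        Real.norm_of_nonneg (Real.exp_pos _).le]
      refine mul_le_of_le_one_left (norm_nonneg _) (Real.exp_le_one_iff.2 ?_)
      have := (abs_nonneg y).trans (b.abs_le_damping y)
      have := hδ.1.le
      simp only [Left.neg_nonpos_iff]
      positivity
    · refine Eventually.of_forall fun y => ?_
      have hc : Continuous fun δ : ℝ => ((rexp (-(δ * b.damping y)) : ℝ) : ℂ) *
        (Complex.exp (Complex.I * k * b.coord y) * packet φ y) := by fun_prop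
      simpa using (hc.tendsto 0).mono_left nhdsWithin_le_nhds
  have hsub : tsupport η ⊆ Ioi 0 := hη.support.trans inter_subset_left
  have hcont := (b.continuousOn_regularMode hk).mono
    (prod_mono (subset_refl (Icc (0 : ℝ) 1)) hsub)
  -- The bound is uniform in `δ` down to 0, by continuity on the compact set `[0, 1] × tsupport η`.
  obtain ⟨C, hC⟩ := (isCompact_Icc.prod hη.compact).exists_bound_of_continuousOn hcont
  have hslice : ∀ δ ∈ Icc (0 : ℝ) 1, ContinuousOn (fun q => b.regularMode k δ q) (Ioi 0) := by
    intro δ hδ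
    exact (b.continuousOn_regularMode hk).comp (f := fun q : ℝ => (δ, q)) (by fun_prop)
      fun q hq => ⟨hδ, hq⟩
  have hzero : ∀ q, q ∉ tsupport η → φ q = 0 := fun q hq => by
    simp [hφ, image_eq_zero_of_notMem_tsupport hq]
  have hlim2 : Tendsto (fun δ : ℝ => ∫ q, (φ q : ℂ) * b.regularMode k δ q) (𝓝[>] 0)
      (𝓝 (∫ q, (φ q : ℂ) * b.regularMode k 0 q)) := by
    refine tendsto_integral_filter_of_dominated_convergence (fun q => ‖φ q‖ * C) ?_ ?_
      (hφi.norm.mul_const C) ?_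
    · filter_upwards [hev] with δ hδ
      have h1 := hη.integrable_mul (h := fun q => (2 * q : ℂ) * b.regularMode k δ q)
        (ContinuousOn.mul (by fun_prop) (hslice δ ⟨hδ.1.le, hδ.2⟩))
      refine h1.aestronglyMeasurable.congr (Eventually.of_forall fun q => ?_)
      simp only [hφ]
      push_cast
      ring
    · filter_upwards [hev] with δ hδ
      refine Eventually.of_forall fun q => ?_
      rw [norm_mul, Complex.norm_real]
      by_cases hq : q ∈ tsupport η
      · exact mul_le_mul_of_nonneg_left (hC (δ, q) ⟨⟨hδ.1.le, hδ.2⟩, hq⟩) (norm_nonneg _)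
      · simp [hzero q hq]
    · refine Eventually.of_forall fun q => ?_
      by_cases hq : q ∈ tsupport η
      · have h0 : ContinuousWithinAt (fun δ : ℝ => b.regularMode k δ q) (Icc 0 1) 0 :=
          (b.continuousOn_regularMode hk).comp (f := fun δ : ℝ => (δ, q)) (by fun_prop)
            (fun δ hδ => ⟨hδ, hsub hq⟩) 0 (left_mem_Icc.2 zero_le_one)
        have h1 : Tendsto (fun δ : ℝ => b.regularMode k δ q) (𝓝[>] 0)
            (𝓝 (b.regularMode k 0 q)) := by
          refine h0.mono_left (le_inf nhdsWithin_le_nhds (le_principal_iff.2 ?_))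
          exact hev.mono fun δ hδ => ⟨hδ.1.le, hδ.2⟩
        exact h1.const_mul _
      · simp [hzero q hq]
  have heq := tendsto_nhds_unique hlim1 ((hlim2.const_mul (1 / (Real.sqrt (2 * π) : ℂ))).congr'
    (by
      filter_upwards [hev] with δ hδ
      exact (integral_regularised_packet b k hδ.1 hφi).symm))
  have e1 : incomingMomentum b.coord (wavePacket η) (-k) = (1 / (Real.sqrt (2 * π) : ℂ)) *
      ∫ y, Complex.exp (Complex.I * k * b.coord y) * packet φ y := by
    rw [incomingMomentum]
    congr 2
    funext y
    rw [wavePacket_eq_packet]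
    congr 2
    push_cast
    ring
  have hsq : (1 / (Real.sqrt (2 * π) : ℂ)) * (1 / (Real.sqrt (2 * π) : ℂ)) = 1 / (2 * π) := by
    rw [div_mul_div_comm, one_mul, ← Complex.ofReal_mul, Real.mul_self_sqrt (by positivity)]
    push_cast
    rfl
  rw [e1, heq, ← mul_assoc, hsq, ← integral_const_mul]
  refine integral_congr_ae (Eventually.of_forall fun q => ?_)
  dsimp only
  by_cases hq : q ∈ tsupport η
  · rw [← b.limitMode_eq (hsub hq)]
    simp only [hφ]
    push_cast
    ring
  · simp [hφ, image_eq_zero_of_notMem_tsupport hq]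

/-- In `s = log k` the measure is half of Lebesgue measure, and `s ≥ K` implies `e^s ≥ K`; a half
line has infinite length. -/
lemma lintegral_momentumMeasure_eq_top_of_large {h : ℝ → ℝ≥0∞} {c : ℝ≥0∞} (hc : c ≠ 0) {K : ℝ}
    (hK : ∀ k, K ≤ k → c ≤ h k) : ∫⁻ k, h k ∂momentumMeasure = ⊤ := by
  rw [lintegral_momentumMeasure_exp, eq_top_iff]
  calc (⊤ : ℝ≥0∞) = ∫⁻ _ in Ici K, ENNReal.ofReal (1 / 2) * c := by
        rw [setLIntegral_const, Real.volume_Ici, ENNReal.mul_top]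
        exact mul_ne_zero (by simp) hc
    _ ≤ ∫⁻ s in Ici K, ENNReal.ofReal (1 / 2) * h (rexp s) := by
        refine setLIntegral_mono' measurableSet_Ici fun s hs => ?_
        gcongr
        refine hK _ ?_
        have := Real.add_one_le_exp s
        have : K ≤ s := hs
        linarith
    _ ≤ _ := setLIntegral_le_lintegral _ _

lemma lintegral_momentumMeasure_eq_top_of_small {h : ℝ → ℝ≥0∞} {c : ℝ≥0∞} (hc : c ≠ 0) {K : ℝ}
    (hK0 : 0 < K) (hK : ∀ k, 0 < k → k ≤ K → c ≤ h k) : ∫⁻ k, h k ∂momentumMeasure = ⊤ := by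
  rw [lintegral_momentumMeasure_exp, eq_top_iff]
  calc (⊤ : ℝ≥0∞) = ∫⁻ _ in Iic (Real.log K), ENNReal.ofReal (1 / 2) * c := by
        rw [setLIntegral_const, Real.volume_Iic, ENNReal.mul_top]
        exact mul_ne_zero (by simp) hc
    _ ≤ ∫⁻ s in Iic (Real.log K), ENNReal.ofReal (1 / 2) * h (rexp s) := by
        refine setLIntegral_mono' measurableSet_Iic fun s hs => ?_
        gcongr
        exact hK _ (Real.exp_pos s) ((Real.le_log_iff_exp_le hK0).1 hs)
    _ ≤ _ := setLIntegral_le_lintegral _ _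

/-- At each `k` the amplitudes of the packets converge to the sharp amplitude, whose square has
infinite integral by `exists_le_norm_limitMode`. Fatou's lemma carries the divergence back to the
packets. -/
theorem tendsto_meanNumber_vacuum (b : BlackHole) {p : ℝ} (hp : 0 ≤ p) :
    Tendsto (fun η => meanNumber b.coord vacuum (wavePacket η)) (modeFilter p) (𝓝 ⊤) := by
  have hne := neBot_modeFilter hp
  obtain ⟨c, hc, hle⟩ := b.exists_le_norm_limitMode hp
  have htop : ∫⁻ k, ‖b.limitMode k p‖ₑ ^ 2 ∂momentumMeasure = ⊤ := by
    refine lintegral_momentumMeasure_eq_top_of_large (c := ENNReal.ofReal c ^ 2) (by simp [hc])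
      (K := max 1 p) fun k hk => ?_
    rw [← ofReal_norm]
    gcongr
    exact hle k hk
  -- a measurable version, for all `η`
  set Q : (ℝ → ℝ) → ℝ → ℝ≥0∞ := fun η k =>
    open Classical in if Integrable (wavePacket η) then
      ‖incomingMomentum b.coord (wavePacket η) (-k)‖ₑ ^ 2 else 0 with hQ
  have hQm : ∀ η, Measurable (Q η) := by
    intro η
    by_cases h : Integrable (wavePacket η)
    · simp only [hQ, h, if_true]
      have hc := continuous_incomingMomentum b.differentiable_coord.continuous.measurable h
      exact (hc.comp continuous_neg).measurable.enorm.pow_const 2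
    · simp only [hQ, h, if_false]
      exact measurable_const
  have hQe : ∀ᶠ η in modeFilter p, ∫⁻ k, Q η k ∂momentumMeasure =
      meanNumber b.coord vacuum (wavePacket η) := by
    filter_upwards [eventually_modeFilter p one_pos] with η hη
    simp only [hQ, integrable_wavePacket hη, if_true]
    exact (meanNumber_vacuum _ _).symm
  have hfatou := lintegral_liminf_le (μ := momentumMeasure) (u := modeFilter p) hQm
  have hptw : ∀ᵐ k ∂momentumMeasure, liminf (fun η => Q η k) (modeFilter p) =
      ‖b.limitMode k p‖ₑ ^ 2 := by
    filter_upwards [ae_momentumMeasure_pos] with k hk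
    refine Tendsto.liminf_eq ?_
    have h1 := tendsto_integral_modeFilter (p := p) (h := b.limitMode k)
      (fun q hq => (b.continuousAt_limitMode hk (le_of_lt hq)).continuousWithinAt)
      (b.continuousAt_limitMode hk hp)
    refine (ENNReal.Tendsto.pow (n := 2) h1.enorm).congr' ?_
    filter_upwards [eventually_modeFilter p one_pos] with η hη
    simp only [hQ, integrable_wavePacket hη, if_true]
    rw [incomingMomentum_wavePacket_neg b hk hη]
  rw [lintegral_congr_ae hptw, htop, top_le_iff] at hfatou
  have h2 : Tendsto (fun η => ∫⁻ k, Q η k ∂momentumMeasure) (modeFilter p) (𝓝 ⊤) := by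
    refine tendsto_of_le_liminf_of_limsup_le ?_ le_top
    rw [hfatou]
  exact h2.congr' hQe

/-! ### The range of the black-hole coordinates and the bound for each mode -/

lemma BlackHole.range_coord (b : BlackHole) : range b.coord = Iio 0 := by
  ext t
  constructor
  · rintro ⟨y, rfl⟩
    have h := Real.exp_pos (-y)
    cases b
    · exact neg_lt_zero.2 h
    · exact neg_lt_zero.2 (Real.log_pos (by linarith))
  · intro ht
    have ht' : t < 0 := ht
    cases b
    · exact ⟨-Real.log (-t), by rw [coord, neg_neg, Real.exp_log (by linarith), neg_neg]⟩
    · have h1 : 0 < rexp (-t) - 1 := by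
        have := Real.add_one_lt_exp (x := -t) (by linarith)
        linarith
      refine ⟨-Real.log (rexp (-t) - 1), ?_⟩
      rw [coord, neg_neg, Real.exp_log h1, add_sub_cancel, Real.log_exp, neg_neg]

lemma lintegral_enorm_outgoing (b : BlackHole) (g : ℝ → ℂ) :
    ∫⁻ y, ‖outgoing b.coord g y‖ₑ = ∫⁻ t in Iio (0 : ℝ), ‖g t‖ₑ := by
  have hinj : InjOn b.coord univ := (strictMono_of_deriv_pos b.deriv_coord_pos).injective.injOn
  rw [← b.range_coord, ← image_univ, lintegral_image_eq_lintegral_abs_deriv_mul (f' := deriv b.coord)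
    MeasurableSet.univ (fun y _ => (b.differentiable_coord y).hasDerivAt.hasDerivWithinAt) hinj,
    setLIntegral_univ]
  refine lintegral_congr fun y => ?_
  rw [outgoing, enorm_mul, ← ofReal_norm, Complex.norm_real, Real.norm_eq_abs]

lemma enorm_momentum_le {h : ℝ → ℂ} (hh : Integrable h) (k : ℝ) :
    ‖momentum h k‖ₑ ≤ ENNReal.ofReal (1 / Real.sqrt (2 * π)) * ∫⁻ y, ‖h y‖ₑ := by
  rw [← ofReal_integral_norm_eq_lintegral_enorm hh, ← ENNReal.ofReal_mul (by positivity),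
    ← ofReal_norm]
  exact ENNReal.ofReal_le_ofReal (norm_incomingMomentum_le _ _ _)

/-- The modulus of each transform is at most `(2π)^{-1/2}` times the `L¹` norm of the outgoing
function, which is that of `g` on the negative half line. Two squares give `2/(2π) = 1/π`. -/
lemma modeLimit_le_modeBound (b : BlackHole) {g : ℝ → ℂ} (hg : Integrable g) (p : ℝ) :
    modeLimit b.coord g p ≤ modeBound g := by
  have hh := integrable_outgoing b.differentiable_coord b.deriv_coord_pos hg
  have h1 := fun k => enorm_momentum_le hh k
  rw [lintegral_enorm_outgoing] at h1
  have hc : ENNReal.ofReal (1 / Real.sqrt (2 * π)) ^ 2 + ENNReal.ofReal (1 / Real.sqrt (2 * π)) ^ 2 =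
      ENNReal.ofReal (1 / π) := by
    rw [← ENNReal.ofReal_pow (by positivity), ← ENNReal.ofReal_add (by positivity) (by positivity),
      div_pow, Real.sq_sqrt (by positivity)]
    congr 1
    field_simp
    norm_num
  rw [modeLimit, modeBound, ← hc, add_mul, ← mul_pow]
  gcongr <;> exact h1 _

/-! ### Finiteness of the number of extra particles -/

lemma fourier_eq_momentum (f : ℝ → ℂ) (v : ℝ) :
    FourierTransform.fourier f v = (Real.sqrt (2 * π) : ℂ) * momentum f (2 * π * v) := by
  have h2 : (Real.sqrt (2 * π) : ℂ) ≠ 0 := Complex.ofReal_ne_zero.2 (by positivity)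
  rw [Real.fourier_eq', momentum, incomingMomentum, ← mul_assoc, mul_one_div_cancel h2, one_mul]
  refine integral_congr_ae (Eventually.of_forall fun t => ?_)
  simp only [RCLike.inner_apply, conj_trivial, id, smul_eq_mul]
  congr 2
  push_cast
  ring

/-- An integrable function whose Fourier transform is a Schwartz function agrees almost everywhere
with a Schwartz function. -/
lemma exists_schwartz_ae_eq {g : ℝ → ℂ} (hg : Integrable g) {γ : 𝓢(ℝ, ℂ)}
    (hγ : ∀ k, momentum g k = γ k) : ∃ S : 𝓢(ℝ, ℂ), g =ᵐ[volume] S := by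
  have h2 : 2 * π ≠ 0 := by positivity
  let e : ℝ ≃L[ℝ] ℝ := ContinuousLinearEquiv.smulLeft (Units.mk0 (2 * π) h2)
  set Γ : 𝓢(ℝ, ℂ) := (Real.sqrt (2 * π) : ℂ) • SchwartzMap.compCLMOfContinuousLinearEquiv ℂ e γ
  set S : 𝓢(ℝ, ℂ) := FourierTransform.fourierInv Γ
  have hS : FourierTransform.fourier (S : ℝ → ℂ) = FourierTransform.fourier g := by
    rw [← SchwartzMap.fourier_coe, FourierTransform.fourier_fourierInv_eq]
    funext v
    rw [fourier_eq_momentum, hγ]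
    rfl
  refine ⟨S, ae_eq_of_integral_contDiff_smul_eq hg.locallyIntegrable
    S.integrable.locallyIntegrable fun φ hφ hc => ?_⟩
  have hc' : HasCompactSupport fun q => (φ q : ℂ) := hc.comp_left (g := Complex.ofReal) rfl
  set Φ : 𝓢(ℝ, ℂ) := hc'.toSchwartzMap (Complex.ofRealCLM.contDiff.comp hφ)
  set ψ : 𝓢(ℝ, ℂ) := FourierTransform.fourierInv Φ
  have hψ : FourierTransform.fourier (ψ : ℝ → ℂ) = Φ := by
    rw [← SchwartzMap.fourier_coe, FourierTransform.fourier_fourierInv_eq]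
  -- Every test function is the transform of a Schwartz function, and the transform moves across the
  -- pairing. So equal transforms give equal pairings with all test functions.
  have key : ∀ f : ℝ → ℂ, Integrable f → ∫ t, φ t • f t =
      ∫ t, ψ t • FourierTransform.fourier f t := by
    intro f hf
    have h1 : ∫ t, FourierTransform.fourier (ψ : ℝ → ℂ) t • f t =
        ∫ t, ψ t • FourierTransform.fourier f t := by
      simpa using! (VectorFourier.integral_fourierIntegral_smul_eq_flip (L := innerₗ ℝ)
        Real.continuous_fourierChar continuous_inner ψ.integrable hf)
    rw [← h1, hψ]
    rfl
  rw [key g hg, key S S.integrable, hS]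

/-- Preimages of null sets under `x` are null because `x' > 0`. This allows `g` to be replaced by a
Schwartz representative. -/
lemma ae_comp_coord (b : BlackHole) {g₁ g₂ : ℝ → ℂ} (h : g₁ =ᵐ[volume] g₂) :
    outgoing b.coord g₁ =ᵐ[volume] outgoing b.coord g₂ := by
  have hinj : InjOn b.coord univ := (strictMono_of_deriv_pos b.deriv_coord_pos).injective.injOn
  obtain ⟨N, hN, hNm, hN0⟩ := exists_measurable_superset_of_null (ae_iff.1 h)
  have hm : MeasurableSet (b.coord ⁻¹' N) := b.differentiable_coord.continuous.measurable hNm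
  have h1 : ∫⁻ y, ENNReal.ofReal |deriv b.coord y| * N.indicator 1 (b.coord y) = 0 := by
    have := lintegral_image_eq_lintegral_abs_deriv_mul (f' := deriv b.coord)
      MeasurableSet.univ (fun y _ => (b.differentiable_coord y).hasDerivAt.hasDerivWithinAt) hinj
      (N.indicator 1)
    rw [setLIntegral_univ] at this
    rw [← this, ← le_zero_iff, ← hN0, ← lintegral_indicator_one hNm]
    exact setLIntegral_le_lintegral _ _
  rw [lintegral_eq_zero_iff (by
    have hd : Measurable (deriv b.coord) := measurable_deriv _
    have hi : Measurable (N.indicator (1 : ℝ → ℝ≥0∞)) := measurable_one.indicator hNm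
    exact (hd.abs.ennreal_ofReal).mul (hi.comp b.differentiable_coord.continuous.measurable))] at h1
  filter_upwards [h1] with y hy
  have hy' : b.coord y ∉ N := by
    intro hyN
    rw [Pi.zero_apply, mul_eq_zero, ENNReal.ofReal_eq_zero, indicator_of_mem hyN] at hy
    rcases hy with hy | hy
    · exact absurd (abs_pos.2 (b.deriv_coord_pos y).ne') (not_lt.2 hy)
    · simp at hy
  have : g₁ (b.coord y) = g₂ (b.coord y) := by
    by_contra hne
    exact hy' (hN hne)
  rw [outgoing, outgoing, this]

lemma momentum_congr_ae {h₁ h₂ : ℝ → ℂ} (h : h₁ =ᵐ[volume] h₂) (k : ℝ) :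
    momentum h₁ k = momentum h₂ k := by
  simp only [momentum, incomingMomentum]
  congr 1
  refine integral_congr_ae ?_
  filter_upwards [h] with t ht
  rw [ht]

/-- The coordinate maps onto the negative half line, so the total integral of the outgoing function
is `G(0)`. -/
lemma momentum_outgoing_zero (b : BlackHole) (g : ℝ → ℂ) :
    momentum (outgoing b.coord g) 0 = (1 / (Real.sqrt (2 * π) : ℂ)) * primitive g 0 := by
  have h := setIntegral_outgoing b.differentiable_coord b.deriv_coord_pos g MeasurableSet.univ
  rw [setIntegral_univ, image_univ, b.range_coord] at h
  rw [primitive, integral_Iic_eq_integral_Iio, ← h]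
  simp [momentum, incomingMomentum]

namespace BlackHole

lemma inv_invSlope_le (b : BlackHole) (y : ℝ) : (b.invSlope y)⁻¹ ≤ 1 + |b.coord y| := by
  cases b
  · simp only [invSlope, coord, abs_neg, Real.exp_neg]
    linarith [le_abs_self (rexp y)⁻¹]
  · have h1 : (cghs.invSlope y)⁻¹ ≤ 1 := by
      refine inv_le_one_of_one_le₀ ?_
      simp only [invSlope]
      linarith [Real.exp_pos y]
    linarith [abs_nonneg (cghs.coord y)]

lemma inv_invSlope_le_exp (b : BlackHole) (y : ℝ) : (b.invSlope y)⁻¹ ≤ rexp (-y) := by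
  rw [Real.exp_neg]
  exact inv_anti₀ (Real.exp_pos y) (b.exp_le_invSlope y)

lemma abs_le_abs_coord (b : BlackHole) {y : ℝ} (hy : y ≤ 0) : |y| ≤ |b.coord y| := by
  have h0 := Real.exp_pos (-y)
  rw [abs_of_nonpos hy]
  cases b
  · simp only [coord, abs_neg, Real.abs_exp]
    linarith [Real.add_one_le_exp (-y)]
  · rw [coord, abs_neg]
    refine le_trans ?_ (le_abs_self _)
    rw [Real.le_log_iff_exp_le (by positivity)]
    linarith

end BlackHole

lemma norm_outgoing (b : BlackHole) (g : ℝ → ℂ) (y : ℝ) :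
    ‖outgoing b.coord g y‖ = (b.invSlope y)⁻¹ * ‖g (b.coord y)‖ := by
  rw [outgoing, norm_mul, Complex.norm_real, b.deriv_coord,
    Real.norm_of_nonneg (inv_nonneg.2 (b.invSlope_pos y).le)]

lemma integrable_one_add_abs_mul (S : 𝓢(ℝ, ℂ)) :
    Integrable fun t => (((1 + |t|) * ‖S t‖ : ℝ) : ℂ) :=
  (SchwartzMap.integrable_one_add_abs_mul_norm S).ofReal

/-- For `y ≥ 0` the slope is at most `e^{-y}` and `S` is bounded. For `y ≤ 0` one has `|y| ≤
|x(y)|`, and the weight is absorbed by the first moment of `S`. -/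
lemma integrable_abs_mul_norm_outgoing (b : BlackHole) (S : 𝓢(ℝ, ℂ)) :
    Integrable fun y => |y| * ‖outgoing b.coord S y‖ := by
  obtain ⟨B, hB0, hB⟩ := S.decay 0 0
  simp only [pow_zero, one_mul, norm_iteratedFDeriv_zero] at hB
  have hout := integrable_outgoing b.differentiable_coord b.deriv_coord_pos S.integrable
  have h1 := (integrable_outgoing b.differentiable_coord b.deriv_coord_pos
    (integrable_one_add_abs_mul S)).norm
  have h2 := (integrable_exp_neg_mul_abs (δ := 1 / 2) (by norm_num)).const_mul (2 * B)
  refine (h2.add h1).mono' (continuous_abs.aestronglyMeasurable.mul hout.1.norm)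
    (Eventually.of_forall fun y => ?_)
  have hs0 := inv_nonneg.2 (b.invSlope_pos y).le
  rw [norm_mul, norm_norm, Real.norm_eq_abs, abs_abs]
  simp only [Pi.add_apply, norm_outgoing, Complex.norm_real]
  rw [Real.norm_of_nonneg (by positivity)]
  rcases le_total 0 y with hy | hy
  · have e1 : |y| * ((b.invSlope y)⁻¹ * ‖S (b.coord y)‖) ≤ |y| * (rexp (-y) * B) := by
      gcongr
      · exact b.inv_invSlope_le_exp y
      · exact hB _
    have e2 : |y| * rexp (-y) ≤ 2 * rexp (-(1 / 2 * |y|)) := by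
      rw [abs_of_nonneg hy]
      have h3 := Real.add_one_le_exp (1 / 2 * y)
      have h4 : rexp (-y) = rexp (-(1 / 2 * y)) * rexp (-(1 / 2 * y)) := by
        rw [← Real.exp_add]
        congr 1
        ring
      have h5 : rexp (1 / 2 * y) * rexp (-(1 / 2 * y)) = 1 := by
        rw [← Real.exp_add]
        simp
      have h6 := Real.exp_pos (-(1 / 2 * y))
      rw [h4]
      have h7 : y * rexp (-(1 / 2 * y)) ≤ 2 := by nlinarith
      nlinarith
    have e3 : 0 ≤ (b.invSlope y)⁻¹ * ((1 + |b.coord y|) * ‖S (b.coord y)‖) := by positivity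
    nlinarith
  · have e1 := b.abs_le_abs_coord hy
    have e2 : |y| * ((b.invSlope y)⁻¹ * ‖S (b.coord y)‖) ≤
        (b.invSlope y)⁻¹ * ((1 + |b.coord y|) * ‖S (b.coord y)‖) := by
      rw [mul_left_comm]
      gcongr
      linarith
    have e3 : 0 ≤ 2 * B * rexp (-(1 / 2 * |y|)) := by positivity
    linarith

/-- The derivative is `x'' · S(x) + x'² · S'(x)`. Since `|x''| ≤ x'` and `x' ≤ 1 + |x|`, it is
dominated by outgoing transforms of integrable functions. -/
lemma exists_deriv_outgoing (b : BlackHole) (S : 𝓢(ℝ, ℂ)) :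
    ∃ D : ℝ → ℂ, Integrable D ∧ ∀ y, HasDerivAt (outgoing b.coord S) (D y) y := by
  set T : 𝓢(ℝ, ℂ) := SchwartzMap.derivCLM ℂ ℂ S with hT
  have hd : ∀ y, HasDerivAt S (T y) y := fun y => by
    rw [hT, SchwartzMap.derivCLM_apply]
    exact (S.differentiableAt).hasDerivAt
  have hout : outgoing b.coord S = fun y => (((b.invSlope y)⁻¹ : ℝ) : ℂ) * S (b.coord y) := by
    funext y
    rw [outgoing, b.deriv_coord]
  have hinv : ∀ y, HasDerivAt (fun y => (b.invSlope y)⁻¹) (-rexp y / b.invSlope y ^ 2) y :=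
    fun y => (b.hasDerivAt_invSlope y).inv (b.invSlope_pos y).ne'
  have hsc : Continuous b.invSlope :=
    continuous_iff_continuousAt.2 fun y => (b.hasDerivAt_invSlope y).continuousAt
  have hcc := b.differentiable_coord.continuous
  refine ⟨fun y => ((-rexp y / b.invSlope y ^ 2 : ℝ) : ℂ) * S (b.coord y) +
    (((b.invSlope y)⁻¹ : ℝ) : ℂ) * ((((b.invSlope y)⁻¹ : ℝ) : ℂ) * T (b.coord y)), ?_, fun y => ?_⟩
  · have h1 := (integrable_outgoing b.differentiable_coord b.deriv_coord_pos S.integrable).norm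
    have h2 := (integrable_outgoing b.differentiable_coord b.deriv_coord_pos
      (integrable_one_add_abs_mul T)).norm
    refine (h1.add h2).mono' ?_ (Eventually.of_forall fun y => ?_)
    · apply Continuous.aestronglyMeasurable
      have hn : ∀ y, b.invSlope y ≠ 0 := fun y => (b.invSlope_pos y).ne'
      have hn2 : ∀ y, b.invSlope y ^ 2 ≠ 0 := fun y => pow_ne_zero 2 (hn y)
      have c1 : Continuous fun y => (b.invSlope y)⁻¹ := hsc.inv₀ hn
      have c2 : Continuous fun y => -rexp y / b.invSlope y ^ 2 :=
        Real.continuous_exp.neg.div (hsc.pow 2) hn2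
      have c3 := S.continuous
      have c4 := T.continuous
      fun_prop
    · have hs := b.invSlope_pos y
      have hs0 := inv_nonneg.2 hs.le
      refine (norm_add_le _ _).trans ?_
      simp only [Pi.add_apply, norm_outgoing, Complex.norm_real, norm_mul,
        Real.norm_of_nonneg hs0]
      rw [norm_norm, Real.norm_of_nonneg (show 0 ≤ 1 + |b.coord y| by positivity)]
      have e1 : ‖-rexp y / b.invSlope y ^ 2‖ ≤ (b.invSlope y)⁻¹ := by
        rw [norm_div, norm_neg, norm_pow, Real.norm_of_nonneg hs.le,
          Real.norm_of_nonneg (Real.exp_pos y).le, div_le_iff₀ (by positivity)]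
        calc rexp y ≤ b.invSlope y := b.exp_le_invSlope y
          _ = _ := by field_simp
      gcongr
      exact b.inv_invSlope_le y
  · rw [hout]
    have h1 := (hinv y).ofReal_comp.mul ((hd (b.coord y)).scomp y (b.hasDerivAt_coord y))
    refine h1.congr_deriv ?_
    simp only [Complex.real_smul, Function.comp]

lemma norm_momentum_le_of_zero {h : ℝ → ℂ} (hh : Integrable h)
    (hy : Integrable fun y => |y| * ‖h y‖) (h0 : momentum h 0 = 0) (p : ℝ) :
    ‖momentum h p‖ ≤ |p| * (∫ y, |y| * ‖h y‖) := by
  have hF0 : oscIntegral volume id h 0 = 0 :=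
    (mul_eq_zero.1 h0).resolve_left one_div_sqrt_two_pi_ne_zero
  have hc : ‖(1 / (Real.sqrt (2 * π) : ℂ))‖ ≤ 1 := by
    rw [norm_div, norm_one, Complex.norm_real, Real.norm_of_nonneg (Real.sqrt_nonneg _),
      div_le_one (by positivity)]
    exact Real.one_le_sqrt.2 (by linarith [Real.pi_gt_three])
  have e : oscIntegral volume id h p = oscIntegral volume id h p - oscIntegral volume id h 0 := by
    rw [hF0, sub_zero]
  rw [momentum, incomingMomentum_eq, norm_mul]
  refine (mul_le_of_le_one_left (norm_nonneg _) hc).trans ?_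
  rw [e, oscIntegral, oscIntegral, ← integral_sub (integrable_osc measurable_id hh p)
    (integrable_osc measurable_id hh 0), ← integral_const_mul]
  refine norm_integral_le_of_norm_le (hy.const_mul _) (Eventually.of_forall fun y => ?_)
  have h1 := Real.norm_exp_I_mul_ofReal_sub_one_le (x := -(p * y))
  rw [Real.norm_eq_abs, abs_neg, abs_mul] at h1
  rw [← sub_mul, norm_mul, ← mul_assoc]
  refine mul_le_mul_of_nonneg_right (le_trans (le_of_eq ?_) h1) (norm_nonneg _)
  simp only [id]
  push_cast
  rw [mul_zero, zero_mul, neg_zero, Complex.exp_zero]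
  congr 3
  ring

lemma norm_momentum_le_of_deriv {h D : ℝ → ℂ} (hh : Integrable h) (hD : Integrable D)
    (hd : ∀ y, HasDerivAt h (D y) y) (p : ℝ) : |p| * ‖momentum h p‖ ≤ ∫ y, ‖D y‖ := by
  have hc : ‖(1 / (Real.sqrt (2 * π) : ℂ))‖ ≤ 1 := by
    rw [norm_div, norm_one, Complex.norm_real, Real.norm_of_nonneg (Real.sqrt_nonneg _),
      div_le_one (by positivity)]
    exact Real.one_le_sqrt.2 (by linarith [Real.pi_gt_three])
  have i1 := integrable_osc (ν := volume) (X := id) measurable_id hh p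
  have i2 := integrable_osc (ν := volume) (X := id) measurable_id hD p
  have hder : ∀ y : ℝ, HasDerivAt (fun y => Complex.exp (-(Complex.I * p * (id y : ℝ))) * h y)
      (-(Complex.I * p) * (Complex.exp (-(Complex.I * p * (id y : ℝ))) * h y) +
        Complex.exp (-(Complex.I * p * (id y : ℝ))) * D y) y := by
    intro y
    have h1 : HasDerivAt (fun y : ℝ => -(Complex.I * p * (y : ℂ))) (-(Complex.I * p)) y := by
      simpa using ((Complex.ofRealCLM.hasDerivAt (x := y)).const_mul (-(Complex.I * p)))
    refine (h1.cexp.mul (hd y)).congr_deriv ?_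
    simp only [id]
    ring
  have hz := integral_eq_zero_of_hasDerivAt_of_integrable hder
    ((i1.const_mul _).add i2) i1
  rw [integral_add (i1.const_mul _) i2, integral_const_mul] at hz
  have hF : Complex.I * p * oscIntegral volume id h p = oscIntegral volume id D p := by
    rw [oscIntegral, oscIntegral]
    linear_combination -hz
  have hn := congrArg norm hF
  rw [norm_mul, norm_mul, Complex.norm_I, one_mul, Complex.norm_real, Real.norm_eq_abs] at hn
  rw [momentum, incomingMomentum_eq, norm_mul]
  calc |p| * (‖(1 / (Real.sqrt (2 * π) : ℂ))‖ * ‖oscIntegral volume id h p‖) ≤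
      |p| * (1 * ‖oscIntegral volume id h p‖) := by gcongr
    _ = ‖oscIntegral volume id D p‖ := by rw [one_mul, hn]
    _ ≤ _ := norm_oscIntegral_le p

/-- With `|p| = e^s`, the zero at `p = 0` and a finite first moment give `O(e^s)` for `s ≤ 0`, and
an integrable derivative gives `O(e^{-s})` for `s ≥ 0`. The squares are integrable in `s`. -/
lemma lintegral_modeLimit_lt_top (b : BlackHole) (S : 𝓢(ℝ, ℂ))
    (h0 : momentum (outgoing b.coord S) 0 = 0) :
    ∫⁻ p, modeLimit b.coord S p ∂momentumMeasure < ⊤ := by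
  have hh := integrable_outgoing b.differentiable_coord b.deriv_coord_pos S.integrable
  obtain ⟨D, hD, hd⟩ := exists_deriv_outgoing b S
  set h := outgoing b.coord S
  set C := max (∫ y, |y| * ‖h y‖) (∫ y, ‖D y‖)
  have hC0 : 0 ≤ C := le_max_of_le_right (integral_nonneg fun y => norm_nonneg _)
  have hb : ∀ s p : ℝ, |p| = rexp s → ‖momentum h p‖ₑ ^ 2 ≤
      ENNReal.ofReal (C ^ 2 * rexp (-(2 * |s|))) := by
    intro s p hp
    rw [← ofReal_norm, ← ENNReal.ofReal_pow (norm_nonneg _)]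
    refine ENNReal.ofReal_le_ofReal ?_
    have e : rexp (-(2 * |s|)) = rexp (-|s|) ^ 2 := by
      rw [← Real.exp_nat_mul]
      congr 1
      push_cast
      ring
    rw [e, ← mul_pow]
    refine pow_le_pow_left₀ (norm_nonneg _) ?_ 2
    rcases le_total 0 s with hs | hs
    · have h1 := norm_momentum_le_of_deriv hh hD hd p
      rw [hp] at h1
      rw [abs_of_nonneg hs, Real.exp_neg, ← div_eq_mul_inv, le_div_iff₀ (Real.exp_pos s), mul_comm]
      exact h1.trans (le_max_right _ _)
    · have h1 := norm_momentum_le_of_zero hh (integrable_abs_mul_norm_outgoing b S) h0 p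
      rw [hp] at h1
      rw [abs_of_nonpos hs, neg_neg, mul_comm]
      exact h1.trans (mul_le_mul_of_nonneg_left (le_max_left _ _) (Real.exp_pos s).le)
  rw [lintegral_momentumMeasure_exp]
  refine lt_of_le_of_lt (lintegral_mono fun s => ?_)
    ((integrable_exp_neg_mul_abs (δ := 2) (by norm_num)).const_mul (C ^ 2)).lintegral_lt_top
  have e1 := hb s (rexp s) (Real.abs_exp s)
  have e2 := hb s (-rexp s) (by rw [abs_neg, Real.abs_exp])
  calc ENNReal.ofReal (1 / 2) * modeLimit b.coord S (rexp s) ≤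
      ENNReal.ofReal (1 / 2) * (ENNReal.ofReal (C ^ 2 * rexp (-(2 * |s|))) +
        ENNReal.ofReal (C ^ 2 * rexp (-(2 * |s|)))) := by
        rw [modeLimit]
        gcongr
    _ = _ := by
        rw [← ENNReal.ofReal_add (by positivity) (by positivity),
          ← ENNReal.ofReal_mul (by norm_num)]
        congr 1
        ring

/-- By continuity the transform stays away from zero near `p = 0`, where `dp/2p` has infinite mass.
-/
lemma lintegral_modeLimit_eq_top (b : BlackHole) {g : ℝ → ℂ} (hg : Integrable g)
    (h0 : momentum (outgoing b.coord g) 0 ≠ 0) :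
    ∫⁻ p, modeLimit b.coord g p ∂momentumMeasure = ⊤ := by
  have hc := continuous_momentum_outgoing b.differentiable_coord b.deriv_coord_pos hg
  set m := momentum (outgoing b.coord g)
  have hev : ∀ᶠ p in 𝓝 (0 : ℝ), ‖m 0‖ / 2 < ‖m p‖ :=
    hc.norm.continuousAt.eventually_const_lt (half_lt_self (norm_pos_iff.2 h0))
  obtain ⟨ε, hε, hball⟩ := Metric.eventually_nhds_iff.1 hev
  refine lintegral_momentumMeasure_eq_top_of_small (c := ENNReal.ofReal (‖m 0‖ / 2) ^ 2)
    (by simpa using h0) (half_pos hε) fun p hp hle => ?_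
  refine le_trans ?_ le_self_add
  rw [← ofReal_norm]
  gcongr
  exact (hball (by rw [Real.dist_eq, sub_zero, abs_of_pos hp]; linarith)).le

lemma lintegral_modeLimit_lt_top_iff (b : BlackHole) {g : ℝ → ℂ} (hg : Integrable g)
    {γ : 𝓢(ℝ, ℂ)} (hγ : ∀ k, momentum g k = γ k) :
    ∫⁻ p, modeLimit b.coord g p ∂momentumMeasure < ⊤ ↔ primitive g 0 = 0 := by
  have hiff : momentum (outgoing b.coord g) 0 = 0 ↔ primitive g 0 = 0 := by
    rw [momentum_outgoing_zero, mul_eq_zero, or_iff_right one_div_sqrt_two_pi_ne_zero]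
  rw [← hiff]
  constructor
  · intro h
    by_contra h0
    rw [lintegral_modeLimit_eq_top b hg h0] at h
    exact lt_irrefl _ h
  · intro h0
    obtain ⟨S, hS⟩ := exists_schwartz_ae_eq hg hγ
    have hm := momentum_congr_ae (ae_comp_coord b hS)
    have := lintegral_modeLimit_lt_top b S (by rw [← hm, h0])
    simpa only [modeLimit, hm] using this

/-! ### Mode numbers and total numbers for black holes -/

lemma modeNumber_vacuum (b : BlackHole) {p : ℝ} (hp : 0 ≤ p) :
    modeNumber b.coord vacuum p = ⊤ := by
  have := neBot_modeFilter hp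
  exact (tendsto_meanNumber_vacuum b hp).limsup_eq

lemma tendsto_meanNumber_oneParticle (b : BlackHole) {g : ℝ → ℂ} (hg : IsIncomingWave g) {p : ℝ}
    (hp : 0 ≤ p) :
    Tendsto (fun η => meanNumber b.coord (oneParticle g) (wavePacket η)) (modeFilter p) (𝓝 ⊤) := by
  refine ((tendsto_meanNumber_vacuum b hp).add (tendsto_extraPart b.differentiable_coord
    b.deriv_coord_pos hg.integrable p)).congr' ?_ |>.trans_eq ?_
  · filter_upwards [eventually_meanNumber b.differentiable_coord hg p] with η hη using hη.symm
  · rw [top_add]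

/-- The vacuum number of each proper packet is finite and cancels before the limit is taken,
although it tends to infinity for `p ≥ 0`. -/
lemma tendsto_extraNumber (b : BlackHole) {g : ℝ → ℂ} (hg : IsIncomingWave g) (p : ℝ) :
    Tendsto (fun η => extraNumber b.coord (oneParticle g) (wavePacket η)) (modeFilter p)
      (𝓝 (modeLimit b.coord g p : EReal)) := by
  have h := (continuous_coe_ennreal_ereal.tendsto _).comp (tendsto_extraPart
    b.differentiable_coord b.deriv_coord_pos hg.integrable p)
  refine h.congr' ?_
  filter_upwards [eventually_meanNumber b.differentiable_coord hg p,
    eventually_modeFilter p one_pos] with η h1 h2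
  have hfin := (meanNumber_vacuum_lt_top b h2).ne
  rw [extraNumber, h1, Function.comp, EReal.coe_ennreal_add, add_comm]
  lift meanNumber b.coord vacuum (wavePacket η) to NNReal using hfin with a
  exact (EReal.add_sub_cancel_right (a := _) (b := a)).symm

lemma modeExtra_oneParticle (b : BlackHole) {g : ℝ → ℂ} (hg : IsIncomingWave g) {p : ℝ}
    (hp : 0 ≤ p) : modeExtra b.coord (oneParticle g) p = modeLimit b.coord g p := by
  have := neBot_modeFilter hp
  exact (tendsto_extraNumber b hg p).limsup_eq

lemma totalExtra_oneParticle (b : BlackHole) {g : ℝ → ℂ} (hg : IsIncomingWave g) :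
    totalExtra b.coord (oneParticle g) = ∫⁻ p, modeLimit b.coord g p ∂momentumMeasure := by
  refine lintegral_congr_ae ?_
  filter_upwards [ae_momentumMeasure_pos] with p hp
  rw [modeExtra_oneParticle b hg hp.le, EReal.toENNReal_coe]

lemma totalNumber_vacuum (b : BlackHole) : totalNumber b.coord vacuum = ⊤ := by
  have h : ∀ᵐ p ∂momentumMeasure, modeNumber b.coord vacuum p = ⊤ := by
    filter_upwards [ae_momentumMeasure_pos] with p hp using modeNumber_vacuum b hp.le
  rw [totalNumber, lintegral_congr_ae h]
  exact lintegral_momentumMeasure_eq_top_of_large (c := ⊤) (by simp) (K := 0) fun _ _ => le_rfl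

end StimulatedEmission

end

/-! ### Assembly of the theorem -/

theorem mainTheorem11 (g : ℝ → ℂ) (hg : IsIncomingWave g) :
    (∀ b : BlackHole,
      -- the mode numbers exist as limits, and the bound for each outgoing mode
      (∀ p : ℝ, 0 ≤ p →
        Tendsto (fun η => meanNumber b.coord vacuum (wavePacket η)) (modeFilter p)
          (𝓝 (modeNumber b.coord vacuum p)) ∧
        Tendsto (fun η => meanNumber b.coord (oneParticle g) (wavePacket η)) (modeFilter p)
          (𝓝 (modeNumber b.coord (oneParticle g) p)) ∧
        modeNumber b.coord (oneParticle g) p ≤ modeNumber b.coord vacuum p + modeBound g ∧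
        Tendsto (fun η => extraNumber b.coord (oneParticle g) (wavePacket η)) (modeFilter p)
          (𝓝 (modeExtra b.coord (oneParticle g) p)) ∧
        0 ≤ modeExtra b.coord (oneParticle g) p ∧
        modeExtra b.coord (oneParticle g) p ≤ (modeBound g : EReal)) ∧
      -- the total numbers
      totalNumber b.coord (oneParticle g) =
        totalNumber b.coord vacuum + momentumNormSq (momentum (outgoing b.coord g)) ∧
      totalExtra b.coord (oneParticle g) = momentumNormSq (momentum (outgoing b.coord g)) ∧
      totalNumber b.coord (oneParticle g) = ⊤ ∧
      ((∃ γ : 𝓢(ℝ, ℂ), ∀ k, momentum g k = γ k) →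
        (totalExtra b.coord (oneParticle g) < ⊤ ↔ primitive g 0 = 0))) ∧
    -- the equation for the total numbers holds for all changes of coordinates
    (∀ x : ℝ → ℝ, ContDiff ℝ ∞ x → (∀ y, 0 < deriv x y) →
      totalNumber x (oneParticle g) =
        totalNumber x vacuum + momentumNormSq (momentum (outgoing x g))) := by
  refine ⟨fun b => ⟨fun p hp => ⟨?_, ?_, ?_, ?_, ?_, ?_⟩, ?_, ?_, ?_, ?_⟩, fun x hx hpos =>
    totalNumber_oneParticle (hx.differentiable (by simp)) hpos hg⟩
  · rw [modeNumber_vacuum b hp]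
    exact tendsto_meanNumber_vacuum b hp
  · rw [modeNumber_oneParticle b.differentiable_coord b.deriv_coord_pos hg hp,
      modeNumber_vacuum b hp, top_add]
    exact tendsto_meanNumber_oneParticle b hg hp
  · rw [modeNumber_oneParticle b.differentiable_coord b.deriv_coord_pos hg hp]
    gcongr
    exact modeLimit_le_modeBound b hg.integrable p
  · rw [modeExtra_oneParticle b hg hp]
    exact tendsto_extraNumber b hg p
  · rw [modeExtra_oneParticle b hg hp]
    exact EReal.coe_ennreal_nonneg _
  · rw [modeExtra_oneParticle b hg hp]
    exact EReal.coe_ennreal_le_coe_ennreal_iff.2 (modeLimit_le_modeBound b hg.integrable p)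
  · exact totalNumber_oneParticle b.differentiable_coord b.deriv_coord_pos hg
  · rw [totalExtra_oneParticle b hg]
    exact lintegral_modeLimit b.differentiable_coord b.deriv_coord_pos hg.integrable
  · rw [totalNumber_oneParticle b.differentiable_coord b.deriv_coord_pos hg,
      totalNumber_vacuum b, top_add]
  · rintro ⟨γ, hγ⟩
    rw [totalExtra_oneParticle b hg]
    exact lintegral_modeLimit_lt_top_iff b hg.integrable hγ
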